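/- Let $k$ be a field of characteristic $p>0$, let $X$ be a smooth variety over $k$ (an integral, separated scheme of finite type, smooth over $k$), and let $f\in\Gamma(X,\mathcal O_X)$ be a function that is not a constant (not in the image of $k$). *The $b$-function.* For $e\ge 0$ let $\nu_e=\partial_t^{[p^e]}t^{p^e}$, where $\partial_t^{[m]}t^l=\binom{l}{m}t^{l-m}$. Let $k[\binom{s}{p^0},\binom{s}{p^1},\dots]$ be the (commutative) $k$-subalgebra generated by the $\nu_e$ in the ring of differential operators of the affine line over $k$, where $\binom{s}{p^e}:=-\nu_e$. Its maximal ideals are in bijection with $\mathbb Z_p$: the $p$-adic integer $\alpha=\sum_e\alpha_ep^e$, $\alpha_e\in\{0,\dots,p-1\}$, corresponds to the maximal ideal generated by all $\binom{s}{p^e}-\alpha_e$. The *roots* of an ideal $I$ of this algebra are the $\alpha\in\mathbb Z_p$ whose maximal ideal contains $I$. For $X=\operatorname{Spec}R$ affine, the ring $D_{R[t]}$ of $k$-linear Grothendieck differential operators of $R[t]$ acts on $B_f=R[t]_{f-t}/R[t]$. Let $\delta$ be the class of $\frac1{f-t}$, let $M_f=D_R[\nu_e;\,e\ge0]\,\delta\subset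 B_f$, and let $N_f=M_f/tM_f$. For general $X$ the $N_f$ of the affine open subsets glue to a sheaf $N_f$. The *$b$-function* $b_f$ is the annihilator of $N_f$ in $k[\binom{s}{p^0},\binom{s}{p^1},\dots]$. *$F$-jumping exponents.* For real $\lambda\ge0$ the test ideal $\tau(f^\lambda)\subset\mathcal O_X$ is given, on affine open subsets, by the union of the increasing sequence of ideals $(f^{\lceil\lambda p^e\rceil})^{[1/p^e]}$, $e\ge0$, where $(g)^{[1/p^e]}$ is the smallest ideal $J$ such that $g\in J^{[p^e]}$, and $J^{[p^e]}$ is the ideal generated by the $p^e$-th powers of the elements of $J$. A real number $\lambda>0$ is an *$F$-jumping exponent* of $f$ if $\tau(f^{\lambda-\varepsilon})\ne\tau(f^\lambda)$ for all $0<\varepsilon\le\lambda$. **Theorem.** The set of roots of $b_f$ is $$\{-\lambda \;:\; \lambda\in(0,1]\cap\mathbb Z_{(p)},\ \lambda \text{ an } F\text{-jumping exponent of } f\}\subset\mathbb Z_p .$$ -/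

import Mathlib

open Polynomial TensorProduct AlgebraicGeometry

universe u

noncomputable section

namespace CharPBFunction

/-! ### Grothendieck differential operators -/

section DiffOps

/-- The commutator `[P, a]` of a `k`-linear endomorphism of `A` with multiplication by `a`. -/
def bracket {k A : Type*} [CommRing k] [CommRing A] [Algebra k A]
    (P : Module.End k A) (a : A) : Module.End k A :=
  P * Algebra.lmul k A a - Algebra.lmul k A a * P

theorem bracket_apply {k A : Type*} [CommRing k] [CommRing A] [Algebra k A]
    (P : Module.End k A) (a b : A) : bracket P a b = P (a * b) - a * P b := by
  simp [bracket]

/-- `diffOpFiltration k A n` is the space of `k`-linear differential operators on `A` of order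
`< n` in the sense of Grothendieck: only `0` has order `< 0`, and `P` has order `< n + 1` iff all
commutators `[P, a]`, `a ∈ A`, have order `< n`. -/
def diffOpFiltration (k A : Type*) [CommRing k] [CommRing A] [Algebra k A] :
    ℕ → Submodule k (Module.End k A)
  | 0 => ⊥
  | n + 1 =>
    { carrier := {P | ∀ a : A, bracket P a ∈ diffOpFiltration k A n}
      add_mem' := by
        intro P Q hP hQ a
        have : bracket (P + Q) a = bracket P a + bracket Q a := by
          simp only [bracket]; noncomm_ring
        rw [this]
        exact add_mem (hP a) (hQ a)
      zero_mem' := by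
        intro a
        have : bracket (0 : Module.End k A) a = 0 := by simp [bracket]
        rw [this]
        exact zero_mem _
      smul_mem' := by
        intro c P hP a
        have : bracket (c • P) a = c • bracket P a := by
          ext b; simp [bracket_apply, smul_sub]
        rw [this]
        exact Submodule.smul_mem _ c (hP a) }

variable {k A : Type*} [CommRing k] [CommRing A] [Algebra k A]

theorem mem_diffOpFiltration_zero {P : Module.End k A} :
    P ∈ diffOpFiltration k A 0 ↔ P = 0 := by
  simp [diffOpFiltration]

theorem mem_diffOpFiltration_succ {n : ℕ} {P : Module.End k A} :
    P ∈ diffOpFiltration k A (n + 1) ↔ ∀ a : A, bracket P a ∈ diffOpFiltration k A n :=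
  Iff.rfl

theorem bracket_zero (a : A) : bracket (0 : Module.End k A) a = 0 := by simp [bracket]

theorem diffOpFiltration_le_succ (n : ℕ) :
    diffOpFiltration k A n ≤ diffOpFiltration k A (n + 1) := by
  induction n with
  | zero =>
    intro P hP a
    rw [mem_diffOpFiltration_zero] at hP
    subst hP
    rw [bracket_zero]
    exact zero_mem _
  | succ n ih => exact fun P hP a => ih (hP a)

theorem diffOpFiltration_mono : Monotone (diffOpFiltration k A) :=
  monotone_nat_of_le_succ diffOpFiltration_le_succ

theorem mul_mem_diffOpFiltration (m n : ℕ) {P Q : Module.End k A}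
    (hP : P ∈ diffOpFiltration k A m) (hQ : Q ∈ diffOpFiltration k A n) :
    P * Q ∈ diffOpFiltration k A (m + n) := by
  induction h : m + n generalizing m n P Q with
  | zero =>
    obtain rfl : m = 0 := by omega
    rw [mem_diffOpFiltration_zero] at hP ⊢
    simp [hP]
  | succ N ih =>
    cases m with
    | zero =>
      rw [mem_diffOpFiltration_zero] at hP
      simp [hP]
    | succ m =>
      cases n with
      | zero =>
        rw [mem_diffOpFiltration_zero] at hQ
        simp [hQ]
      | succ n =>
        intro a
        have : bracket (P * Q) a = P * bracket Q a + bracket P a * Q := by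
          ext c; simp [bracket_apply]
        rw [this]
        exact add_mem (ih (m + 1) n hP (hQ a) (by omega)) (ih m (n + 1) (hP a) hQ (by omega))

theorem lmul_mem_diffOpFiltration (a : A) : Algebra.lmul k A a ∈ diffOpFiltration k A 1 := by
  intro b
  rw [mem_diffOpFiltration_zero]
  ext c
  simp [bracket_apply]
  ring

theorem lmul_mul_mem {n : ℕ} {P : Module.End k A} (hP : P ∈ diffOpFiltration k A n) (a : A) :
    Algebra.lmul k A a * P ∈ diffOpFiltration k A n := by
  induction n generalizing P with
  | zero =>
    rw [mem_diffOpFiltration_zero] at hP ⊢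
    simp [hP]
  | succ n ih =>
    intro b
    have : bracket (Algebra.lmul k A a * P) b = Algebra.lmul k A a * bracket P b := by
      ext c; simp [bracket_apply]; ring
    rw [this]
    exact ih (hP b)

theorem mul_lmul_mem {n : ℕ} {P : Module.End k A} (hP : P ∈ diffOpFiltration k A n) (a : A) :
    P * Algebra.lmul k A a ∈ diffOpFiltration k A n := by
  induction n generalizing P with
  | zero =>
    rw [mem_diffOpFiltration_zero] at hP ⊢
    simp [hP]
  | succ n ih =>
    intro b
    have : bracket (P * Algebra.lmul k A a) b = bracket P b * Algebra.lmul k A a := by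
      ext c; simp [bracket_apply, mul_left_comm]
    rw [this]
    exact ih (hP b)

theorem bracket_add_right (P : Module.End k A) (a b : A) :
    bracket P (a + b) = bracket P a + bracket P b := by
  ext c; simp [bracket_apply, add_mul]; ring

theorem bracket_mul_right (P : Module.End k A) (a b : A) :
    bracket P (a * b) = bracket P a * Algebra.lmul k A b + Algebra.lmul k A a * bracket P b := by
  ext c; simp [bracket_apply, mul_assoc]; ring

end DiffOps

/-- The `k`-linear differential operators on the commutative `k`-algebra `A`, of all orders, as a
subalgebra of the `k`-linear endomorphisms of `A`. -/
def diffOpSubalgebra (k A : Type*) [CommRing k] [CommRing A] [Algebra k A] :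
    Subalgebra k (Module.End k A) where
  carrier := {P | ∃ n, P ∈ diffOpFiltration k A n}
  mul_mem' := by
    rintro P Q ⟨m, hm⟩ ⟨n, hn⟩
    exact ⟨m + n, mul_mem_diffOpFiltration m n hm hn⟩
  add_mem' := by
    rintro P Q ⟨m, hm⟩ ⟨n, hn⟩
    exact ⟨max m n, add_mem (diffOpFiltration_mono (le_max_left m n) hm)
      (diffOpFiltration_mono (le_max_right m n) hn)⟩
  algebraMap_mem' := by
    intro c
    refine ⟨1, fun a => ?_⟩
    rw [mem_diffOpFiltration_zero]
    ext b
    simp [bracket_apply]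

/-- The ring of all `k`-linear differential operators on the commutative `k`-algebra `A`
(Grothendieck's ring of differential operators of `Spec A` over `k`). -/
def DiffOp (k A : Type*) [CommRing k] [CommRing A] [Algebra k A] : Type _ :=
  diffOpSubalgebra k A

instance DiffOp.instRing (k A : Type*) [CommRing k] [CommRing A] [Algebra k A] :
    Ring (DiffOp k A) :=
  inferInstanceAs (Ring (diffOpSubalgebra k A))

instance DiffOp.instAlgebra (k A : Type*) [CommRing k] [CommRing A] [Algebra k A] :
    Algebra k (DiffOp k A) :=
  inferInstanceAs (Algebra k (diffOpSubalgebra k A))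

/-- The action of differential operators on functions. -/
def DiffOp.toEnd (k A : Type*) [CommRing k] [CommRing A] [Algebra k A] :
    DiffOp k A →ₐ[k] Module.End k A :=
  (diffOpSubalgebra k A).val

/-- A `k`-linear endomorphism of finite order, as a differential operator. -/
def DiffOp.mk {k A : Type*} [CommRing k] [CommRing A] [Algebra k A] (P : Module.End k A)
    (hP : ∃ n, P ∈ diffOpFiltration k A n) : DiffOp k A :=
  Subtype.mk (p := fun P => P ∈ diffOpSubalgebra k A) P hP

theorem DiffOp.toEnd_mk {k A : Type*} [CommRing k] [CommRing A] [Algebra k A]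
    (P : Module.End k A) (hP : ∃ n, P ∈ diffOpFiltration k A n) :
    DiffOp.toEnd k A (DiffOp.mk P hP) = P :=
  rfl

theorem DiffOp.exists_order {k A : Type*} [CommRing k] [CommRing A] [Algebra k A]
    (P : DiffOp k A) : ∃ n, DiffOp.toEnd k A P ∈ diffOpFiltration k A n :=
  P.2

theorem DiffOp.toEnd_injective (k A : Type*) [CommRing k] [CommRing A] [Algebra k A] :
    Function.Injective (DiffOp.toEnd k A) :=
  Subtype.val_injective

/-- Multiplication by `a`, as a differential operator. -/
def DiffOp.mulBy (k : Type*) {A : Type*} [CommRing k] [CommRing A] [Algebra k A] (a : A) :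
    DiffOp k A :=
  DiffOp.mk (Algebra.lmul k A a) ⟨1, lmul_mem_diffOpFiltration a⟩

/-- An algebra homomorphism to `Module.End k A` with values of finite order lands in the ring of
differential operators. -/
def DiffOp.codRestrict {k A B : Type*} [CommRing k] [CommRing A] [Algebra k A] [Ring B]
    [Algebra k B] (φ : B →ₐ[k] Module.End k A)
    (h : ∀ b, ∃ n, φ b ∈ diffOpFiltration k A n) : B →ₐ[k] DiffOp k A :=
  AlgHom.codRestrict φ (diffOpSubalgebra k A) h

/-! ### The action of differential operators on a localization -/

section Localize

/-- To bound the order of an operator on a localization, it suffices to commute it with the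
elements coming from the base. -/
theorem mem_succ_of_localization {k A : Type*} [CommRing k] [CommRing A] [Algebra k A]
    (M : Submonoid A) {L : Type*} [CommRing L] [Algebra A L] [Algebra k L]
    [IsLocalization M L] {n : ℕ} {Q : Module.End k L}
    (hQ : ∀ a : A, bracket Q (algebraMap A L a) ∈ diffOpFiltration k L n) :
    Q ∈ diffOpFiltration k L (n + 1) := by
  intro l
  obtain ⟨a, s, rfl⟩ := IsLocalization.exists_mk'_eq M l
  have key : bracket Q (IsLocalization.mk' L a s) =
      Algebra.lmul k L (IsLocalization.mk' L 1 s) *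
        (bracket Q (algebraMap A L a) -
          bracket Q (algebraMap A L s) * Algebra.lmul k L (IsLocalization.mk' L a s)) := by
    have hu : IsLocalization.mk' L 1 s * algebraMap A L s = 1 := by
      rw [IsLocalization.mk'_spec]; simp
    have ha : algebraMap A L a = algebraMap A L s * IsLocalization.mk' L a s := by
      rw [mul_comm, IsLocalization.mk'_spec]
    rw [ha]
    ext c
    simp only [bracket_apply, Module.End.mul_apply, LinearMap.sub_apply, Algebra.coe_lmul_eq_mul,
      LinearMap.mul_apply', mul_assoc]
    linear_combination (-Q (IsLocalization.mk' L a s * c)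
      + IsLocalization.mk' L a s * Q c) * hu
  rw [key]
  exact lmul_mul_mem (sub_mem (hQ a) (mul_lmul_mem (hQ s) _)) _

/-- A differential operator on a localization is determined by its restriction to the base. -/
theorem ext_of_localization {k A : Type*} [CommRing k] [CommRing A] [Algebra k A]
    (M : Submonoid A) {L : Type*} [CommRing L] [Algebra A L] [Algebra k L]
    [IsLocalization M L] {n : ℕ} {Q : Module.End k L}
    (hQ : Q ∈ diffOpFiltration k L n) (h : ∀ a : A, Q (algebraMap A L a) = 0) : Q = 0 := by
  induction n generalizing Q with
  | zero => exact mem_diffOpFiltration_zero.1 hQ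
  | succ n ih =>
    ext x
    obtain ⟨a, s, rfl⟩ := IsLocalization.exists_mk'_eq M x
    have h0 : bracket Q (algebraMap A L s) = 0 := by
      refine ih (hQ _) fun b => ?_
      rw [bracket_apply, ← map_mul, h, h, mul_zero, sub_zero]
    have h1 := bracket_apply Q (algebraMap A L s) (IsLocalization.mk' L a s)
    rw [h0, IsLocalization.mk'_spec', h, LinearMap.zero_apply, zero_sub, eq_comm,
      neg_eq_zero] at h1
    simpa using ((IsLocalization.map_units L s).mul_right_eq_zero).1 h1

/-- Every differential operator extends (uniquely, by `ext_of_localization`) to a differential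
operator on a localization at nonzerodivisors. -/
theorem exists_extension {k A : Type*} [CommRing k] [CommRing A] [Algebra k A]
    (M : Submonoid A) (hM : M ≤ nonZeroDivisors A) (L : Type*) [CommRing L] [Algebra A L]
    [Algebra k L] [IsScalarTower k A L] [IsLocalization M L] {n : ℕ} {P : Module.End k A}
    (hP : P ∈ diffOpFiltration k A n) :
    ∃ Q ∈ diffOpFiltration k L n, ∀ a : A, Q (algebraMap A L a) = algebraMap A L (P a) := by
  have hinj : Function.Injective (algebraMap A L) := IsLocalization.injective L hM
  induction n generalizing P with
  | zero =>
    rw [mem_diffOpFiltration_zero] at hP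
    subst hP
    exact ⟨0, zero_mem _, by simp⟩
  | succ n ih =>
    choose E hE hE' using fun a : A => ih (hP a)
    have hsymm : ∀ a b : A, bracket (E a) (algebraMap A L b) = bracket (E b) (algebraMap A L a) := by
      intro a b
      rw [← sub_eq_zero]
      refine ext_of_localization M (n := n + 1)
        (sub_mem (diffOpFiltration_le_succ n ?_) (diffOpFiltration_le_succ n ?_)) ?_
      · cases n with
        | zero => have := hE a; rw [mem_diffOpFiltration_zero] at this ⊢; rw [this, bracket_zero]
        | succ n => exact diffOpFiltration_le_succ n (hE a _)
      · cases n with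
        | zero => have := hE b; rw [mem_diffOpFiltration_zero] at this ⊢; rw [this, bracket_zero]
        | succ n => exact diffOpFiltration_le_succ n (hE b _)
      · intro c
        simp only [LinearMap.sub_apply, bracket_apply, ← map_mul, hE', ← map_sub]
        rw [← map_zero (algebraMap A L)]
        congr 1
        rw [mul_left_comm a b c]
        ring
    have hval : ∀ x : L, ∃ y : L, ∀ (s : M) (b : A), algebraMap A L s * x = algebraMap A L b →
        algebraMap A L s * y = algebraMap A L (P b) - E s x := by
      intro x
      obtain ⟨a, t, rfl⟩ := IsLocalization.exists_mk'_eq M x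
      set x := IsLocalization.mk' L a t with hx
      have htx : algebraMap A L t * x = algebraMap A L a := IsLocalization.mk'_spec' _ _ _
      obtain ⟨y, hy⟩ : ∃ y, algebraMap A L t * y = algebraMap A L (P a) - E t x :=
        ⟨(↑(IsLocalization.map_units L t).unit⁻¹ : L) * (algebraMap A L (P a) - E t x), by
          rw [← mul_assoc, IsUnit.mul_val_inv, one_mul]⟩
      refine ⟨y, fun s b hsb => ?_⟩
      have h1 := congrArg (fun T => T x) (hsymm t s)
      simp only [bracket_apply] at h1
      rw [htx, hsb, hE', hE', bracket_apply, bracket_apply, map_sub, map_sub, map_mul (algebraMap A L),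
        map_mul (algebraMap A L)] at h1
      have h2 : (t : A) * b = s * a := by
        apply hinj
        rw [map_mul, map_mul, ← hsb, ← htx]
        ring
      rw [h2] at h1
      apply ((IsLocalization.map_units L t).mul_right_inj).1
      linear_combination (algebraMap A L s) * hy + h1
    choose Q hQ using hval
    have hden : ∀ x : L, ∃ (s : M) (b : A), algebraMap A L s * x = algebraMap A L b := by
      intro x
      obtain ⟨a, t, rfl⟩ := IsLocalization.exists_mk'_eq M x
      exact ⟨t, a, IsLocalization.mk'_spec' _ _ _⟩
    have hadd : ∀ x x' : L, Q (x + x') = Q x + Q x' := by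
      intro x x'
      obtain ⟨s, b, hs⟩ := hden x
      obtain ⟨s', b', hs'⟩ := hden x'
      have e1 : algebraMap A L ((s * s' : M) : A) * x = algebraMap A L (s' * b) := by
        rw [map_mul, ← hs, Submonoid.coe_mul, map_mul]; ring
      have e2 : algebraMap A L ((s * s' : M) : A) * x' = algebraMap A L (s * b') := by
        rw [map_mul, ← hs', Submonoid.coe_mul, map_mul]; ring
      have e3 : algebraMap A L ((s * s' : M) : A) * (x + x') =
          algebraMap A L (s' * b + s * b') := by
        rw [mul_add, e1, e2, map_add]
      apply ((IsLocalization.map_units L (s * s')).mul_right_inj).1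
      rw [hQ _ _ _ e3, mul_add, hQ _ _ _ e1, hQ _ _ _ e2, map_add, map_add, map_add]
      ring
    have hι : ∀ (c : k) (a : A), algebraMap A L (c • a) = c • algebraMap A L a :=
      fun c a => map_smul (IsScalarTower.toAlgHom k A L) c a
    have hsmul : ∀ (c : k) (x : L), Q (c • x) = c • Q x := by
      intro c x
      obtain ⟨s, b, hs⟩ := hden x
      have e1 : algebraMap A L s * (c • x) = algebraMap A L (c • b) := by
        rw [mul_smul_comm, hs, hι]
      apply ((IsLocalization.map_units L s).mul_right_inj).1
      rw [hQ _ _ _ e1, mul_smul_comm, hQ _ _ _ hs, LinearMap.map_smul, LinearMap.map_smul, hι,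
        smul_sub]
    let Q' : Module.End k L := { toFun := Q, map_add' := hadd, map_smul' := hsmul }
    have hE1 : E 1 = 0 := by
      refine ext_of_localization M (hE 1) fun a => ?_
      rw [hE', bracket_apply]
      simp
    have hQA : ∀ a : A, Q' (algebraMap A L a) = algebraMap A L (P a) := by
      intro a
      have := hQ (algebraMap A L a) 1 a (by simp)
      change Q (algebraMap A L a) = _
      simpa [hE1] using this
    refine ⟨Q', mem_succ_of_localization M fun a => ?_, hQA⟩
    have hbr : bracket Q' (algebraMap A L a) = E a := by
      ext x
      obtain ⟨s, b, hs⟩ := hden x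
      have e1 : algebraMap A L s * (algebraMap A L a * x) = algebraMap A L (a * b) := by
        rw [map_mul, ← hs]; ring
      have h1 := congrArg (fun T => T x) (hsymm a s)
      simp only [bracket_apply] at h1
      rw [hs, hE', bracket_apply, map_sub, map_mul (algebraMap A L)] at h1
      have h2 := hQ _ _ _ e1
      have h3 := hQ _ _ _ hs
      apply ((IsLocalization.map_units L s).mul_right_inj).1
      rw [bracket_apply]
      change algebraMap A L s * (Q (algebraMap A L a * x) - algebraMap A L a * Q x) = _
      linear_combination h2 - (algebraMap A L a) * h3 + h1
    rw [hbr]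
    exact hE a

end Localize

/-- The action of `k`-linear differential operators of `A` on the localization `L` of `A` at a
submonoid of nonzerodivisors: `P` acts by the unique differential operator of `L` extending `P`. -/
def DiffOp.localize {k A : Type*} [CommRing k] [CommRing A] [Algebra k A]
    (M : Submonoid A) (hM : M ≤ nonZeroDivisors A) (L : Type*) [CommRing L] [Algebra A L]
    [Algebra k L] [IsScalarTower k A L] [IsLocalization M L] :
    DiffOp k A →ₐ[k] DiffOp k L :=
  have ex : ∀ P : DiffOp k A, ∃ Q : DiffOp k L, ∀ a : A,
      DiffOp.toEnd k L Q (algebraMap A L a) = algebraMap A L (DiffOp.toEnd k A P a) := by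
    intro P
    obtain ⟨n, hP⟩ := P.exists_order
    obtain ⟨Q, hQ, h⟩ := exists_extension M hM L hP
    exact ⟨DiffOp.mk Q ⟨n, hQ⟩, h⟩
  have uniq : ∀ Q Q' : DiffOp k L,
      (∀ a : A, DiffOp.toEnd k L Q (algebraMap A L a) =
        DiffOp.toEnd k L Q' (algebraMap A L a)) → Q = Q' := by
    intro Q Q' h
    obtain ⟨n, hn⟩ := (Q - Q').exists_order
    have := ext_of_localization M hn fun a => by
      rw [map_sub, LinearMap.sub_apply, h, sub_self]
    exact sub_eq_zero.1 (DiffOp.toEnd_injective k L (this.trans (map_zero _).symm))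
  AlgHom.ofLinearMap
    { toFun := fun P => (ex P).choose
      map_add' := fun P Q => uniq _ _ fun a => by
        rw [(ex (P + Q)).choose_spec a, map_add, map_add, LinearMap.add_apply,
          LinearMap.add_apply, (ex P).choose_spec a, (ex Q).choose_spec a, map_add]
      map_smul' := fun c P => uniq _ _ fun a => by
        rw [(ex (c • P)).choose_spec a, RingHom.id_apply, map_smul, map_smul,
          LinearMap.smul_apply, LinearMap.smul_apply, (ex P).choose_spec a]
        exact map_smul (IsScalarTower.toAlgHom k A L) c _ }
    (uniq _ _ fun a => by
      refine ((ex 1).choose_spec a).trans ?_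
      simp)
    (fun P Q => uniq _ _ fun a => by
      refine ((ex (P * Q)).choose_spec a).trans ?_
      rw [map_mul, map_mul, Module.End.mul_apply, Module.End.mul_apply]
      change _ = DiffOp.toEnd k L (ex P).choose (DiffOp.toEnd k L (ex Q).choose _)
      rw [(ex Q).choose_spec a, (ex P).choose_spec])

theorem DiffOp.localize_algebraMap {k A : Type*} [CommRing k] [CommRing A] [Algebra k A]
    (M : Submonoid A) (hM : M ≤ nonZeroDivisors A) (L : Type*) [CommRing L] [Algebra A L]
    [Algebra k L] [IsScalarTower k A L] [IsLocalization M L] (P : DiffOp k A) (a : A) :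
    DiffOp.toEnd k L (DiffOp.localize M hM L P) (algebraMap A L a) =
      algebraMap A L (DiffOp.toEnd k A P a) := by
  have ex : ∃ Q : DiffOp k L, ∀ a : A,
      DiffOp.toEnd k L Q (algebraMap A L a) = algebraMap A L (DiffOp.toEnd k A P a) := by
    obtain ⟨n, hP⟩ := P.exists_order
    obtain ⟨Q, hQ, h⟩ := exists_extension M hM L hP
    exact ⟨DiffOp.mk Q ⟨n, hQ⟩, h⟩
  exact ex.choose_spec a

/-! ### Differential operators on a product with the affine line -/

/-- A differential operator of `A` acts on `A ⊗ C` through the first factor. -/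
theorem rTensor_mem_diffOpFiltration {k A : Type*} [CommRing k] [CommRing A] [Algebra k A]
    (C : Type*) [CommRing C] [Algebra k C] {n : ℕ} {P : Module.End k A}
    (hP : P ∈ diffOpFiltration k A n) :
    LinearMap.rTensor C P ∈ diffOpFiltration k (A ⊗[k] C) n := by
  induction n generalizing P with
  | zero =>
    rw [mem_diffOpFiltration_zero] at hP ⊢
    simp [hP]
  | succ n ih =>
    intro x
    induction x with
    | zero =>
      have : bracket (LinearMap.rTensor C P) (0 : A ⊗[k] C) = 0 := by
        ext; simp [bracket_apply]
      rw [this]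
      exact zero_mem _
    | add x y hx hy =>
      rw [bracket_add_right]
      exact add_mem hx hy
    | tmul a c =>
      have : bracket (LinearMap.rTensor C P) (a ⊗ₜ[k] c) =
          Algebra.lmul k (A ⊗[k] C) (1 ⊗ₜ[k] c) * LinearMap.rTensor C (bracket P a) := by
        ext b d
        simp [bracket_apply, TensorProduct.sub_tmul, mul_sub]
      rw [this]
      exact lmul_mul_mem (ih (hP a)) _

/-- A differential operator of `C` acts on `A ⊗ C` through the second factor. -/
theorem lTensor_mem_diffOpFiltration {k C : Type*} [CommRing k] [CommRing C] [Algebra k C]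
    (A : Type*) [CommRing A] [Algebra k A] {n : ℕ} {P : Module.End k C}
    (hP : P ∈ diffOpFiltration k C n) :
    LinearMap.lTensor A P ∈ diffOpFiltration k (A ⊗[k] C) n := by
  induction n generalizing P with
  | zero =>
    rw [mem_diffOpFiltration_zero] at hP ⊢
    simp [hP]
  | succ n ih =>
    intro x
    induction x with
    | zero =>
      have : bracket (LinearMap.lTensor A P) (0 : A ⊗[k] C) = 0 := by
        ext; simp [bracket_apply]
      rw [this]
      exact zero_mem _
    | add x y hx hy =>
      rw [bracket_add_right]
      exact add_mem hx hy
    | tmul a c =>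
      have : bracket (LinearMap.lTensor A P) (a ⊗ₜ[k] c) =
          Algebra.lmul k (A ⊗[k] C) (a ⊗ₜ[k] 1) * LinearMap.lTensor A (bracket P c) := by
        ext b d
        simp [bracket_apply, TensorProduct.tmul_sub, mul_sub]
      rw [this]
      exact lmul_mul_mem (ih (hP c)) _

theorem conj_mem_diffOpFiltration {k A B : Type*} [CommRing k] [CommRing A] [Algebra k A]
    [CommRing B] [Algebra k B] (e : A ≃ₐ[k] B) {n : ℕ} {P : Module.End k A}
    (hP : P ∈ diffOpFiltration k A n) :
    e.toLinearEquiv.conj P ∈ diffOpFiltration k B n := by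
  induction n generalizing P with
  | zero =>
    rw [mem_diffOpFiltration_zero] at hP ⊢
    simp [hP]
  | succ n ih =>
    intro b
    have : bracket (e.toLinearEquiv.conj P) b =
        e.toLinearEquiv.conj (bracket P (e.symm b)) := by
      ext c
      simp [bracket_apply, LinearEquiv.conj_apply]
    rw [this]
    exact ih (hP _)

/-- The inclusion `D_X → D_{X × 𝔸¹}` for `X = Spec R`: on `R[t] = R ⊗ k[t]`, the operator `P`
acts as `P ⊗ 1`, i.e. coefficientwise. -/
def DiffOp.inclBase (k R : Type*) [CommRing k] [CommRing R] [Algebra k R] :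
    DiffOp k R →ₐ[k] DiffOp k R[X] :=
  DiffOp.codRestrict
    ((((polyEquivTensor k R).symm.toLinearEquiv.conjAlgEquiv k : _ →ₐ[k] _).comp
      (Module.End.rTensorAlgHom k R k[X])).comp (DiffOp.toEnd k R))
    (fun P => P.exists_order.imp fun _ h =>
      conj_mem_diffOpFiltration _ (rTensor_mem_diffOpFiltration _ h))

/-- The inclusion `D_{𝔸¹} → D_{X × 𝔸¹}` for `X = Spec R`: on `R[t] = R ⊗ k[t]`, the operator `θ`
acts as `1 ⊗ θ`. -/
def DiffOp.inclLine (k R : Type*) [CommRing k] [CommRing R] [Algebra k R] :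
    DiffOp k k[X] →ₐ[k] DiffOp k R[X] :=
  DiffOp.codRestrict
    ((((polyEquivTensor k R).symm.toLinearEquiv.conjAlgEquiv k : _ →ₐ[k] _).comp
      (Module.End.lTensorAlgHom k k[X] R)).comp (DiffOp.toEnd k k[X]))
    (fun P => P.exists_order.imp fun _ h =>
      conj_mem_diffOpFiltration _ (lTensor_mem_diffOpFiltration _ h))

theorem DiffOp.inclBase_monomial (k R : Type*) [CommRing k] [CommRing R] [Algebra k R]
    (P : DiffOp k R) (n : ℕ) (r : R) :
    DiffOp.toEnd k R[X] (DiffOp.inclBase k R P) (monomial n r) =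
      monomial n (DiffOp.toEnd k R P r) := by
  have h : polyEquivTensor k R (monomial n r) = r ⊗ₜ[k] (X ^ n : k[X]) := by
    rw [← (polyEquivTensor k R).eq_symm_apply, polyEquivTensor_symm_apply_tmul_eq_smul]
    simp [← C_mul_X_pow_eq_monomial, smul_eq_C_mul]
  change (polyEquivTensor k R).symm
    (LinearMap.rTensor k[X] (DiffOp.toEnd k R P) (polyEquivTensor k R (monomial n r))) = _
  rw [h, LinearMap.rTensor_tmul, polyEquivTensor_symm_apply_tmul_eq_smul]
  simp [← C_mul_X_pow_eq_monomial, smul_eq_C_mul]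

theorem DiffOp.inclLine_apply (k R : Type*) [CommRing k] [CommRing R] [Algebra k R]
    (θ : DiffOp k k[X]) (r : R) (g : k[X]) :
    DiffOp.toEnd k R[X] (DiffOp.inclLine k R θ) (C r * g.map (algebraMap k R)) =
      C r * (DiffOp.toEnd k k[X] θ g).map (algebraMap k R) := by
  have h : polyEquivTensor k R (C r * g.map (algebraMap k R)) = r ⊗ₜ[k] g := by
    rw [← (polyEquivTensor k R).eq_symm_apply, polyEquivTensor_symm_apply_tmul_eq_smul,
      smul_eq_C_mul]
  change (polyEquivTensor k R).symm (LinearMap.lTensor R (DiffOp.toEnd k k[X] θ)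
    (polyEquivTensor k R (C r * g.map (algebraMap k R)))) = _
  rw [h, LinearMap.lTensor_tmul, polyEquivTensor_symm_apply_tmul_eq_smul, smul_eq_C_mul]

/-! ### The algebra of binomial coefficients -/

theorem hasseDeriv_mem_diffOpFiltration (k : Type*) [CommRing k] (m : ℕ) :
    (hasseDeriv m : Module.End k k[X]) ∈ diffOpFiltration k k[X] (m + 1) := by
  induction m using Nat.strong_induction_on with
  | _ m ih =>
    intro g
    have : bracket (hasseDeriv m : Module.End k k[X]) g =
        ∑ i ∈ Finset.range m, Algebra.lmul k k[X] (hasseDeriv (m - i) g) * hasseDeriv i := by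
      ext1 n
      ext1
      simp only [LinearMap.comp_apply, bracket_apply, LinearMap.sum_apply, Module.End.mul_apply,
        Algebra.coe_lmul_eq_mul, LinearMap.mul_apply']
      rw [mul_comm g, hasseDeriv_mul, Finset.Nat.sum_antidiagonal_eq_sum_range_succ
        (fun i j => hasseDeriv i (monomial n (1 : k)) * hasseDeriv j g),
        Finset.sum_range_succ, Nat.sub_self, hasseDeriv_zero', mul_comm g, add_sub_cancel_right]
      exact Finset.sum_congr rfl fun i _ => mul_comm _ _
    rw [this]
    refine Submodule.sum_mem _ fun i hi => ?_
    rw [Finset.mem_range] at hi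
    exact diffOpFiltration_mono hi (lmul_mul_mem (ih i hi) _)

/-- The divided power derivative `∂_t^{[m]}` on `k[t]`, which maps `t ^ l` to
`(l choose m) t ^ (l - m)`. -/
def dividedDeriv (k : Type*) [CommRing k] (m : ℕ) : DiffOp k k[X] :=
  DiffOp.mk (hasseDeriv m) ⟨m + 1, hasseDeriv_mem_diffOpFiltration k m⟩

/-- The higher Euler operator `ν_e = ∂_t^{[p ^ e]} t ^ (p ^ e)`. -/
def eulerOp (k : Type*) [CommRing k] (p e : ℕ) : DiffOp k k[X] :=
  dividedDeriv k (p ^ e) * DiffOp.mulBy k (X ^ p ^ e)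

theorem eulerOp_monomial (k : Type*) [CommRing k] (p e l : ℕ) (c : k) :
    DiffOp.toEnd k k[X] (eulerOp k p e) (monomial l c) =
      monomial l (((l + p ^ e).choose (p ^ e) : k) * c) := by
  change hasseDeriv (p ^ e) (X ^ p ^ e * monomial l c) = _
  rw [X_pow_mul_monomial, hasseDeriv_monomial, Nat.add_sub_cancel]

theorem eulerOp_comm (k : Type*) [CommRing k] (p e e' : ℕ) :
    eulerOp k p e * eulerOp k p e' = eulerOp k p e' * eulerOp k p e := by
  apply DiffOp.toEnd_injective
  ext1 l
  ext1
  simp only [map_mul, LinearMap.comp_apply, Module.End.mul_apply, eulerOp_monomial]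
  rw [mul_left_comm]

/-- The algebra of binomial coefficients `k[(s choose p^0), (s choose p^1), …]`: the
`k`-subalgebra of the ring of differential operators on the affine line generated by the higher
Euler operators. -/
def binomialAlgebra (k : Type*) [CommRing k] (p : ℕ) : Subalgebra k (DiffOp k k[X]) :=
  Algebra.adjoin k (Set.range (eulerOp k p))

instance isMulCommutative_binomialAlgebra (k : Type*) [CommRing k] (p : ℕ) :
    IsMulCommutative (binomialAlgebra k p) :=
  Algebra.isMulCommutative_adjoin k (by
    rintro _ ⟨e, rfl⟩ _ ⟨e', rfl⟩
    exact eulerOp_comm k p e e')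

instance commRingBinomialAlgebra (k : Type*) [CommRing k] (p : ℕ) :
    CommRing (binomialAlgebra k p) :=
  { Subalgebra.toRing (binomialAlgebra k p) with
    mul_comm := fun a b => mul_comm' a b }

/-- The element `(s choose p^e) = -ν_e` of the algebra of binomial coefficients. -/
def binomialCoeff (k : Type*) [CommRing k] (p e : ℕ) : binomialAlgebra k p :=
  -⟨eulerOp k p e, Algebra.subset_adjoin ⟨e, rfl⟩⟩

/-- The `e`-th digit `α_e ∈ {0, …, p - 1}` of the `p`-adic expansion `α = ∑ α_e p^e`. -/
def padicDigit {p : ℕ} [Fact p.Prime] (α : ℤ_[p]) (e : ℕ) : ℕ :=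
  (PadicInt.toZModPow (e + 1) α).val / p ^ e

/-- The roots of an ideal `I` of the algebra of binomial coefficients: the `p`-adic integers `α`
which correspond to a maximal ideal containing `I`. Here `α = ∑ α_e p^e` corresponds to the
maximal ideal in whose residue field every `(s choose p^e)` equals `α_e`. -/
def padicRoots {k : Type*} [Field k] {p : ℕ} [Fact p.Prime] (I : Ideal (binomialAlgebra k p)) :
    Set ℤ_[p] :=
  {α | ∃ 𝔪 : Ideal (binomialAlgebra k p), 𝔪.IsMaximal ∧ I ≤ 𝔪 ∧
    ∀ e : ℕ, binomialCoeff k p e - algebraMap k (binomialAlgebra k p) (padicDigit α e : k) ∈ 𝔪}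

/-! ### The modules `B_f`, `M_f` and the `b`-function in the affine case -/

theorem powers_le_nonZeroDivisors {R : Type*} [CommRing R] (f : R) :
    Submonoid.powers (C f - X : R[X]) ≤ nonZeroDivisors R[X] := by
  refine Submonoid.powers_le.2 ?_
  have h := (monic_X_sub_C f).mem_nonZeroDivisors
  rw [← neg_sub, ← neg_one_mul]
  exact mul_mem (isUnit_one.neg.mem_nonZeroDivisors) h

/-- `R[t]_{f - t}`. -/
abbrev GraphLocalization {R : Type*} [CommRing R] (f : R) : Type _ :=
  Localization (Submonoid.powers (C f - X : R[X]))

/-- The `k`-submodule `R[t]` of `R[t]_{f - t}`. -/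
def integralPart (k : Type*) {R : Type*} [CommRing k] [CommRing R] [Algebra k R] (f : R) :
    Submodule k (GraphLocalization f) :=
  LinearMap.range (IsScalarTower.toAlgHom k R[X] (GraphLocalization f)).toLinearMap

/-- `B_f = R[t]_{f - t} / R[t]`. -/
abbrev Bf (k : Type*) {R : Type*} [CommRing k] [CommRing R] [Algebra k R] (f : R) : Type _ :=
  GraphLocalization f ⧸ integralPart k f

/-- The left action on `B_f` of the ring of differential operators of `R[t]`. -/
def actionBf (k : Type*) {R : Type*} [CommRing k] [CommRing R] [Algebra k R] (f : R) :
    DiffOp k R[X] →ₐ[k] Module.End k (Bf k f) :=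
  have stable : ∀ P : DiffOp k R[X], integralPart k f ≤ (integralPart k f).comap
      (DiffOp.localize _ (powers_le_nonZeroDivisors f) (GraphLocalization f) P |> DiffOp.toEnd k _) := by
    rintro P _ ⟨a, rfl⟩
    exact ⟨DiffOp.toEnd k _ P a, (DiffOp.localize_algebraMap _ (powers_le_nonZeroDivisors f) _ P a).symm⟩
  AlgHom.ofLinearMap
    { toFun := fun P => (integralPart k f).mapQ (integralPart k f) _ (stable P)
      map_add' := fun P Q => by
        ext x
        simp
      map_smul' := fun c P => by
        ext x
        simp }
    (by ext x; simp)
    (fun P Q => by ext x; simp)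

/-- The class `δ` of `1 / (f - t)` in `B_f`. -/
def deltaBf (k : Type*) {R : Type*} [CommRing k] [CommRing R] [Algebra k R] (f : R) : Bf k f :=
  (integralPart k f).mkQ (IsLocalization.mk' (GraphLocalization f) (1 : R[X])
    (⟨C f - X, Submonoid.mem_powers _⟩ : Submonoid.powers (C f - X : R[X])))

/-- The ring `D_X[ν_e ; e ∈ ℕ]` of differential operators on `X × 𝔸¹`, for `X = Spec R`. -/
def baseEulerOps (k : Type*) (R : Type*) [CommRing k] [CommRing R] [Algebra k R] (p : ℕ) :
    Subalgebra k (DiffOp k R[X]) :=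
  Algebra.adjoin k (Set.range (DiffOp.inclBase k R) ∪
    Set.range (fun e => DiffOp.inclLine k R (eulerOp k p e)))

/-- `M_f = D_X[ν_e ; e ∈ ℕ] δ ⊆ B_f`. -/
def Mf (k : Type*) {R : Type*} [CommRing k] [CommRing R] [Algebra k R] (p : ℕ) (f : R) :
    Submodule k (Bf k f) :=
  (Subalgebra.toSubmodule (baseEulerOps k R p)).map
    ((LinearMap.applyₗ (deltaBf k f)).comp (actionBf k f).toLinearMap)

/-- `t M_f`. -/
def tMf (k : Type*) {R : Type*} [CommRing k] [CommRing R] [Algebra k R] (p : ℕ) (f : R) :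
    Submodule k (Bf k f) :=
  (Mf k p f).map (actionBf k f (DiffOp.mulBy k (X : R[X])))

theorem inclLine_mem_baseEulerOps (k : Type*) (R : Type*) [CommRing k] [CommRing R] [Algebra k R]
    (p : ℕ) (θ : binomialAlgebra k p) : DiffOp.inclLine k R θ ∈ baseEulerOps k R p := by
  have h : (binomialAlgebra k p).map (DiffOp.inclLine k R) ≤ baseEulerOps k R p := by
    rw [binomialAlgebra, AlgHom.map_adjoin, Algebra.adjoin_le_iff]
    rintro _ ⟨_, ⟨e, rfl⟩, rfl⟩
    exact Algebra.subset_adjoin (Or.inr ⟨e, rfl⟩)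
  exact h ⟨θ, θ.2, rfl⟩

theorem action_mem_Mf (k : Type*) {R : Type*} [CommRing k] [CommRing R] [Algebra k R] (p : ℕ)
    (f : R) (θ : binomialAlgebra k p) {m : Bf k f} (hm : m ∈ Mf k p f) :
    actionBf k f (DiffOp.inclLine k R θ) m ∈ Mf k p f := by
  obtain ⟨Q, hQ, rfl⟩ := hm
  refine ⟨DiffOp.inclLine k R θ * Q, (baseEulerOps k R p).mul_mem (inclLine_mem_baseEulerOps k R p θ) hQ, ?_⟩
  simp

/-- The `b`-function of `f` on `X = Spec R`: the annihilator of `N_f = M_f / t M_f` in the algebra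
of binomial coefficients, i.e. the ideal of all `θ` with `θ M_f ⊆ t M_f`. -/
def affineBFunction (k : Type*) {R : Type*} [CommRing k] [CommRing R] [Algebra k R] (p : ℕ)
    (f : R) : Ideal (binomialAlgebra k p) where
  carrier := {θ | ∀ m ∈ Mf k p f, actionBf k f (DiffOp.inclLine k R θ) m ∈ tMf k p f}
  add_mem' := by
    intro θ θ' h h' m hm
    have : actionBf k f (DiffOp.inclLine k R ((θ + θ' : binomialAlgebra k p) : DiffOp k k[X])) m =
        actionBf k f (DiffOp.inclLine k R θ) m + actionBf k f (DiffOp.inclLine k R θ') m := by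
      simp
    rw [this]
    exact add_mem (h m hm) (h' m hm)
  zero_mem' := by
    intro m hm
    simp
  smul_mem' := by
    intro c θ h m hm
    have : c • θ = θ * c := mul_comm c θ
    rw [this]
    have : actionBf k f (DiffOp.inclLine k R ((θ * c : binomialAlgebra k p) : DiffOp k k[X])) m =
        actionBf k f (DiffOp.inclLine k R θ) (actionBf k f (DiffOp.inclLine k R c) m) := by
      simp
    rw [this]
    exact h _ (action_mem_Mf k p f c hm)

/-! ### Test ideals in the affine case -/

/-- The Frobenius power `J^{[p^e]}`, generated by the `p^e`-th powers of the elements of `J`. -/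
def frobeniusPower {R : Type*} [CommRing R] (p e : ℕ) (J : Ideal R) : Ideal R :=
  Ideal.span ((fun x => x ^ p ^ e) '' (J : Set R))

/-- The ideal `(f^m)^{[1/p^e]}`: the smallest ideal `J` such that `f^m ∈ J^{[p^e]}`, obtained as
the intersection of all such ideals (which is one of them when `R` is smooth over a field). -/
def frobeniusRoot {R : Type*} [CommRing R] (p e : ℕ) (f : R) (m : ℕ) : Ideal R :=
  sInf {J : Ideal R | f ^ m ∈ frobeniusPower p e J}

/-- The test ideal `τ(f^c)`: the union of the increasing sequence of ideals
`(f^⌈c p^e⌉)^{[1/p^e]}`, `e ≥ 0`. -/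
def affineTestIdeal {R : Type*} [CommRing R] (p : ℕ) (f : R) (c : ℝ) : Ideal R :=
  ⨆ e : ℕ, frobeniusRoot p e f ⌈c * (p : ℝ) ^ e⌉₊

/-! ### Globalization to schemes over `k` -/

section Schemes

open CategoryTheory

/-- The structure homomorphism `k → Γ(X, U)` of a scheme over `k`. -/
def structureMap {k : Type u} [Field k] {X : Scheme.{u}} (π : X ⟶ Spec (CommRingCat.of k))
    (U : X.Opens) : k →+* Γ(X, U) :=
  (π.appLE ⊤ U le_top).hom.comp (Scheme.ΓSpecIso (CommRingCat.of k)).inv.hom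

/-- The restriction of a global function to an open subset. -/
def restrictFun {X : Scheme.{u}} (f : Γ(X, ⊤)) (U : X.Opens) : Γ(X, U) :=
  (X.presheaf.map (homOfLE le_top).op).hom f

/-- The `b`-function of a function `f` on a scheme `X` over `k`: the annihilator of the sheaf
`N_f`, whose module of sections over an affine open `U` is `N_{f|U}`. A `θ` annihilates this sheaf
iff it annihilates the sections over every affine open. -/
def bFunction {k : Type u} [Field k] (p : ℕ) {X : Scheme.{u}}
    (π : X ⟶ Spec (CommRingCat.of k)) (f : Γ(X, ⊤)) : Ideal (binomialAlgebra k p) :=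
  ⨅ U : X.affineOpens,
    letI := (structureMap π U).toAlgebra
    affineBFunction k p (restrictFun f U)

/-- The test ideal `τ(f^c) ⊆ 𝒪_X`, as the family of its ideals of sections over the affine
opens. -/
def testIdeal (p : ℕ) {X : Scheme.{u}} (f : Γ(X, ⊤)) (c : ℝ) (U : X.affineOpens) :
    Ideal Γ(X, U) :=
  affineTestIdeal p (restrictFun f U) c

/-- `c` is an `F`-jumping exponent of `f`: it is positive and `τ(f^(c - ε)) ≠ τ(f^c)` for every
`ε > 0` (with `ε ≤ c`, so that the exponent is nonnegative). -/
def IsFJumpingExponent (p : ℕ) {X : Scheme.{u}} (f : Γ(X, ⊤)) (c : ℝ) : Prop :=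
  0 < c ∧ ∀ ε : ℝ, 0 < ε → ε ≤ c → testIdeal p f (c - ε) ≠ testIdeal p f c

end Schemes

end CharPBFunction

end

/-! Let D_e be the set of k-linear operators on R that commute with multiplication by p^e-th powers
(level p^e). On a finitely generated algebra the D_e exhaust the differential operators. Say that a
jumps at level e if f^a does not lie in D_e f^(a+1), that is, if `LevelEq` fails. Both sides of the
theorem are translated into this condition.

The b-function. Since (f - t)^(p^e) = f^(p^e) - t^(p^e), the operators in D_e and the ν_i with i < e
commute with this denominator and act on numerators alone. Over it, δ has numerator ∑ f^a t^(p^e - 1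
- a), a < p^e, and -ν_i acts on t^(p^e - 1 - a) as the i-th digit of a. Digit projectors therefore
split M_f: for large e its elements have components in D_e f^a, and those of t M_f in D_e f^(a+1).
Hence α is a root iff on some affine open the residue of α mod p^e jumps at every level e
(`mem_padicRoots_bFunction_iff`); quasi-compactness makes the level uniform.

Rationality. Smoothness makes R finite projective over its relative Frobenius twists, by dual
families whose degrees are controlled uniformly in e (`exists_frobeniusFamily`). So for a < p^e the
ideals D_e f^a are generated by p^e-expansions of polynomials of bounded degree, and the number of
jumping a < p^e is bounded independently of e (`exists_bound_not_levelEq`). The set of p-adic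
integers all of whose residues jump is thus finite, and each of its elements stays in it after
prepending a suitable digit (`LevelEq.of_succ`). Prepending is an injection of a finite set, so
every element is purely periodic: α = C + p^d α, that is α = -λ with λ = C/(p^d - 1)
(`exists_periodic`). A Krull intersection argument excludes λ = 0 (`exists_levelEq_zero`).

Test ideals. Let r_j consist of j digits C in base p^d; then ⌈λ p^(dj)⌉ = r_j + 1. If r_j does not
jump at level dj, then, as operators of level p^(dj) preserve p^(dj)-th Frobenius powers of ideals,
the Frobenius roots of f^(r_j) and f^(r_j + 1) agree, and λ is not an F-jumping exponent. The
converse needs care because D_e is relative to k whereas Frobenius roots are absolute and k may be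
imperfect. From some j on, the ideals generated by f^(r_j + 1) at level dj are Frobenius powers of
one ideal J (`exists_levelIdeal_stable`). With x = f^(r_j), flatness of Frobenius puts the roots of
all f^(r_i + 1) inside J : x. If λ is not F-jumping, some f^(r_e) lies in the p^(de)-th Frobenius
power of J : x, and multiplying by x^(p^(de)) shows that r_(j+e) does not jump
(`exists_levelEq_of_frobeniusRoot_le`). -/

noncomputable section

namespace CharPBFunction

/-! ### Splitting polynomials by exponents modulo p -/

section ResidueParts

variable {σ k : Type*} [Fintype σ] [Field k]

/-- The exponent vector of a tuple of residues. -/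
def residueExponent {p : ℕ} (u : σ → Fin p) : σ →₀ ℕ :=
  Finsupp.equivFunOnFinite.symm fun i => (u i : ℕ)

@[simp]
theorem residueExponent_apply {p : ℕ} (u : σ → Fin p) (i : σ) : residueExponent u i = u i :=
  rfl

open Classical in
/-- The component `κ_u` in the decomposition `G = ∑ u, expand p (κ_u G) * X ^ u` of a polynomial
according to the residues of its exponents modulo `p`. -/
def residuePart (p : ℕ) (u : σ → Fin p) : MvPolynomial σ k →ₗ[k] MvPolynomial σ k :=
  (MvPolynomial.basisMonomials σ k).constr k fun m =>
    if ∀ i, m i % p = u i then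
      MvPolynomial.monomial (m.mapRange (· / p) (Nat.zero_div p)) 1
    else 0

open Classical in
theorem residuePart_monomial (p : ℕ) (u : σ → Fin p) (m : σ →₀ ℕ) (c : k) :
    residuePart p u (MvPolynomial.monomial m c) =
      if ∀ i, m i % p = u i then
        MvPolynomial.monomial (m.mapRange (· / p) (Nat.zero_div p)) c
      else 0 := by
  have h : (MvPolynomial.monomial m c : MvPolynomial σ k) =
      c • MvPolynomial.basisMonomials σ k m := by
    rw [MvPolynomial.coe_basisMonomials, MvPolynomial.smul_monomial, smul_eq_mul, mul_one]
  rw [h, map_smul, residuePart, Module.Basis.constr_basis]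
  split_ifs
  · rw [MvPolynomial.smul_monomial, smul_eq_mul, mul_one]
  · rw [smul_zero]

theorem sum_expand_residuePart {p : ℕ} (hp : 0 < p) (G : MvPolynomial σ k) :
    letI := Classical.decEq σ
    ∑ u : σ → Fin p, MvPolynomial.expand p (residuePart p u G) *
      MvPolynomial.monomial (residueExponent u) 1 = G := by
  classical
  induction G using MvPolynomial.induction_on' with
  | monomial m c =>
    have huniq : ∀ u : σ → Fin p, (∀ i, m i % p = u i) ↔
        u = fun i => ⟨m i % p, Nat.mod_lt _ hp⟩ := by
      intro u
      constructor
      · intro h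
        funext i
        exact Fin.ext (h i).symm
      · rintro rfl i
        rfl
    simp only [residuePart_monomial]
    rw [Finset.sum_eq_single fun i => (⟨m i % p, Nat.mod_lt _ hp⟩ : Fin p)]
    · rw [if_pos fun i => rfl, MvPolynomial.expand_monomial, MvPolynomial.monomial_mul, mul_one]
      have hm : (p • m.mapRange (· / p) (Nat.zero_div p) +
          residueExponent fun i => (⟨m i % p, Nat.mod_lt _ hp⟩ : Fin p)) = m := by
        ext i
        simp [Nat.div_add_mod]
      rw [hm]
    · intro u _ hu
      rw [if_neg (mt (huniq u).1 hu), map_zero, zero_mul]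
    · simp
  | add G H hG hH =>
    simp only [map_add, add_mul, Finset.sum_add_distrib]
    rw [hG, hH]

theorem residuePart_expand_mul {p : ℕ} (hp : 0 < p) (u : σ → Fin p) (r G : MvPolynomial σ k) :
    residuePart p u (MvPolynomial.expand p r * G) = r * residuePart p u G := by
  classical
  induction r using MvPolynomial.induction_on' with
  | monomial a c =>
    induction G using MvPolynomial.induction_on' with
    | monomial m d =>
      rw [MvPolynomial.expand_monomial, MvPolynomial.monomial_mul, residuePart_monomial,
        residuePart_monomial]
      have h : (∀ i, (p • a + m) i % p = u i) ↔ ∀ i, m i % p = u i := by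
        simp
      by_cases hm : ∀ i, m i % p = u i
      · rw [if_pos (h.2 hm), if_pos hm, MvPolynomial.monomial_mul]
        have ha : (p • a + m).mapRange (· / p) (Nat.zero_div p) =
            a + m.mapRange (· / p) (Nat.zero_div p) := by
          ext i
          simp [Nat.mul_add_div hp]
        rw [ha]
      · rw [if_neg (mt h.1 hm), if_neg hm, mul_zero]
    | add G H hG hH => rw [mul_add, map_add, map_add, mul_add, hG, hH]
  | add r s hr hs => rw [map_add, add_mul, map_add, add_mul, hr, hs]

theorem residuePart_map (p : ℕ) (u : σ → Fin p) (ρ : k →+* k) (G : MvPolynomial σ k) :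
    residuePart p u (MvPolynomial.map ρ G) = MvPolynomial.map ρ (residuePart p u G) := by
  classical
  induction G using MvPolynomial.induction_on' with
  | monomial m c =>
    rw [MvPolynomial.map_monomial, residuePart_monomial, residuePart_monomial]
    split_ifs
    · rw [MvPolynomial.map_monomial]
    · rw [map_zero]
  | add G H hG hH => rw [map_add, map_add, map_add, map_add, hG, hH]

theorem coeff_residuePart {p : ℕ} (hp : 0 < p) (u : σ → Fin p) (G : MvPolynomial σ k)
    (s : σ →₀ ℕ) :
    (residuePart p u G).coeff s = G.coeff (p • s + residueExponent u) := by
  classical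
  induction G using MvPolynomial.induction_on' with
  | monomial m c =>
    have h : m = p • s + residueExponent u ↔
        (∀ i, m i % p = u i) ∧ m.mapRange (· / p) (Nat.zero_div p) = s := by
      constructor
      · rintro rfl
        refine ⟨fun i => ?_, ?_⟩
        · simp [Nat.mod_eq_of_lt (u i).2]
        · ext i
          simp [Nat.mul_add_div hp, Nat.div_eq_of_lt (u i).2]
      · rintro ⟨h1, rfl⟩
        ext i
        simp [← h1 i, Nat.div_add_mod]
    rw [residuePart_monomial, MvPolynomial.coeff_monomial]
    by_cases hm : ∀ i, m i % p = u i
    · rw [if_pos hm, MvPolynomial.coeff_monomial]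
      exact if_congr (by rw [h, and_iff_right hm]) rfl rfl
    · rw [if_neg hm, if_neg (fun h' => hm (h.1 h').1), MvPolynomial.coeff_zero]
  | add G H hG hH => rw [map_add, MvPolynomial.coeff_add, MvPolynomial.coeff_add, hG, hH]

theorem mul_totalDegree_residuePart_le {p : ℕ} (hp : 0 < p) (u : σ → Fin p)
    (G : MvPolynomial σ k) : p * (residuePart p u G).totalDegree ≤ G.totalDegree := by
  rw [mul_comm, ← Nat.le_div_iff_mul_le hp]
  refine Finset.sup_le fun s hs => ?_
  rw [MvPolynomial.mem_support_iff, coeff_residuePart hp, ← MvPolynomial.mem_support_iff] at hs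
  have h := MvPolynomial.le_totalDegree hs
  rw [Nat.le_div_iff_mul_le hp]
  refine le_trans ?_ h
  rw [Finsupp.sum_fintype _ _ (by simp), Finsupp.sum_fintype _ _ (by simp), Finset.sum_mul]
  exact Finset.sum_le_sum fun i _ => by simp [mul_comm p]

end ResidueParts

/-! ### Dual families for the relative Frobenius, and their composition -/

section FrobeniusFamilies

variable {σ : Type} {k : Type*} [Field k] (p : ℕ) [Fact p.Prime] [CharP k p]

/-- The `t`-fold Frobenius twist of polynomials: raise all coefficients to the power `p ^ t`. -/
def twist (t : ℕ) : MvPolynomial σ k →+* MvPolynomial σ k :=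
  MvPolynomial.map (iterateFrobenius k p t)

theorem twist_expand (t : ℕ) (G : MvPolynomial σ k) :
    twist p t (MvPolynomial.expand (p ^ t) G) = G ^ p ^ t :=
  MvPolynomial.map_iterateFrobenius_expand p G t

theorem expand_twist (t : ℕ) (G : MvPolynomial σ k) :
    MvPolynomial.expand (p ^ t) (twist p t G) = G ^ p ^ t := by
  rw [← twist_expand p t G, twist, MvPolynomial.map_expand]

theorem twist_twist (s t : ℕ) (G : MvPolynomial σ k) :
    twist p s (twist p t G) = twist p (s + t) G := by
  rw [twist, twist, twist, MvPolynomial.map_map, ← iterateFrobenius_add]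

theorem map_twist_twist (s t : ℕ) (I : Ideal (MvPolynomial σ k)) :
    (I.map (twist p t)).map (twist p s) = I.map (twist p (s + t)) := by
  rw [Ideal.map_map]
  congr 1
  exact RingHom.ext fun G => twist_twist p s t G

theorem map_twist_zero (I : Ideal (MvPolynomial σ k)) : I.map (twist p 0) = I := by
  have : (twist p 0 : MvPolynomial σ k →+* MvPolynomial σ k) = RingHom.id _ := by
    rw [twist, iterateFrobenius_zero]
    exact RingHom.ext fun G => MvPolynomial.map_id G
  rw [this, Ideal.map_id]

theorem totalDegree_twist_le (t : ℕ) (G : MvPolynomial σ k) :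
    (twist p t G).totalDegree ≤ G.totalDegree :=
  Finset.sup_mono (MvPolynomial.support_map_subset _ _)

/-- The ideal `I.map (twist p t)` cuts out the t-fold Frobenius twist of P/I, and `expand (p ^ s)`
induces the relative Frobenius between twists. It is well defined because `expand (p ^ s)` after
`twist p s` is the p^s-th power map. -/
theorem expand_mem_of_mem_map_twist (s t : ℕ) {I : Ideal (MvPolynomial σ k)}
    {G : MvPolynomial σ k} (hG : G ∈ I.map (twist p (t + s))) :
    MvPolynomial.expand (p ^ s) G ∈ I.map (twist p t) := by
  have h : I.map (twist p (t + s)) ≤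
      (I.map (twist p t)).comap (MvPolynomial.expand (p ^ s)).toRingHom := by
    rw [Ideal.map_le_iff_le_comap]
    intro g hg
    change MvPolynomial.expand (p ^ s) (twist p (t + s) g) ∈ I.map (twist p t)
    rw [add_comm, ← twist_twist, expand_twist]
    exact Ideal.pow_mem_of_mem _ (Ideal.mem_map_of_mem _ hg) _
      (pow_pos (Fact.out : p.Prime).pos _)
  exact h hG

/-- A level `e` Frobenius dual family for an ideal `I` of a polynomial ring `P`. Its member at the
twist `t = 0` exhibits `P / I` as a finite projective module over its relative Frobenius twist
`P / I ^ (p ^ e)`: every element `G` is the sum of the `expand (φ i G) * b i` modulo `I`. -/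
structure FrobeniusFamily (I : Ideal (MvPolynomial σ k)) (e c : ℕ) where
  ι : Type
  fintype : Fintype ι
  b : ι → MvPolynomial σ k
  φ : ℕ → ι → MvPolynomial σ k →ₗ[k] MvPolynomial σ k
  map_expand_mul : ∀ t i r G, φ t i (MvPolynomial.expand (p ^ e) r * G) = r * φ t i G
  map_mem : ∀ t i, ∀ G ∈ I.map (twist p t), φ t i G ∈ I.map (twist p (t + e))
  sum_sub_mem : ∀ t G, ∑ i, MvPolynomial.expand (p ^ e) (φ t i G) * twist p t (b i) - G ∈
    I.map (twist p t)
  -- Degrees shrink by the factor p^e up to the additive constant c. When c does not depend on e,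
  -- this bounds the degrees of generators uniformly.
  totalDegree_le : ∀ t i G, p ^ e * (φ t i G).totalDegree ≤ G.totalDegree + p ^ e * c
  map_twist : ∀ t i G, φ (t + 1) i (twist p 1 G) = twist p 1 (φ t i G)

attribute [instance] FrobeniusFamily.fintype

/-- The family of level zero. -/
def FrobeniusFamily.zero (I : Ideal (MvPolynomial σ k)) (c : ℕ) : FrobeniusFamily p I 0 c where
  ι := Unit
  fintype := inferInstance
  b _ := 1
  φ _ _ := LinearMap.id
  map_expand_mul t i r G := by simp
  map_mem t i G hG := hG
  sum_sub_mem t G := by simp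
  totalDegree_le t i G := by simp
  map_twist t i G := rfl

/-- The composition of a family of level `e` with a family of level one. -/
def FrobeniusFamily.succ {I : Ideal (MvPolynomial σ k)} {e c : ℕ}
    (A : FrobeniusFamily p I 1 c) (B : FrobeniusFamily p I e (2 * c)) :
    FrobeniusFamily p I (e + 1) (2 * c) where
  ι := B.ι × A.ι
  fintype := inferInstance
  b x := B.b x.1 * A.b x.2 ^ p ^ e
  φ t x := A.φ (t + e) x.2 ∘ₗ B.φ t x.1
  map_expand_mul t i r G := by
    rw [LinearMap.comp_apply, pow_succ, MvPolynomial.expand_mul, B.map_expand_mul,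
      LinearMap.comp_apply, ← A.map_expand_mul, pow_one]
  map_mem t i G hG := A.map_mem _ _ _ (B.map_mem _ _ _ hG)
  sum_sub_mem t G := by
    have h1 : ∀ i : B.ι, ∑ j : A.ι,
        MvPolynomial.expand (p ^ (e + 1)) (A.φ (t + e) j (B.φ t i G)) *
          twist p t (B.b i * A.b j ^ p ^ e) -
        MvPolynomial.expand (p ^ e) (B.φ t i G) * twist p t (B.b i) ∈ I.map (twist p t) := by
      intro i
      have h2 := Ideal.mul_mem_right (twist p t (B.b i)) _
        (expand_mem_of_mem_map_twist p e t (A.sum_sub_mem (t + e) (B.φ t i G)))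
      convert h2 using 1
      rw [map_sub, map_sum, sub_mul, Finset.sum_mul]
      congr 1
      refine Finset.sum_congr rfl fun j _ => ?_
      rw [map_mul, map_mul, pow_succ, MvPolynomial.expand_mul, pow_one, add_comm t e,
        ← twist_twist, expand_twist, map_pow]
      ring
    have h3 := add_mem (sum_mem fun i (_ : i ∈ Finset.univ) => h1 i) (B.sum_sub_mem t G)
    rw [Finset.sum_sub_distrib, sub_add_sub_cancel] at h3
    rw [Fintype.sum_prod_type]
    exact h3
  -- The constant 2c reproduces itself: the composition costs 2c p^e + c p^(e+1), which is at most
  -- 2c p^(e+1) because p ≥ 2.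
  totalDegree_le t i G := by
    have h1 := A.totalDegree_le (t + e) i.2 (B.φ t i.1 G)
    have h2 := B.totalDegree_le t i.1 G
    have h3 := (Fact.out : p.Prime).two_le
    rw [LinearMap.comp_apply, pow_succ, mul_assoc, mul_assoc]
    rw [pow_one] at h1
    have h4 := Nat.mul_le_mul_left (p ^ e) h1
    have h5 := Nat.mul_le_mul_left (p ^ e) (Nat.mul_le_mul_right c h3)
    nlinarith
  map_twist t i G := by
    rw [LinearMap.comp_apply, LinearMap.comp_apply, B.map_twist, add_right_comm, A.map_twist]

/-- A family of level one with constant `c` generates families of all levels. -/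
def FrobeniusFamily.iterate {I : Ideal (MvPolynomial σ k)} {c : ℕ}
    (A : FrobeniusFamily p I 1 c) : ∀ e, FrobeniusFamily p I e (2 * c)
  | 0 => .zero p I (2 * c)
  | e + 1 => A.succ p (A.iterate e)

end FrobeniusFamilies

/-! ### The family of level one attached to a substitution X ↦ Y -/

section LevelOne

variable {σ : Type} {k : Type*} [Field k] (p : ℕ) [Fact p.Prime] [CharP k p]

theorem map_frobenius_map_twist_le (t : ℕ) (I : Ideal (MvPolynomial σ k)) :
    (I.map (frobenius _ p)).map (twist p t) ≤ (I.map (twist p t)).map (frobenius _ p) := by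
  rw [Ideal.map_map, Ideal.map_map]
  refine le_of_eq ?_
  congr 1
  exact RingHom.ext fun G => by simp [frobenius_def]

/-- Y_i ≡ X_i modulo I gives Y_i^p ≡ X_i^p modulo the Frobenius power of I, and an expanded
polynomial involves only p-th powers of the variables. -/
theorem aeval_expand_sub_expand_mem {I : Ideal (MvPolynomial σ k)} {Y : σ → MvPolynomial σ k}
    (hY : ∀ i, Y i - MvPolynomial.X i ∈ I) (G : MvPolynomial σ k) :
    MvPolynomial.aeval Y (MvPolynomial.expand p G) - MvPolynomial.expand p G ∈
      I.map (frobenius _ p) := by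
  rw [← Ideal.Quotient.eq]
  have h : ((Ideal.Quotient.mkₐ k (I.map (frobenius _ p))).comp (MvPolynomial.aeval Y)).comp
      (MvPolynomial.expand p) =
      (Ideal.Quotient.mkₐ k (I.map (frobenius _ p))).comp (MvPolynomial.expand p) := by
    refine MvPolynomial.algHom_ext fun i => ?_
    simp only [AlgHom.comp_apply, MvPolynomial.expand_X, map_pow, MvPolynomial.aeval_X]
    rw [← map_pow, ← map_pow, Ideal.Quotient.mkₐ_eq_mk, Ideal.Quotient.eq, ← sub_pow_char]
    exact Ideal.mem_map_of_mem (frobenius _ p) (hY i)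
  exact DFunLike.congr_fun h G

theorem twist_aeval (Y : σ → MvPolynomial σ k) (t : ℕ) (G : MvPolynomial σ k) :
    twist p t (MvPolynomial.aeval Y G) =
      MvPolynomial.aeval (fun i => twist p t (Y i)) (twist p t G) := by
  induction G using MvPolynomial.induction_on with
  | C a => simp [twist]
  | add G H hG hH => simp only [map_add, hG, hH]
  | mul_X G i hG => simp only [map_mul, hG, MvPolynomial.aeval_X]; simp [twist]

theorem twist_X (t : ℕ) (i : σ) :
    twist p t (MvPolynomial.X i : MvPolynomial σ k) = MvPolynomial.X i :=
  MvPolynomial.map_X _ _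

variable [Fintype σ]

/-- A p-th power y^p equals `expand p (twist p 1 y)`, and `residuePart` is linear over expanded
polynomials. -/
theorem residuePart_mem_of_mem_map_frobenius {I : Ideal (MvPolynomial σ k)} (u : σ → Fin p)
    {G : MvPolynomial σ k} (hG : G ∈ I.map (frobenius _ p)) :
    residuePart p u G ∈ I.map (twist p 1) := by
  rw [Ideal.map] at hG
  suffices h : ∀ a, residuePart p u (a * G) ∈ I.map (twist p 1) by simpa using h 1
  induction hG using Submodule.span_induction with
  | mem x hx =>
    intro a
    obtain ⟨y, hy, rfl⟩ := hx
    have h : a * frobenius _ p y = MvPolynomial.expand p (twist p 1 y) * a := by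
      have := expand_twist p 1 y
      rw [pow_one] at this
      rw [this, mul_comm, frobenius_def]
    rw [h, residuePart_expand_mul (Fact.out : p.Prime).pos]
    exact Ideal.mul_mem_right _ _ (Ideal.mem_map_of_mem _ hy)
  | zero => intro a; rw [mul_zero, map_zero]; exact zero_mem _
  | add x y _ _ hx hy => intro a; rw [mul_add, map_add]; exact add_mem (hx a) (hy a)
  | smul b x hx ih => intro a; rw [smul_eq_mul, ← mul_assoc]; exact ih _

/-- The product of the powers of the entries of `Y` with exponents in `v`. -/
def residuePower {p : ℕ} (Y : σ → MvPolynomial σ k) (v : σ → Fin p) : MvPolynomial σ k :=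
  ∏ i, Y i ^ (v i : ℕ)

theorem residuePower_X {p : ℕ} (v : σ → Fin p) :
    residuePower (MvPolynomial.X : σ → MvPolynomial σ k) v =
      MvPolynomial.monomial (residueExponent v) 1 := by
  rw [MvPolynomial.monomial_eq, MvPolynomial.C_1, one_mul, Finsupp.prod_fintype _ _ (by simp)]
  rfl

theorem map_residuePower {p : ℕ} (Y : σ → MvPolynomial σ k) (v : σ → Fin p)
    (g : MvPolynomial σ k →+* MvPolynomial σ k) :
    g (residuePower Y v) = residuePower (fun i => g (Y i)) v := by
  simp [residuePower]

/-- The members of the family of level one attached to an endomorphism `X ↦ Y` of the polynomial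
ring. -/
def levelOneMap (Y : σ → MvPolynomial σ k) (u : σ → Fin p) :
    MvPolynomial σ k →ₗ[k] MvPolynomial σ k :=
  letI := Classical.decEq σ
  ∑ v : σ → Fin p, LinearMap.mulRight k (residuePart p u (residuePower Y v)) ∘ₗ residuePart p v

theorem levelOneMap_apply (Y : σ → MvPolynomial σ k) (u : σ → Fin p) (G : MvPolynomial σ k) :
    letI := Classical.decEq σ
    levelOneMap p Y u G =
      ∑ v : σ → Fin p, residuePart p v G * residuePart p u (residuePower Y v) := by
  simp [levelOneMap]

theorem levelOneMap_eq_residuePart (Y : σ → MvPolynomial σ k) (u : σ → Fin p)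
    (G : MvPolynomial σ k) :
    letI := Classical.decEq σ
    levelOneMap p Y u G = residuePart p u
      (∑ v : σ → Fin p, MvPolynomial.expand p (residuePart p v G) * residuePower Y v) := by
  rw [levelOneMap_apply, map_sum]
  exact Finset.sum_congr rfl fun v _ => by
    rw [residuePart_expand_mul (Fact.out : p.Prime).pos]

/-- Substituting Y only into the residue monomials is exactly linear over expanded polynomials,
unlike the full substitution. The two differ by an element of the Frobenius power of I. -/
theorem sum_expand_sub_aeval_mem {I : Ideal (MvPolynomial σ k)} {Y : σ → MvPolynomial σ k}
    (hY : ∀ i, Y i - MvPolynomial.X i ∈ I) (G : MvPolynomial σ k) :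
    letI := Classical.decEq σ
    ∑ v : σ → Fin p, MvPolynomial.expand p (residuePart p v G) * residuePower Y v -
      MvPolynomial.aeval Y G ∈ I.map (frobenius _ p) := by
  have h : MvPolynomial.aeval Y G = letI := Classical.decEq σ
      ∑ v : σ → Fin p, MvPolynomial.aeval Y (MvPolynomial.expand p (residuePart p v G)) *
        residuePower Y v := by
    conv_lhs => rw [← sum_expand_residuePart (Fact.out : p.Prime).pos G]
    rw [map_sum]
    refine Finset.sum_congr rfl fun v _ => ?_
    rw [map_mul, ← residuePower_X]
    congr 1
    simp [residuePower]
  rw [h, ← Finset.sum_sub_distrib]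
  refine sum_mem fun v _ => ?_
  rw [← sub_mul]
  refine Ideal.mul_mem_right _ _ ?_
  rw [← neg_sub]
  exact neg_mem (aeval_expand_sub_expand_mem p hY _)

theorem levelOneMap_mem {I : Ideal (MvPolynomial σ k)} {Y : σ → MvPolynomial σ k}
    (hY : ∀ i, Y i - MvPolynomial.X i ∈ I)
    (hI : ∀ G ∈ I, MvPolynomial.aeval Y G ∈ I.map (frobenius _ p)) (u : σ → Fin p)
    {G : MvPolynomial σ k} (hG : G ∈ I) : levelOneMap p Y u G ∈ I.map (twist p 1) := by
  rw [levelOneMap_eq_residuePart]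
  refine residuePart_mem_of_mem_map_frobenius p u ?_
  have := add_mem (sum_expand_sub_aeval_mem p hY G) (hI G hG)
  rwa [sub_add_cancel] at this

theorem sum_expand_levelOneMap_sub_mem {I : Ideal (MvPolynomial σ k)}
    {Y : σ → MvPolynomial σ k} (hY : ∀ i, Y i - MvPolynomial.X i ∈ I) (G : MvPolynomial σ k) :
    letI := Classical.decEq σ
    ∑ u : σ → Fin p, MvPolynomial.expand p (levelOneMap p Y u G) *
      MvPolynomial.monomial (residueExponent u) 1 - G ∈ I := by
  simp only [levelOneMap_eq_residuePart]
  rw [sum_expand_residuePart (Fact.out : p.Prime).pos]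
  have hG := sum_expand_residuePart (Fact.out : p.Prime).pos G
  suffices h : letI := Classical.decEq σ
      ∑ v : σ → Fin p, MvPolynomial.expand p (residuePart p v G) * residuePower Y v -
      ∑ v : σ → Fin p, MvPolynomial.expand p (residuePart p v G) *
        MvPolynomial.monomial (residueExponent v) 1 ∈ I by rwa [hG] at h
  rw [← Finset.sum_sub_distrib]
  refine sum_mem fun v _ => ?_
  rw [← mul_sub, ← residuePower_X]
  refine Ideal.mul_mem_left _ _ ?_
  rw [← Ideal.Quotient.eq, residuePower, residuePower, map_prod, map_prod]
  exact Finset.prod_congr rfl fun i _ => by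
    rw [map_pow, map_pow, Ideal.Quotient.eq.2 (hY i)]

theorem levelOneMap_twist (Y : σ → MvPolynomial σ k) (u : σ → Fin p) (t : ℕ)
    (G : MvPolynomial σ k) :
    levelOneMap p (fun i => twist p t (Y i)) u (twist p t G) =
      twist p t (levelOneMap p Y u G) := by
  rw [levelOneMap_apply, levelOneMap_apply, map_sum]
  refine Finset.sum_congr rfl fun v _ => ?_
  rw [← map_residuePower, map_mul, twist, residuePart_map, residuePart_map]

/-- The family of level one attached to an endomorphism `X ↦ Y` of the polynomial ring which is
the identity modulo `I` and maps `I` to its Frobenius power. -/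
def FrobeniusFamily.levelOne {I : Ideal (MvPolynomial σ k)} {Y : σ → MvPolynomial σ k}
    (hY : ∀ i, Y i - MvPolynomial.X i ∈ I)
    (hI : ∀ G ∈ I, MvPolynomial.aeval Y G ∈ I.map (frobenius _ p)) :
    letI := Classical.decEq σ
    FrobeniusFamily p I 1 (∑ u : σ → Fin p, ∑ v : σ → Fin p,
      (residuePart p u (residuePower Y v)).totalDegree) :=
  letI := Classical.decEq σ
  have hYt : ∀ t i, twist p t (Y i) - MvPolynomial.X i ∈ I.map (twist p t) := by
    intro t i
    rw [← twist_X p t i, ← map_sub]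
    exact Ideal.mem_map_of_mem _ (hY i)
  have hIt : ∀ t, ∀ G ∈ I.map (twist p t), MvPolynomial.aeval (fun i => twist p t (Y i)) G ∈
      (I.map (twist p t)).map (frobenius _ p) := by
    intro t
    have : I.map (twist p t) ≤ ((I.map (twist p t)).map (frobenius _ p)).comap
        (MvPolynomial.aeval (fun i => twist p t (Y i))).toRingHom := by
      rw [Ideal.map_le_iff_le_comap]
      intro g hg
      change MvPolynomial.aeval (fun i => twist p t (Y i)) (twist p t g) ∈
        (I.map (twist p t)).map (frobenius _ p)
      rw [← twist_aeval]
      exact map_frobenius_map_twist_le p t I (Ideal.mem_map_of_mem _ (hI g hg))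
    exact this
  { ι := σ → Fin p
    fintype := inferInstance
    b u := MvPolynomial.monomial (residueExponent u) 1
    φ t u := levelOneMap p (fun i => twist p t (Y i)) u
    map_expand_mul t u r G := by
      rw [levelOneMap_apply, levelOneMap_apply, Finset.mul_sum, pow_one]
      exact Finset.sum_congr rfl fun v _ => by
        rw [residuePart_expand_mul (Fact.out : p.Prime).pos, mul_assoc]
    map_mem t u G hG := by
      rw [add_comm, ← map_twist_twist]
      exact levelOneMap_mem p (hYt t) (hIt t) u hG
    sum_sub_mem t G := by
      have h : ∀ u : σ → Fin p, twist p t (MvPolynomial.monomial (residueExponent u) (1 : k)) =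
          MvPolynomial.monomial (residueExponent u) 1 := by
        intro u
        rw [twist, MvPolynomial.map_monomial, map_one]
      simp only [h, pow_one]
      exact sum_expand_levelOneMap_sub_mem p (hYt t) G
    totalDegree_le t u G := by
      rw [pow_one, mul_comm p, ← Nat.le_div_iff_mul_le (Fact.out : p.Prime).pos,
        Nat.add_mul_div_left _ _ (Fact.out : p.Prime).pos, levelOneMap_apply]
      refine MvPolynomial.totalDegree_finsetSum_le fun v _ => ?_
      refine (MvPolynomial.totalDegree_mul _ _).trans (add_le_add ?_ ?_)
      · rw [Nat.le_div_iff_mul_le (Fact.out : p.Prime).pos, mul_comm]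
        exact mul_totalDegree_residuePart_le (Fact.out : p.Prime).pos v G
      · rw [← map_residuePower, twist, residuePart_map]
        refine (totalDegree_twist_le p t _).trans ?_
        refine le_trans ?_ (Finset.single_le_sum (fun _ _ => Nat.zero_le _) (Finset.mem_univ u))
        exact Finset.single_le_sum
          (f := fun v => (residuePart p u (residuePower Y v)).totalDegree)
          (fun _ _ => Nat.zero_le _) (Finset.mem_univ v)
    map_twist t u G := by
      rw [← levelOneMap_twist]
      simp only [twist_twist, add_comm t 1] }

end LevelOne

/-! ### Coordinates of k over its p^e-th powers -/

section FrobeniusCoordinates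

variable {k : Type*} [Field k] (p : ℕ) [Fact p.Prime] [CharP k p]

theorem exists_coordinates_of_ringHom {K L : Type*} [Field K] [Field L] (φ : K →+* L) :
    ∃ (V : Set L) (θ : V → L) (coord : L →+ (V →₀ K)),
      (∀ c x, coord (φ c * x) = c • coord x) ∧
      ∀ x, (coord x).sum (fun v c => φ c * θ v) = x := by
  let _ : Algebra K L := φ.toAlgebra
  let B := Module.Basis.ofVectorSpace K L
  refine ⟨_, B, B.repr.toLinearMap.toAddMonoidHom, fun c x => ?_, fun x => ?_⟩
  · have := B.repr.map_smul c x
    rwa [Algebra.smul_def] at this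
  · have := B.linearCombination_repr x
    simp only [Finsupp.linearCombination_apply, Algebra.smul_def] at this
    exact this

/-- A field of characteristic `p` has coordinates over its subfield of `p ^ e`-th powers. -/
theorem exists_frobenius_coordinates (k : Type*) [Field k] [CharP k p] (e : ℕ) :
    ∃ (V : Set k) (θ : V → k) (coord : k →+ (V →₀ k)),
      (∀ c x, coord (c ^ p ^ e * x) = c • coord x) ∧
      ∀ x, (coord x).sum (fun v c => c ^ p ^ e * θ v) = x :=
  exists_coordinates_of_ringHom (iterateFrobenius k p e)

/-- Apply an additive map to all the coefficients of a polynomial. -/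
def mapCoeff {σ : Type} {k : Type*} [CommRing k] (ρ : k →+ k) :
    MvPolynomial σ k →+ MvPolynomial σ k :=
  ((MvPolynomial.basisMonomials σ k).repr.symm.toLinearMap.toAddMonoidHom.comp
    (Finsupp.mapRange.addMonoidHom ρ)).comp
      (MvPolynomial.basisMonomials σ k).repr.toLinearMap.toAddMonoidHom

theorem mapCoeff_monomial {σ : Type} (ρ : k →+ k) (m : σ →₀ ℕ) (c : k) :
    mapCoeff ρ (MvPolynomial.monomial m c) = MvPolynomial.monomial m (ρ c) := by
  have h : ∀ c, (MvPolynomial.monomial m c : MvPolynomial σ k) =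
      (MvPolynomial.basisMonomials σ k).repr.symm (Finsupp.single m c) := by
    intro c
    rw [Module.Basis.repr_symm_single, MvPolynomial.coe_basisMonomials,
      MvPolynomial.smul_monomial, smul_eq_mul, mul_one]
  rw [h, h]
  change (MvPolynomial.basisMonomials σ k).repr.symm (Finsupp.mapRange ρ ρ.map_zero
    ((MvPolynomial.basisMonomials σ k).repr _)) = _
  rw [LinearEquiv.apply_symm_apply, Finsupp.mapRange_single]

theorem coeff_mapCoeff {σ : Type} (ρ : k →+ k) (m : σ →₀ ℕ) (G : MvPolynomial σ k) :
    (mapCoeff ρ G).coeff m = ρ (G.coeff m) := by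
  classical
  induction G using MvPolynomial.induction_on' with
  | monomial a c =>
    rw [mapCoeff_monomial, MvPolynomial.coeff_monomial, MvPolynomial.coeff_monomial]
    split_ifs <;> simp
  | add G H hG hH => simp only [map_add, MvPolynomial.coeff_add, hG, hH]

theorem mapCoeff_twist_mul {σ : Type} {e : ℕ} {ρ : k →+ k}
    (hρ : ∀ c x, ρ (c ^ p ^ e * x) = c * ρ x) (r G : MvPolynomial σ k) :
    mapCoeff ρ (twist p e r * G) = r * mapCoeff ρ G := by
  induction r using MvPolynomial.induction_on' with
  | monomial a c =>
    induction G using MvPolynomial.induction_on' with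
    | monomial m d =>
      rw [twist, MvPolynomial.map_monomial, MvPolynomial.monomial_mul, mapCoeff_monomial,
        mapCoeff_monomial, MvPolynomial.monomial_mul, iterateFrobenius_def, hρ]
    | add G H hG hH => rw [mul_add, map_add, map_add, mul_add, hG, hH]
  | add r s hr hs => rw [map_add, add_mul, map_add, add_mul, hr, hs]

theorem mem_span_twist_mapCoeff {σ : Type} {e : ℕ} {V : Type*} {θ : V → k}
    {coord : k →+ (V →₀ k)}
    (hθ : ∀ x, (coord x).sum (fun v c => c ^ p ^ e * θ v) = x) (G : MvPolynomial σ k) :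
    G ∈ Ideal.span (Set.range fun v =>
      twist p e (mapCoeff ((Finsupp.applyAddHom v).comp coord) G)) := by
  classical
  let s : Finset V := G.support.biUnion fun m => (coord (G.coeff m)).support
  have h : G = ∑ v ∈ s, MvPolynomial.C (θ v) *
      twist p e (mapCoeff ((Finsupp.applyAddHom v).comp coord) G) := by
    ext m
    rw [MvPolynomial.coeff_sum]
    simp only [MvPolynomial.coeff_C_mul, twist, MvPolynomial.coeff_map, coeff_mapCoeff,
      iterateFrobenius_def]
    by_cases hm : m ∈ G.support
    · conv_lhs => rw [← hθ (G.coeff m)]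
      rw [Finsupp.sum_of_support_subset _
        (Finset.subset_biUnion_of_mem (fun m => (coord (G.coeff m)).support) hm) _
        (fun v _ => by rw [zero_pow (pow_pos (Fact.out : p.Prime).pos _).ne', zero_mul])]
      exact Finset.sum_congr rfl fun v _ => mul_comm _ _
    · rw [MvPolynomial.notMem_support_iff.1 hm]
      symm
      refine Finset.sum_eq_zero fun v _ => ?_
      rw [map_zero, zero_pow (pow_pos (Fact.out : p.Prime).pos _).ne', mul_zero]
  set J := Ideal.span (Set.range fun v =>
    twist p e (mapCoeff ((Finsupp.applyAddHom v).comp coord) G)) with hJ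
  rw [h]
  exact sum_mem fun v _ => Ideal.mul_mem_left _ _ (Ideal.subset_span (Set.mem_range_self v))

end FrobeniusCoordinates

/-! ### Flatness of the relative Frobenius -/

section FamilyIdeals

variable {σ : Type} {k : Type*} [Field k] {p : ℕ} [Fact p.Prime] [CharP k p]
  {I : Ideal (MvPolynomial σ k)} {e c : ℕ}

/-- Membership in an ideal extended along the relative Frobenius is detected by a Frobenius dual
family. -/
theorem FrobeniusFamily.mem_map_expand_sup_iff (A : FrobeniusFamily p I e c) (t : ℕ)
    {J : Ideal (MvPolynomial σ k)} (hJ : I.map (twist p (t + e)) ≤ J) (G : MvPolynomial σ k) :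
    G ∈ J.map (MvPolynomial.expand (p ^ e)) ⊔ I.map (twist p t) ↔ ∀ i, A.φ t i G ∈ J := by
  constructor
  · intro hG i
    obtain ⟨x, hx, y, hy, rfl⟩ := Submodule.mem_sup.1 hG
    rw [map_add]
    refine add_mem ?_ (hJ (A.map_mem t i y hy))
    clear hG
    rw [Ideal.map] at hx
    suffices h : ∀ a, A.φ t i (a * x) ∈ J by simpa using h 1
    induction hx using Submodule.span_induction with
    | mem x hx =>
      intro a
      obtain ⟨z, hz, rfl⟩ := hx
      change A.φ t i (a * MvPolynomial.expand (p ^ e) z) ∈ J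
      rw [mul_comm, A.map_expand_mul]
      exact Ideal.mul_mem_right _ _ hz
    | zero => intro a; rw [mul_zero, map_zero]; exact zero_mem _
    | add x y _ _ hx hy => intro a; rw [mul_add, map_add]; exact add_mem (hx a) (hy a)
    | smul b x hx ih => intro a; rw [smul_eq_mul, ← mul_assoc]; exact ih _
  · intro h
    have h1 := A.sum_sub_mem t G
    rw [← sub_sub_cancel (∑ i, MvPolynomial.expand (p ^ e) (A.φ t i G) * twist p t (A.b i)) G]
    refine sub_mem (Ideal.mem_sup_left (sum_mem fun i _ => ?_)) (Ideal.mem_sup_right h1)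
    exact Ideal.mul_mem_right _ _ (Ideal.mem_map_of_mem _ (h i))

/-- The relative Frobenius is faithfully flat. -/
theorem FrobeniusFamily.mem_of_expand_mem (A : FrobeniusFamily p I e c)
    {J : Ideal (MvPolynomial σ k)} (hJ : I.map (twist p e) ≤ J) {z : MvPolynomial σ k}
    (hz : MvPolynomial.expand (p ^ e) z ∈ J.map (MvPolynomial.expand (p ^ e)) ⊔ I) : z ∈ J := by
  have h1 := A.sum_sub_mem 0 1
  have h2 := (A.mem_map_expand_sup_iff 0 (J := J) (by rwa [zero_add])
    (MvPolynomial.expand (p ^ e) z)).1 (by rwa [map_twist_zero])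
  have h3 : ∀ i, z * A.φ 0 i 1 ∈ J := by
    intro i
    have := h2 i
    rwa [← mul_one (MvPolynomial.expand (p ^ e) z), A.map_expand_mul] at this
  rw [map_twist_zero] at h1
  -- Twisting the expansion of 1 gives 1 ≡ ∑ φ_i(1)^(p^e) b_i' modulo J, where b_i' is a twist of
  -- b_i. Multiplying by z and using z φ_i(1) ∈ J yields z ∈ J.
  have h4 := hJ (Ideal.mem_map_of_mem (twist p e) h1)
  rw [map_sub, map_sum, map_one] at h4
  have h5 : z = ∑ i, z * twist p e (MvPolynomial.expand (p ^ e) (A.φ 0 i 1) *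
      twist p 0 (A.b i)) - z * (∑ i, twist p e (MvPolynomial.expand (p ^ e) (A.φ 0 i 1) *
      twist p 0 (A.b i)) - 1) := by
    rw [mul_sub, Finset.mul_sum]
    ring
  rw [h5]
  refine sub_mem (sum_mem fun i _ => ?_) (Ideal.mul_mem_left _ _ h4)
  rw [map_mul, twist_expand, ← mul_assoc]
  refine Ideal.mul_mem_right _ _ ?_
  rw [← Nat.sub_add_cancel (Nat.one_le_pow e p (Fact.out : p.Prime).pos), pow_succ',
    ← mul_assoc]
  exact Ideal.mul_mem_right _ _ (h3 i)

end FamilyIdeals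

/-! ### Families from formal smoothness -/

section SmoothFamilies

/-- Makes the kernel of P/I^[p] → P/I nilpotent, so that formal smoothness applies to this
surjection. -/
theorem pow_exponent_le_map_frobenius {P : Type*} [CommRing P] [IsNoetherianRing P] (p : ℕ)
    [Fact p.Prime] [CharP P p] (I : Ideal P) : ∃ n, I ^ n ≤ I.map (frobenius P p) :=
  Ideal.exists_pow_le_of_le_radical_of_fg
    (fun _ hx => ⟨p, Ideal.mem_map_of_mem (frobenius P p) hx⟩) (IsNoetherian.noetherian I)

/-- The kernel of a presentation of a formally smooth algebra has Frobenius dual families of all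
levels, of uniformly bounded degrees. -/
theorem exists_frobeniusFamily {k : Type*} [Field k] (p : ℕ) [Fact p.Prime] [CharP k p]
    {R : Type*} [CommRing R] [Algebra k R] [Algebra.FormallySmooth k R] {σ : Type} [Fintype σ]
    (π : MvPolynomial σ k →ₐ[k] R) (hπ : Function.Surjective π) :
    ∃ c, ∀ e, Nonempty (FrobeniusFamily p (RingHom.ker π) e c) := by
  set I := RingHom.ker π with hI
  let I' := I.map (frobenius (MvPolynomial σ k) p)
  have hI' : I' ≤ I := by
    rw [Ideal.map_le_iff_le_comap]
    intro x hx
    exact Ideal.pow_mem_of_mem _ hx p (Fact.out : p.Prime).pos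
  let g : (MvPolynomial σ k ⧸ I') →ₐ[k] R := Ideal.Quotient.liftₐ I' π fun a ha => hI' ha
  have hg : Function.Surjective g := fun r => by
    obtain ⟨a, rfl⟩ := hπ r
    exact ⟨Ideal.Quotient.mk I' a, rfl⟩
  have hnil : IsNilpotent (RingHom.ker (g : (MvPolynomial σ k ⧸ I') →+* R)) := by
    obtain ⟨n, hn⟩ := pow_exponent_le_map_frobenius p I
    refine ⟨n, ?_⟩
    have hk : RingHom.ker (g : (MvPolynomial σ k ⧸ I') →+* R) = I.map (Ideal.Quotient.mk I') := by
      refine le_antisymm (fun x hx => ?_) ?_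
      · obtain ⟨a, rfl⟩ := Ideal.Quotient.mk_surjective x
        exact Ideal.mem_map_of_mem _ hx
      · rw [Ideal.map_le_iff_le_comap]
        intro a ha
        exact ha
    rw [hk, ← Ideal.map_pow, Ideal.zero_eq_bot, eq_bot_iff, Ideal.map_le_iff_le_comap]
    intro a ha
    exact Ideal.Quotient.eq_zero_iff_mem.2 (hn ha)
  -- Formal smoothness lifts the identity of R to P/I^[p]. Polynomial representatives Y of the
  -- images of the variables then satisfy Y ≡ X modulo I, and the substitution carries I into I^[p].
  let s : R →ₐ[k] (MvPolynomial σ k ⧸ I') :=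
    Algebra.FormallySmooth.liftOfSurjective (AlgHom.id k R) g hg hnil
  have hs : ∀ r, g (s r) = r :=
    Algebra.FormallySmooth.liftOfSurjective_apply (AlgHom.id k R) g hg hnil
  choose Y hY using fun i => Ideal.Quotient.mk_surjective (s (π (MvPolynomial.X i)))
  have hYs : ∀ G, Ideal.Quotient.mk I' (MvPolynomial.aeval Y G) = s (π G) := by
    have : (Ideal.Quotient.mkₐ k I').comp (MvPolynomial.aeval Y) = s.comp π :=
      MvPolynomial.algHom_ext fun i => by simp [hY]
    exact DFunLike.congr_fun this
  have h1 : ∀ i, Y i - MvPolynomial.X i ∈ I := by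
    intro i
    have h := hs (π (MvPolynomial.X i))
    rw [← hY] at h
    rw [hI, RingHom.mem_ker, map_sub, sub_eq_zero]
    exact h
  have h2 : ∀ G ∈ I, MvPolynomial.aeval Y G ∈ I.map (frobenius _ p) := by
    intro G hG
    rw [hI, RingHom.mem_ker] at hG
    rw [← Ideal.Quotient.eq_zero_iff_mem]
    exact (hYs G).trans (by rw [hG, map_zero])
  exact ⟨_, fun e => ⟨(FrobeniusFamily.levelOne p h1 h2).iterate p e⟩⟩

end SmoothFamilies

/-! ### Absolute dual families and Frobenius powers of ideals -/

section FrobeniusPowers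

variable {R : Type*} [CommRing R] {p : ℕ}

/-- A family of additive maps exhibiting `R` as a projective module over its subring of
`p ^ e`-th powers. -/
def IsFrobeniusDual {ι : Type*} (p e : ℕ) (ψ : ι → R →+ R) : Prop :=
  (∀ i r g, ψ i (r ^ p ^ e * g) = r * ψ i g) ∧
    ∀ g, g ∈ Ideal.span (Set.range fun i => ψ i g ^ p ^ e)

theorem pow_mem_frobeniusPower (e : ℕ) {J : Ideal R} {x : R} (hx : x ∈ J) :
    x ^ p ^ e ∈ frobeniusPower p e J :=
  Ideal.subset_span ⟨x, hx, rfl⟩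

theorem frobeniusPower_mono (e : ℕ) {J J' : Ideal R} (h : J ≤ J') :
    frobeniusPower p e J ≤ frobeniusPower p e J' :=
  Ideal.span_mono (Set.image_mono h)

/-- The form in which flatness of the absolute Frobenius is used: membership in a Frobenius power
becomes a family of memberships in J itself, which commutes visibly with colons and intersections.
-/
theorem IsFrobeniusDual.mem_frobeniusPower_iff {ι : Type*} {e : ℕ} {ψ : ι → R →+ R}
    (hψ : IsFrobeniusDual p e ψ) (J : Ideal R) (g : R) :
    g ∈ frobeniusPower p e J ↔ ∀ i, ψ i g ∈ J := by
  constructor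
  · intro hg i
    suffices h : ∀ a, ψ i (a * g) ∈ J by simpa using h 1
    rw [frobeniusPower] at hg
    induction hg using Submodule.span_induction with
    | mem x hx =>
      intro a
      obtain ⟨y, hy, rfl⟩ := hx
      change ψ i (a * y ^ p ^ e) ∈ J
      rw [mul_comm, hψ.1]
      exact Ideal.mul_mem_right _ _ hy
    | zero => intro a; rw [mul_zero, map_zero]; exact zero_mem _
    | add x y _ _ hx hy => intro a; rw [mul_add, map_add]; exact add_mem (hx a) (hy a)
    | smul b x hx ih => intro a; rw [smul_eq_mul, ← mul_assoc]; exact ih _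
  · intro h
    refine Ideal.span_le.2 ?_ (hψ.2 g)
    rintro _ ⟨i, rfl⟩
    exact pow_mem_frobeniusPower e (h i)

/-- Frobenius powers of ideals commute with colon ideals by an element. -/
theorem IsFrobeniusDual.mem_frobeniusPower_colon {ι : Type*} {e : ℕ} {ψ : ι → R →+ R}
    (hψ : IsFrobeniusDual p e ψ) {J J' : Ideal R} {x g : R}
    (hJ : ∀ y, x * y ∈ J → y ∈ J') (hg : x ^ p ^ e * g ∈ frobeniusPower p e J) :
    g ∈ frobeniusPower p e J' := by
  rw [hψ.mem_frobeniusPower_iff] at hg ⊢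
  exact fun i => hJ _ (by rw [← hψ.1]; exact hg i)

/-- Frobenius powers of ideals commute with arbitrary intersections. -/
theorem IsFrobeniusDual.mem_frobeniusPower_sInf {ι : Type*} {e : ℕ} {ψ : ι → R →+ R}
    (hψ : IsFrobeniusDual p e ψ) {S : Set (Ideal R)} {g : R}
    (hg : ∀ J ∈ S, g ∈ frobeniusPower p e J) : g ∈ frobeniusPower p e (sInf S) := by
  rw [hψ.mem_frobeniusPower_iff]
  exact fun i => Submodule.mem_sInf.2 fun J hJ => (hψ.mem_frobeniusPower_iff J g).1 (hg J hJ) i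

/-- The colon ideal of `J` by `x`. -/
def colonBy (J : Ideal R) (x : R) : Ideal R :=
  Submodule.comap (LinearMap.mulLeft R x) J

theorem mem_colonBy {J : Ideal R} {x y : R} : y ∈ colonBy J x ↔ x * y ∈ J :=
  Iff.rfl

theorem frobeniusPower_le_self (hp : 0 < p) (e : ℕ) (J : Ideal R) : frobeniusPower p e J ≤ J := by
  refine Ideal.span_le.2 ?_
  rintro _ ⟨x, hx, rfl⟩
  exact Ideal.pow_mem_of_mem _ hx _ (pow_pos hp e)

/-- By the colon property with g = 1, the element 1 lies in the Frobenius power of J : x, hence in J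
: x. -/
theorem IsFrobeniusDual.mem_of_pow_mem (hp : 0 < p) {ι : Type*} {e : ℕ} {ψ : ι → R →+ R}
    (hψ : IsFrobeniusDual p e ψ) {J : Ideal R} {x : R}
    (hx : x ^ p ^ e ∈ frobeniusPower p e J) : x ∈ J := by
  have h := frobeniusPower_le_self hp e _ (hψ.mem_frobeniusPower_colon (J' := colonBy J x)
    (x := x) (g := 1) (fun _ hy => hy) (by rwa [mul_one]))
  rwa [mem_colonBy, mul_one] at h

theorem frobeniusPower_eq_map [Fact p.Prime] [CharP R p] (e : ℕ) (J : Ideal R) :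
    frobeniusPower p e J = J.map (iterateFrobenius R p e) :=
  rfl

theorem frobeniusPower_frobeniusPower [Fact p.Prime] [CharP R p] (e e' : ℕ) (J : Ideal R) :
    frobeniusPower p e (frobeniusPower p e' J) = frobeniusPower p (e + e') J := by
  rw [frobeniusPower_eq_map, frobeniusPower_eq_map, frobeniusPower_eq_map, Ideal.map_map,
    ← iterateFrobenius_add]

theorem pow_mem_frobeniusPower_add [Fact p.Prime] [CharP R p] (e e' : ℕ) {J : Ideal R} {x : R}
    (hx : x ∈ frobeniusPower p e' J) : x ^ p ^ e ∈ frobeniusPower p (e + e') J := by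
  rw [← frobeniusPower_frobeniusPower]
  exact pow_mem_frobeniusPower e hx

theorem frobeniusPower_zero (J : Ideal R) : frobeniusPower p 0 J = J := by
  simp [frobeniusPower]

end FrobeniusPowers

/-! ### From relative to absolute dual families -/

section Presentation

variable {k : Type*} [Field k] {p : ℕ} [Fact p.Prime] [CharP k p] {R : Type*} [CommRing R]
  [Algebra k R] {σ : Type} {π : MvPolynomial σ k →ₐ[k] R}

/-- A presentation with Frobenius dual families yields absolute dual families. -/
theorem exists_isFrobeniusDual_of_family (hπ : Function.Surjective π) {e c : ℕ}
    (A : FrobeniusFamily p (RingHom.ker π) e c) :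
    ∃ (V : Set k) (ψ : A.ι × V → R →+ R), IsFrobeniusDual p e ψ := by
  obtain ⟨V, θ, coord, h1, h2⟩ := exists_frobenius_coordinates p k e
  let ρ : V → k →+ k := fun v => (Finsupp.applyAddHom v).comp coord
  have hρ : ∀ v c x, ρ v (c ^ p ^ e * x) = c * ρ v x := fun v c x => by
    change coord (c ^ p ^ e * x) v = _
    rw [h1]
    rfl
  -- The absolute Frobenius is the relative one followed by the Frobenius of k on coefficients.
  -- Accordingly the absolute dual maps compose the relative ones with the coordinates of
  -- coefficients over k^(p^e).
  let T : A.ι × V → MvPolynomial σ k →+ R := fun x =>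
    ((π : MvPolynomial σ k →+ R).comp (mapCoeff (ρ x.2))).comp (A.φ 0 x.1).toAddMonoidHom
  have hT : ∀ x G, T x G = π (mapCoeff (ρ x.2) (A.φ 0 x.1 G)) := fun _ _ => rfl
  have hker : ∀ v, ∀ G ∈ (RingHom.ker π).map (twist p e), π (mapCoeff (ρ v) G) = 0 := by
    intro v G hG
    suffices h : ∀ a, π (mapCoeff (ρ v) (a * G)) = 0 by simpa using h 1
    rw [Ideal.map] at hG
    induction hG using Submodule.span_induction with
    | mem x hx =>
      intro a
      obtain ⟨y, hy, rfl⟩ := hx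
      rw [mul_comm, mapCoeff_twist_mul p (hρ v), map_mul, RingHom.mem_ker.1 hy, zero_mul]
    | zero => intro a; rw [mul_zero, map_zero, map_zero]
    | add x y _ _ hx hy => intro a; rw [mul_add, map_add, map_add, hx, hy, add_zero]
    | smul b x hx ih => intro a; rw [smul_eq_mul, ← mul_assoc]; exact ih _
  have hT0 : ∀ x, ∀ G ∈ RingHom.ker π, T x G = 0 := by
    intro x G hG
    refine hker _ _ ?_
    have := A.map_mem 0 x.1 G (by rwa [map_twist_zero])
    rwa [zero_add] at this
  have hTeq : ∀ x G H, π G = π H → T x G = T x H := by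
    intro x G H h
    rw [← sub_eq_zero, ← map_sub]
    exact hT0 x _ (by rw [RingHom.mem_ker, map_sub, h, sub_self])
  let s := Function.surjInv hπ
  have hs : ∀ r, π (s r) = r := Function.surjInv_eq hπ
  let ψ : A.ι × V → R →+ R := fun x => AddMonoidHom.mk' (fun r => T x (s r)) fun a b => by
    rw [← map_add]
    exact hTeq _ _ _ (by rw [hs, map_add, hs, hs])
  have hψ : ∀ x G, ψ x (π G) = T x G := fun x G => hTeq _ _ _ (hs _)
  refine ⟨V, ψ, ?_, ?_⟩
  · intro x r g
    obtain ⟨r, rfl⟩ := hπ r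
    obtain ⟨g, rfl⟩ := hπ g
    rw [← map_pow, ← map_mul, hψ, hψ, ← expand_twist, hT, hT, A.map_expand_mul,
      mapCoeff_twist_mul p (hρ x.2), map_mul]
  · intro g
    obtain ⟨G, rfl⟩ := hπ g
    set J : Ideal R := Ideal.span (Set.range fun x => ψ x (π G) ^ p ^ e) with hJ
    have h3 : ∀ i, A.φ 0 i G ∈ (J.comap π).comap (MvPolynomial.expand (p ^ e)) := by
      intro i
      refine Ideal.span_le.2 ?_ (mem_span_twist_mapCoeff p h2 (A.φ 0 i G))
      rintro _ ⟨v, rfl⟩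
      change π (MvPolynomial.expand (p ^ e) (twist p e _)) ∈ J
      rw [expand_twist, map_pow]
      exact Ideal.subset_span ⟨(i, v), by rw [← hT (i, v), ← hψ]⟩
    have h4 := A.sum_sub_mem 0 G
    rw [map_twist_zero, RingHom.mem_ker, map_sub, sub_eq_zero] at h4
    rw [← h4, map_sum]
    refine sum_mem fun i _ => ?_
    rw [map_mul]
    exact Ideal.mul_mem_right _ _ (h3 i)

theorem exists_isFrobeniusDual (k : Type u) [Field k] (p : ℕ) [Fact p.Prime] [CharP k p]
    (R : Type*) [CommRing R] [Algebra k R] [Algebra.Smooth k R] (e : ℕ) :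
    ∃ (ι : Type u) (ψ : ι → R →+ R), IsFrobeniusDual p e ψ := by
  obtain ⟨n, π, hπ⟩ := Algebra.FiniteType.iff_quotient_mvPolynomial''.1
    (inferInstance : Algebra.FiniteType k R)
  obtain ⟨c, hc⟩ := exists_frobeniusFamily p π hπ
  obtain ⟨A⟩ := hc e
  obtain ⟨V, ψ, hψ⟩ := exists_isFrobeniusDual_of_family hπ A
  exact ⟨_, ψ, hψ⟩

end Presentation

/-! ### Operators of level q and the ideals they generate -/

section LevelOperators

variable (k : Type*) {R : Type*} [Field k] [CommRing R] [Algebra k R]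

/-- A `k`-linear operator has level `q` if it is linear over the `q`-th powers. -/
def IsLevel {k R : Type*} [Field k] [CommRing R] [Algebra k R] (q : ℕ) (P : Module.End k R) :
    Prop :=
  ∀ r x, P (r ^ q * x) = r ^ q * P x

/-- The ideal of the values at `g` of the operators of level `q`. -/
def levelIdeal (q : ℕ) (g : R) : Ideal R where
  carrier := {x | ∃ P : Module.End k R, IsLevel q P ∧ P g = x}
  add_mem' := by
    rintro _ _ ⟨P, hP, rfl⟩ ⟨Q, hQ, rfl⟩
    exact ⟨P + Q, fun r x => by simp [hP r x, hQ r x, mul_add], rfl⟩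
  zero_mem' := ⟨0, fun r x => by simp, rfl⟩
  smul_mem' := by
    rintro a _ ⟨P, hP, rfl⟩
    exact ⟨Algebra.lmul k R a * P, fun r x => by simp [hP r x, mul_left_comm], rfl⟩

variable {k}

theorem self_mem_levelIdeal (q : ℕ) (g : R) : g ∈ levelIdeal k q g :=
  ⟨1, fun _ _ => rfl, rfl⟩

theorem IsLevel.mul {q : ℕ} {P Q : Module.End k R} (hP : IsLevel q P) (hQ : IsLevel q Q) :
    IsLevel q (P * Q) := fun r x => by
  rw [Module.End.mul_apply, hQ, hP, Module.End.mul_apply]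

theorem IsLevel.of_dvd {q q' : ℕ} (h : q ∣ q') {P : Module.End k R} (hP : IsLevel q P) :
    IsLevel q' P := by
  obtain ⟨m, rfl⟩ := h
  intro r x
  rw [mul_comm q, pow_mul, hP]

theorem IsLevel.lmul (q : ℕ) (a : R) : IsLevel q (Algebra.lmul k R a) := fun r x => by
  simp [mul_left_comm]

theorem levelIdeal_le_of_mem {q : ℕ} {g h : R} (hg : g ∈ levelIdeal k q h) :
    levelIdeal k q g ≤ levelIdeal k q h := by
  obtain ⟨Q, hQ, rfl⟩ := hg
  rintro _ ⟨P, hP, rfl⟩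
  exact ⟨P * Q, hP.mul hQ, rfl⟩

theorem mul_mem_levelIdeal (q : ℕ) (a g : R) : a * g ∈ levelIdeal k q g :=
  Ideal.mul_mem_left _ _ (self_mem_levelIdeal q g)

theorem levelIdeal_mul_le (q : ℕ) (a g : R) : levelIdeal k q (a * g) ≤ levelIdeal k q g := by
  rintro _ ⟨P, hP, rfl⟩
  exact ⟨P * Algebra.lmul k R a, hP.mul (.lmul q a), rfl⟩

theorem levelIdeal_mono_level {q q' : ℕ} (h : q ∣ q') (g : R) :
    levelIdeal k q g ≤ levelIdeal k q' g := by
  rintro _ ⟨P, hP, rfl⟩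
  exact ⟨P, hP.of_dvd h, rfl⟩

theorem pow_mul_mem_levelIdeal {q : ℕ} {g x : R} (r : R) (hx : x ∈ levelIdeal k q g) :
    r ^ q * x ∈ levelIdeal k q (r ^ q * g) := by
  obtain ⟨P, hP, rfl⟩ := hx
  exact ⟨P, hP, hP r g⟩

/-- Operators of level `p ^ e` preserve `p ^ e`-th Frobenius powers of ideals. -/
theorem IsLevel.mem_frobeniusPower {p e : ℕ} {P : Module.End k R} (hP : IsLevel (p ^ e) P)
    {J : Ideal R} {x : R} (hx : x ∈ frobeniusPower p e J) : P x ∈ frobeniusPower p e J := by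
  suffices h : ∀ a, P (a * x) ∈ frobeniusPower p e J by simpa using h 1
  rw [frobeniusPower] at hx
  induction hx using Submodule.span_induction with
  | mem x hx =>
    intro a
    obtain ⟨y, hy, rfl⟩ := hx
    change P (a * y ^ p ^ e) ∈ _
    rw [mul_comm, hP]
    exact Ideal.mul_mem_right _ _ (pow_mem_frobeniusPower e hy)
  | zero => intro a; rw [mul_zero, map_zero]; exact zero_mem _
  | add x y _ _ hx hy => intro a; rw [mul_add, map_add]; exact add_mem (hx a) (hy a)
  | smul b x hx ih => intro a; rw [smul_eq_mul, ← mul_assoc]; exact ih _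

end LevelOperators

/-! ### Dimensions under the Frobenius twist -/

section TwistRank

variable {σ : Type} {k : Type*} [Field k] (p : ℕ) [Fact p.Prime] [CharP k p]

/-- Taking a coordinate over k^(p^t) of every coefficient turns a relation among the twists into a
relation among the original vectors. Hence all coordinates of the coefficients of the relation
vanish. -/
theorem linearIndependent_twist {n : ℕ} {v : Fin n → MvPolynomial σ k}
    (hv : LinearIndependent k v) (t : ℕ) : LinearIndependent k fun i => twist p t (v i) := by
  obtain ⟨V, θ, coord, h1, h2⟩ := exists_frobenius_coordinates p k t
  rw [Fintype.linearIndependent_iff] at hv ⊢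
  intro c hc i
  have h3 : coord (c i) = 0 := by
    ext v'
    let ρ : k →+ k := (Finsupp.applyAddHom v').comp coord
    have hρ : ∀ c x, ρ (c ^ p ^ t * x) = c * ρ x := fun c x => by
      change coord (c ^ p ^ t * x) v' = _
      rw [h1]
      rfl
    refine hv (fun i => ρ (c i)) ?_ i
    have h4 := congrArg (mapCoeff ρ) hc
    rw [map_sum, map_zero] at h4
    rw [← h4]
    refine Finset.sum_congr rfl fun j _ => ?_
    rw [MvPolynomial.smul_eq_C_mul, MvPolynomial.smul_eq_C_mul, mul_comm (MvPolynomial.C (c j)),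
      mapCoeff_twist_mul p hρ, mul_comm, ← MvPolynomial.monomial_zero',
      mapCoeff_monomial]
  rw [← h2 (c i), h3, Finsupp.sum_zero_index]

theorem finrank_span_twist {V : Submodule k (MvPolynomial σ k)} [Module.Finite k V] (t : ℕ) :
    ∃ U : Submodule k (MvPolynomial σ k), U ≤ Submodule.span k (twist p t '' V) ∧
      Module.finrank k U = Module.finrank k V := by
  let b := Module.finBasis k V
  have hb : LinearIndependent k fun i => (b i : MvPolynomial σ k) :=
    b.linearIndependent.map' V.subtype V.ker_subtype
  have h1 := finrank_span_eq_card (linearIndependent_twist p hb t)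
  rw [Fintype.card_fin] at h1
  refine ⟨_, Submodule.span_mono ?_, h1⟩
  rintro _ ⟨i, rfl⟩
  exact ⟨_, (b i).2, rfl⟩

/-- The Frobenius twist does not decrease the dimension of a space of polynomials. -/
theorem finrank_le_of_twist_mem {V W : Submodule k (MvPolynomial σ k)}
    [Module.Finite k V] [Module.Finite k W] (t : ℕ) (h : ∀ v ∈ V, twist p t v ∈ W) :
    Module.finrank k V ≤ Module.finrank k W := by
  obtain ⟨U, hU, hr⟩ := finrank_span_twist p t (V := V)
  rw [← hr]
  exact Submodule.finrank_mono (hU.trans (Submodule.span_le.2 (Set.image_subset_iff.2 h)))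

/-- The twists of a basis of V already span a subspace of W of dimension dim V, so equality of
dimensions leaves no room. This converts stationary dimensions into equality with a Frobenius power.
-/
theorem le_span_twist_of_finrank_le {V W : Submodule k (MvPolynomial σ k)}
    [Module.Finite k V] [Module.Finite k W] (t : ℕ) (h : ∀ v ∈ V, twist p t v ∈ W)
    (hr : Module.finrank k W ≤ Module.finrank k V) :
    W ≤ Submodule.span k (twist p t '' V) := by
  obtain ⟨U, hU, hr'⟩ := finrank_span_twist p t (V := V)
  have h3 := Submodule.eq_of_le_of_finrank_le
    (hU.trans (Submodule.span_le.2 (Set.image_subset_iff.2 h))) (by rw [hr']; exact hr)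
  rwa [← h3]

end TwistRank

/-! ### Generators of level ideals, and their behaviour under p-th powers -/

section LevelIdealGenerators

variable {k : Type*} [Field k] {p : ℕ} [Fact p.Prime] [CharP k p] {R : Type*} [CommRing R]
  [Algebra k R] {σ : Type} {π : MvPolynomial σ k →ₐ[k] R}

/-- The image of `expand q` is the k-algebra generated by q-th powers of the generators of R, and a
k-linear operator of level q is linear over it. -/
theorem IsLevel.map_expand_mul {q : ℕ} {P : Module.End k R} (hP : IsLevel q P)
    (y : MvPolynomial σ k) (x : R) :
    P (π (MvPolynomial.expand q y) * x) = π (MvPolynomial.expand q y) * P x := by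
  induction y using MvPolynomial.induction_on generalizing x with
  | C a =>
    rw [MvPolynomial.expand_C, MvPolynomial.algHom_C, ← Algebra.smul_def, ← Algebra.smul_def,
      map_smul]
  | add y z hy hz => rw [map_add, map_add, add_mul, map_add, hy, hz, add_mul]
  | mul_X y i hy =>
    rw [map_mul (MvPolynomial.expand q), MvPolynomial.expand_X, map_mul π, map_pow π, mul_assoc, hy,
      hP, mul_assoc]

/-- The level `p ^ e` ideal of `g` is generated by the components of a lift of `g` in a Frobenius
dual family. -/
theorem FrobeniusFamily.levelIdeal_eq_span (hπ : Function.Surjective π) {e c : ℕ}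
    (A : FrobeniusFamily p (RingHom.ker π) e c) (G : MvPolynomial σ k) :
    levelIdeal k (p ^ e) (π G) =
      Ideal.span (Set.range fun i => π (MvPolynomial.expand (p ^ e) (A.φ 0 i G))) := by
  have hsum : ∀ G, π G = ∑ i, π (MvPolynomial.expand (p ^ e) (A.φ 0 i G)) *
      π (twist p 0 (A.b i)) := by
    intro G
    have h4 := A.sum_sub_mem 0 G
    rw [map_twist_zero, RingHom.mem_ker, map_sub, sub_eq_zero] at h4
    rw [← h4, map_sum]
    exact Finset.sum_congr rfl fun i _ => map_mul _ _ _
  apply le_antisymm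
  · rintro _ ⟨P, hP, rfl⟩
    rw [hsum G, map_sum]
    refine sum_mem fun i _ => ?_
    rw [hP.map_expand_mul]
    exact Ideal.mul_mem_right _ _ (Ideal.subset_span ⟨i, rfl⟩)
  · rw [Ideal.span_le]
    rintro _ ⟨i, rfl⟩
    obtain ⟨s, hs⟩ := π.toLinearMap.exists_rightInverse_of_surjective
      (LinearMap.range_eq_top.2 hπ)
    have hs' : ∀ r, π (s r) = r := fun r => DFunLike.congr_fun hs r
    -- The generators are themselves values of operators: G ↦ `expand (p ^ e) (A.φ 0 i G)` vanishes
    -- in R on the kernel of π, so it descends to an operator of level p^e.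
    let T : MvPolynomial σ k →ₗ[k] R :=
      (π.comp (MvPolynomial.expand (p ^ e))).toLinearMap ∘ₗ A.φ 0 i
    have hT : ∀ G, T G = π (MvPolynomial.expand (p ^ e) (A.φ 0 i G)) := fun _ => rfl
    have hTeq : ∀ G H, π G = π H → T G = T H := by
      intro G H h
      rw [← sub_eq_zero, ← map_sub]
      have h1 := A.map_mem 0 i (G - H) (by
        rw [map_twist_zero, RingHom.mem_ker, map_sub, h, sub_self])
      have h2 := expand_mem_of_mem_map_twist p e 0 h1
      rwa [map_twist_zero] at h2
    refine ⟨T ∘ₗ s, fun r x => ?_, hTeq _ _ (hs' _)⟩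
    change T (s (r ^ p ^ e * x)) = r ^ p ^ e * T (s x)
    rw [hTeq _ (s r ^ p ^ e * s x) (by
      rw [hs', map_mul, map_pow, hs', hs']), ← expand_twist, hT, A.map_expand_mul, map_mul,
      expand_twist, map_mul, map_pow, hs', hT]

/-- Raising to the `p`-th power maps level `p ^ e` ideals to level `p ^ (e + 1)` ideals. -/
theorem pow_mem_levelIdeal_succ (hπ : Function.Surjective π) {c : ℕ}
    (A : ∀ e, FrobeniusFamily p (RingHom.ker π) e c) (e : ℕ) (g : R) {x : R}
    [CharP R p] (hx : x ∈ levelIdeal k (p ^ e) g) :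
    x ^ p ∈ levelIdeal k (p ^ (e + 1)) (g ^ p) := by
  set I := RingHom.ker π with hI
  obtain ⟨G, rfl⟩ := hπ g
  set E := levelIdeal k (p ^ (e + 1)) (π G ^ p) with hE
  let J : Ideal (MvPolynomial σ k) :=
    E.comap (π.comp (MvPolynomial.expand (p ^ (e + 1)))).toRingHom
  have hJ : ∀ y, y ∈ J ↔ π (MvPolynomial.expand (p ^ (e + 1)) y) ∈ E := fun _ => Iff.rfl
  have hIJ : I.map (twist p (1 + e)) ≤ J := by
    intro y hy
    rw [hJ]
    have h := expand_mem_of_mem_map_twist p (e + 1) 0 (I := I) (G := y)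
      (by rwa [zero_add, add_comm e])
    rw [map_twist_zero] at h
    rw [RingHom.mem_ker.1 h]
    exact zero_mem _
  -- G^p is the expansion of `twist p 1 G`. Its generators at level p^(e+1) lie in E, so G^p lies in
  -- the extension of J modulo I.
  have h1 : MvPolynomial.expand (p ^ 1) (twist p 1 G) ∈
      (J.map (MvPolynomial.expand (p ^ e)) ⊔ I.map (twist p 1)).map
        (MvPolynomial.expand (p ^ 1)) ⊔ I := by
    have h2 : G ^ p ∈ J.map (MvPolynomial.expand (p ^ (e + 1))) ⊔ I.map (twist p 0) := by
      rw [(A (e + 1)).mem_map_expand_sup_iff 0 (by rwa [zero_add, add_comm e])]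
      intro i
      rw [hJ, hE, ← map_pow, (A (e + 1)).levelIdeal_eq_span hπ]
      exact Ideal.subset_span ⟨i, rfl⟩
    rw [map_twist_zero] at h2
    rw [expand_twist, pow_one]
    refine sup_le_sup_right ?_ I h2
    rw [Ideal.map_le_iff_le_comap]
    intro y hy
    rw [Ideal.mem_comap, pow_succ', MvPolynomial.expand_mul]
    exact Ideal.mem_map_of_mem (MvPolynomial.expand p)
      (Ideal.mem_sup_left (Ideal.mem_map_of_mem (MvPolynomial.expand (p ^ e)) hy))
  -- Faithful flatness removes one Frobenius from G^p, leaving `twist p 1 G`. Compatibility of φ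
  -- with twists then gives the p-th powers of the generators at level p^e.
  have h3 := (A 1).mem_of_expand_mem le_sup_right h1
  rw [(A e).mem_map_expand_sup_iff 1 hIJ] at h3
  have h4 : levelIdeal k (p ^ e) (π G) ≤ E.comap (frobenius R p) := by
    rw [(A e).levelIdeal_eq_span hπ, Ideal.span_le]
    rintro _ ⟨i, rfl⟩
    have h5 := h3 i
    rw [(A e).map_twist, hJ, pow_succ, MvPolynomial.expand_mul] at h5
    have h6 := expand_twist p 1 ((A e).φ 0 i G)
    rw [pow_one] at h6
    rwa [h6, map_pow, map_pow] at h5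
  exact h4 hx

end LevelIdealGenerators

/-! ### Bounded degrees: few jumps, and stabilization of level ideals -/

section Finiteness

variable {k : Type*} [Field k] {p : ℕ} [Fact p.Prime] [CharP k p] {R : Type*} [CommRing R]
  [Algebra k R] {σ : Type} {π : MvPolynomial σ k →ₐ[k] R}

/-- The polynomials of degree at most `N` whose `q`-expansion represents an element of `E`. -/
def degreePart (π : MvPolynomial σ k →ₐ[k] R) (q N : ℕ) (E : Ideal R) :
    Submodule k (MvPolynomial σ k) :=
  MvPolynomial.restrictTotalDegree σ k N ⊓
    (E.restrictScalars k).comap (π.comp (MvPolynomial.expand q)).toLinearMap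

theorem mem_degreePart {q N : ℕ} {E : Ideal R} {y : MvPolynomial σ k} :
    y ∈ degreePart π q N E ↔ y.totalDegree ≤ N ∧ π (MvPolynomial.expand q y) ∈ E := by
  rw [degreePart, Submodule.mem_inf, MvPolynomial.mem_restrictTotalDegree]
  rfl

theorem degreePart_mono (q N : ℕ) {E E' : Ideal R} (h : E ≤ E') :
    degreePart π q N E ≤ degreePart π q N E' := fun y hy => by
  rw [mem_degreePart] at hy ⊢
  exact ⟨hy.1, h hy.2⟩

instance finite_degreePart [Finite σ] (q N : ℕ) (E : Ideal R) :
    Module.Finite k (degreePart π q N E) :=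
  Submodule.finiteDimensional_of_le (inf_le_left : _ ≤ MvPolynomial.restrictTotalDegree σ k N)

theorem finrank_degreePart_le [Finite σ] (q N : ℕ) (E : Ideal R) :
    Module.finrank k (degreePart π q N E) ≤
      Module.finrank k (MvPolynomial.restrictTotalDegree σ k N) :=
  Submodule.finrank_mono inf_le_left

/-- The components of G that generate its level ideal have degree at most N. The ideal is therefore
determined by the finite-dimensional space `degreePart`. -/
theorem FrobeniusFamily.levelIdeal_le_of_degreePart (hπ : Function.Surjective π) {e c N : ℕ}
    (A : FrobeniusFamily p (RingHom.ker π) e c) {G : MvPolynomial σ k}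
    (hG : G.totalDegree + p ^ e * c ≤ p ^ e * N) {E : Ideal R}
    (h : ∀ y ∈ degreePart π (p ^ e) N (levelIdeal k (p ^ e) (π G)),
      π (MvPolynomial.expand (p ^ e) y) ∈ E) :
    levelIdeal k (p ^ e) (π G) ≤ E := by
  have h1 := A.levelIdeal_eq_span hπ G
  conv_lhs => rw [h1]
  rw [Ideal.span_le]
  rintro _ ⟨i, rfl⟩
  refine h _ (mem_degreePart.2 ⟨?_, ?_⟩)
  · exact Nat.le_of_mul_le_mul_left ((A.totalDegree_le 0 i G).trans hG)
      (pow_pos (Fact.out : p.Prime).pos e)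
  · rw [h1]
    exact Ideal.subset_span ⟨i, rfl⟩

variable (k) in
/-- The condition that the ideals generated by `f ^ a` and by `f ^ (a + 1)` under the operators of
level `p ^ e` coincide. -/
def LevelEq (p : ℕ) (f : R) (e a : ℕ) : Prop :=
  f ^ a ∈ levelIdeal k (p ^ e) (f ^ (a + 1))

theorem levelIdeal_pow_antitone (q : ℕ) (f : R) : Antitone fun a => levelIdeal k q (f ^ a) := by
  refine antitone_nat_of_succ_le fun a => ?_
  rw [pow_succ']
  exact levelIdeal_mul_le q f (f ^ a)

/-- For a < p^e all these ideals are generated in one degree bound independent of e. Their degree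
parts decrease with a inside a fixed finite-dimensional space, strictly at each jump. -/
theorem exists_bound_not_levelEq [Finite σ] (hπ : Function.Surjective π) {c : ℕ}
    (A : ∀ e, FrobeniusFamily p (RingHom.ker π) e c) (f : R) :
    ∃ N, ∀ e, ∀ s : Finset ℕ, (∀ a ∈ s, a < p ^ e ∧ ¬ LevelEq k p f e a) → s.card ≤ N := by
  obtain ⟨F, rfl⟩ := hπ f
  -- For a < p^e the degree of F^a is at most p^e deg F, so after division by p^e the components
  -- have degree at most deg F + c.
  let M := F.totalDegree + c
  refine ⟨Module.finrank k (MvPolynomial.restrictTotalDegree σ k M) + 1, fun e s hs => ?_⟩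
  let r : ℕ → ℕ := fun a =>
    Module.finrank k (degreePart π (p ^ e) M (levelIdeal k (p ^ e) (π F ^ a)))
  have hanti : ∀ {a b}, a ≤ b → r b ≤ r a := fun hab =>
    Submodule.finrank_mono (degreePart_mono _ _ (levelIdeal_pow_antitone _ _ hab))
  have hstrict : ∀ a ∈ s, r (a + 1) < r a := by
    intro a ha
    obtain ⟨h1, h2⟩ := hs a ha
    refine Submodule.finrank_lt_finrank_of_lt (lt_of_le_of_ne
      (degreePart_mono _ _ (levelIdeal_pow_antitone _ _ a.le_succ)) fun heq => h2 ?_)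
    have h3 : levelIdeal k (p ^ e) (π (F ^ a)) ≤ levelIdeal k (p ^ e) (π F ^ (a + 1)) := by
      refine (A e).levelIdeal_le_of_degreePart hπ (N := M) ?_ fun y hy => ?_
      · have := MvPolynomial.totalDegree_pow F a
        have := Nat.mul_le_mul_right F.totalDegree h1.le
        simp only [M, mul_add]
        omega
      · rw [map_pow, ← heq] at hy
        exact (mem_degreePart.1 hy).2
    rw [map_pow] at h3
    exact h3 (self_mem_levelIdeal _ _)
  have hinj : Set.InjOn r s := by
    intro a ha b hb hab
    rcases lt_trichotomy a b with h | h | h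
    · have := hanti h; have := hstrict a ha; simp only [Nat.succ_eq_add_one] at *; omega
    · exact h
    · have := hanti h; have := hstrict b hb; simp only [Nat.succ_eq_add_one] at *; omega
  rw [← Finset.card_image_of_injOn hinj]
  refine (Finset.card_le_card (t := Finset.range _) fun x hx => ?_).trans_eq
    (Finset.card_range _)
  obtain ⟨a, -, rfl⟩ := Finset.mem_image.1 hx
  exact Finset.mem_range.2 (Nat.lt_succ_of_le (finrank_degreePart_le _ _ _))

theorem pow_mem_levelIdeal_add (hπ : Function.Surjective π) {c : ℕ}
    (A : ∀ e, FrobeniusFamily p (RingHom.ker π) e c) [CharP R p] (e d : ℕ) (g : R) {x : R}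
    (hx : x ∈ levelIdeal k (p ^ e) g) :
    x ^ p ^ d ∈ levelIdeal k (p ^ (e + d)) (g ^ p ^ d) := by
  induction d with
  | zero => simpa using hx
  | succ d ih =>
    rw [pow_succ, pow_mul, pow_mul]
    exact pow_mem_levelIdeal_succ hπ A (e + d) _ ih

/-- Operators of level `p ^ (e + 1)` preserve the Frobenius powers of level `p ^ e` ideals. -/
theorem IsLevel.mem_frobeniusPower_levelIdeal (hπ : Function.Surjective π) {e c : ℕ}
    (A : FrobeniusFamily p (RingHom.ker π) e c) [CharP R p] {P : Module.End k R}
    (hP : IsLevel (p ^ (e + 1)) P) (g : R) {x : R}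
    (hx : x ∈ frobeniusPower p 1 (levelIdeal k (p ^ e) g)) :
    P x ∈ frobeniusPower p 1 (levelIdeal k (p ^ e) g) := by
  obtain ⟨G, rfl⟩ := hπ g
  suffices h : ∀ a, P (a * x) ∈ frobeniusPower p 1 (levelIdeal k (p ^ e) (π G)) by
    simpa using h 1
  rw [A.levelIdeal_eq_span hπ, frobeniusPower_eq_map, Ideal.map_span] at hx ⊢
  induction hx using Submodule.span_induction with
  | mem x hx =>
    intro a
    obtain ⟨_, ⟨i, rfl⟩, rfl⟩ := hx
    -- The p-th power of a p^e-expansion is a p^(e+1)-expansion, and operators of level p^(e+1) are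
    -- linear over those.
    have h : iterateFrobenius R p 1 (π (MvPolynomial.expand (p ^ e) (A.φ 0 i G))) =
        π (MvPolynomial.expand (p ^ (e + 1)) (twist p 1 (A.φ 0 i G))) := by
      rw [iterateFrobenius_def, pow_add p e 1, MvPolynomial.expand_mul, ← map_pow π, ← map_pow,
        ← expand_twist]
    rw [mul_comm, h, hP.map_expand_mul, ← h]
    exact Ideal.mul_mem_right _ _ (Ideal.subset_span ⟨_, ⟨i, rfl⟩, rfl⟩)
  | zero => intro a; rw [mul_zero, map_zero]; exact zero_mem _
  | add x y _ _ hx hy => intro a; rw [mul_add, map_add]; exact add_mem (hx a) (hy a)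
  | smul b x hx ih => intro a; rw [smul_eq_mul, ← mul_assoc]; exact ih _

/-- A sequence of level ideals which increases relative to the Frobenius and is generated in
bounded degree stabilizes. -/
theorem exists_levelIdeal_stable [Finite σ] (hπ : Function.Surjective π) {c : ℕ}
    (A : ∀ e, FrobeniusFamily p (RingHom.ker π) e c) [CharP R p] (d D : ℕ)
    (G : ℕ → MvPolynomial σ k) (hG : ∀ j, (G j).totalDegree ≤ p ^ (d * j) * D)
    (hinc : ∀ j, π (G j) ^ p ^ d ∈ levelIdeal k (p ^ (d * (j + 1))) (π (G (j + 1)))) :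
    ∃ j, ∀ i, levelIdeal k (p ^ (d * (j + i))) (π (G (j + i))) =
      frobeniusPower p (d * i) (levelIdeal k (p ^ (d * j)) (π (G j))) := by
  let E : ℕ → Ideal R := fun j => levelIdeal k (p ^ (d * j)) (π (G j))
  let V : ℕ → Submodule k (MvPolynomial σ k) := fun j => degreePart π (p ^ (d * j)) (D + c) (E j)
  have hE : ∀ j, ∀ x ∈ E j, x ^ p ^ d ∈ E (j + 1) := by
    intro j x hx
    have := pow_mem_levelIdeal_add hπ A (d * j) d _ hx
    rw [← mul_add_one] at this
    exact levelIdeal_le_of_mem (hinc j) this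
  have hexp : ∀ j (y : MvPolynomial σ k), π (MvPolynomial.expand (p ^ (d * (j + 1))) (twist p d y)) =
      π (MvPolynomial.expand (p ^ (d * j)) y) ^ p ^ d := by
    intro j y
    rw [mul_add_one, pow_add, MvPolynomial.expand_mul, expand_twist, map_pow, map_pow]
  have hV : ∀ j, ∀ y ∈ V j, twist p d y ∈ V (j + 1) := by
    intro j y hy
    rw [mem_degreePart] at hy ⊢
    rw [hexp]
    exact ⟨(totalDegree_twist_le p d y).trans hy.1, hE j _ hy.2⟩
  let r : ℕ → ℕ := fun j => Module.finrank k (V j)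
  -- Twisting maps V_j into V_(j+1) without loss of dimension, and the dimensions are bounded. Past
  -- an index of maximal dimension, the twist of each V_j spans the next one.
  obtain ⟨j, hj⟩ : ∃ j, ∀ i, r i ≤ r j := by
    have hb : BddAbove (Set.range r) := ⟨_, by
      rintro _ ⟨i, rfl⟩
      exact finrank_degreePart_le _ _ _⟩
    obtain ⟨j, hj⟩ := Nat.sSup_mem (Set.range_nonempty r) hb
    exact ⟨j, fun i => hj ▸ le_csSup hb ⟨i, rfl⟩⟩
  have hmono : ∀ i, r i ≤ r (i + 1) := fun i => finrank_le_of_twist_mem p d (hV i)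
  have hge : ∀ i, r j ≤ r (j + i) := fun i =>
    monotone_nat_of_le_succ hmono (Nat.le_add_right j i)
  refine ⟨j, fun i => ?_⟩
  induction i with
  | zero => rw [mul_zero, frobeniusPower_zero]; rfl
  | succ i ih =>
    rw [mul_add_one, add_comm (d * i), ← frobeniusPower_frobeniusPower, ← ih]
    apply le_antisymm
    · refine (A _).levelIdeal_le_of_degreePart hπ (N := D + c) ?_ fun y hy => ?_
      · rw [mul_add (p ^ (d * (j + (i + 1))))]
        exact Nat.add_le_add_right (hG (j + (i + 1))) _
      · have h1 := le_span_twist_of_finrank_le p d (hV (j + i))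
          ((hj _).trans (hge i)) hy
        have h2 : Submodule.span k (twist p d '' V (j + i)) ≤
            ((frobeniusPower p d (E (j + i))).restrictScalars k).comap
              (π.comp (MvPolynomial.expand (p ^ (d * (j + i + 1))))).toLinearMap := by
          rw [Submodule.span_le]
          rintro _ ⟨z, hz, rfl⟩
          change π (MvPolynomial.expand (p ^ (d * (j + i + 1))) (twist p d z)) ∈
            frobeniusPower p d (E (j + i))
          rw [hexp]
          exact pow_mem_frobeniusPower d (mem_degreePart.1 hz).2
        exact h2 h1
    · rw [frobeniusPower, Ideal.span_le]
      rintro _ ⟨x, hx, rfl⟩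
      exact hE (j + i) x hx

end Finiteness

/-! ### Numbers with one repeated digit in base q -/

section RepeatedDigits

/-- The number whose expansion in base `q` consists of `j` digits `C`. -/
def repeatDigit (q C : ℕ) : ℕ → ℕ
  | 0 => 0
  | j + 1 => C + q * repeatDigit q C j

theorem repeatDigit_add (q C j i : ℕ) :
    repeatDigit q C (j + i) = repeatDigit q C i + q ^ i * repeatDigit q C j := by
  induction i with
  | zero => simp [repeatDigit]
  | succ i ih => rw [← add_assoc, repeatDigit, ih, repeatDigit]; ring

theorem repeatDigit_lt {q C : ℕ} (hC : C < q) (j : ℕ) : repeatDigit q C j < q ^ j := by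
  induction j with
  | zero => simp [repeatDigit]
  | succ j ih =>
    rw [repeatDigit, pow_succ']
    calc C + q * repeatDigit q C j < q + q * repeatDigit q C j := by omega
      _ = q * (repeatDigit q C j + 1) := by ring
      _ ≤ q * q ^ j := Nat.mul_le_mul_left _ ih

theorem repeatDigit_mul (q C j : ℕ) :
    q * repeatDigit q C j + C = C * q ^ j + repeatDigit q C j := by
  induction j with
  | zero => simp [repeatDigit]
  | succ j ih =>
    rw [repeatDigit, pow_succ]
    linear_combination q * ih

theorem repeatDigit_zero (q j : ℕ) : repeatDigit q 0 j = 0 := by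
  induction j with
  | zero => rfl
  | succ j ih => rw [repeatDigit, ih, mul_zero, add_zero]

end RepeatedDigits

/-! ### How jumps depend on level and exponent -/

section LevelEqLemmas

variable {k : Type u} [Field k] {p : ℕ} {R : Type*} [CommRing R] [Algebra k R] {f : R}

/-- Operators of level p^e commute with f^(b p^e) and also have level p^(e+1). So the absence of a
jump persists when higher digits are added. -/
theorem LevelEq.succ {e a : ℕ} (h : LevelEq k p f e a) (b : ℕ) :
    LevelEq k p f (e + 1) (a + b * p ^ e) := by
  have h1 := levelIdeal_mono_level (pow_dvd_pow p e.le_succ) _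
    (pow_mul_mem_levelIdeal (f ^ b) h)
  rw [← pow_mul, ← pow_add, ← pow_add] at h1
  rw [LevelEq]
  convert h1 using 2 <;> ring_nf

theorem LevelEq.add {e a : ℕ} (h : LevelEq k p f e a) (i b : ℕ) :
    LevelEq k p f (e + i) (a + b * p ^ e) := by
  have h1 := levelIdeal_mono_level (pow_dvd_pow p (Nat.le_add_right e i)) _
    (pow_mul_mem_levelIdeal (f ^ b) h)
  rw [← pow_mul, ← pow_add, ← pow_add] at h1
  rw [LevelEq]
  convert h1 using 2 <;> ring_nf

variable [Fact p.Prime] [CharP k p]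

theorem exists_presentation (k : Type u) [Field k] (p : ℕ) [Fact p.Prime] [CharP k p]
    (R : Type*) [CommRing R] [Algebra k R] [Algebra.Smooth k R] :
    ∃ (n : ℕ) (π : MvPolynomial (Fin n) k →ₐ[k] R) (c : ℕ), Function.Surjective π ∧
      ∀ e, Nonempty (FrobeniusFamily p (RingHom.ker π) e c) := by
  obtain ⟨n, π, hπ⟩ := Algebra.FiniteType.iff_quotient_mvPolynomial''.1
    (inferInstance : Algebra.FiniteType k R)
  obtain ⟨c, hc⟩ := exists_frobeniusFamily p π hπ
  exact ⟨n, π, c, hπ, hc⟩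

variable [Algebra.Smooth k R]

theorem exists_bound_not_levelEq_of_smooth (f : R) :
    ∃ N, ∀ e, ∀ s : Finset ℕ, (∀ a ∈ s, a < p ^ e ∧ ¬ LevelEq k p f e a) → s.card ≤ N := by
  obtain ⟨n, π, c, hπ, hA⟩ := exists_presentation k p R
  exact exists_bound_not_levelEq hπ (fun e => (hA e).some) f

variable [CharP R p]

/-- Without jumps at pb, …, pb + p - 1, some operator P of level p^(e+1) maps f^(pb+p) to f^(pb).
For J the level p^e ideal of f^(b+1), P preserves J^[p], which contains f^(pb+p). Hence (f^b)^p ∈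
J^[p], and flatness of Frobenius gives f^b ∈ J. -/
theorem LevelEq.of_succ {e b : ℕ} (h : ∀ c < p, LevelEq k p f (e + 1) (p * b + c)) :
    LevelEq k p f e b := by
  have h1 : ∀ c ≤ p, f ^ (p * b) ∈ levelIdeal k (p ^ (e + 1)) (f ^ (p * b + c)) := by
    intro c hc
    induction c with
    | zero => exact self_mem_levelIdeal _ _
    | succ c ih => exact levelIdeal_le_of_mem (h c hc) (ih (Nat.le_of_succ_le hc))
  obtain ⟨P, hP, hPf⟩ := h1 p le_rfl
  obtain ⟨ι, ψ, hψ⟩ := exists_isFrobeniusDual k p R 1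
  obtain ⟨n, π, c, hπ, hA⟩ := exists_presentation k p R
  set J := levelIdeal k (p ^ e) (f ^ (b + 1)) with hJ
  refine hψ.mem_of_pow_mem (Fact.out : p.Prime).pos (J := J) ?_
  have h2 : f ^ (p * b + p) ∈ frobeniusPower p 1 J := by
    have := pow_mem_frobeniusPower (p := p) 1 (self_mem_levelIdeal (k := k) (p ^ e) (f ^ (b + 1)))
    rwa [← pow_mul, pow_one, add_one_mul, mul_comm b] at this
  have h3 : ∀ x ∈ frobeniusPower p 1 J, P x ∈ frobeniusPower p 1 J := fun x hx =>
    hP.mem_frobeniusPower_levelIdeal hπ (hA e).some _ hx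
  have h4 := h3 _ h2
  rw [hPf] at h4
  rwa [← pow_mul, pow_one, mul_comm b]

/-- The stabilization of the ideals attached to a periodic expansion. -/
theorem exists_levelIdeal_repeatDigit_stable (f : R) {d C : ℕ} (hC : C < p ^ d) :
    ∃ j, ∀ i, levelIdeal k (p ^ (d * (j + i))) (f ^ (repeatDigit (p ^ d) C (j + i) + 1)) =
      frobeniusPower p (d * i)
        (levelIdeal k (p ^ (d * j)) (f ^ (repeatDigit (p ^ d) C j + 1))) := by
  obtain ⟨n, π, c, hπ, hA⟩ := exists_presentation k p R
  obtain ⟨F, rfl⟩ := hπ f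
  have h := exists_levelIdeal_stable hπ (fun e => (hA e).some) d F.totalDegree
    (fun j => F ^ (repeatDigit (p ^ d) C j + 1)) (fun j => ?_) fun j => ?_
  · simpa only [map_pow] using h
  · refine (MvPolynomial.totalDegree_pow _ _).trans (Nat.mul_le_mul_right _ ?_)
    rw [pow_mul]
    exact repeatDigit_lt hC j
  · rw [map_pow π, map_pow π, ← pow_mul]
    -- With q = p^d and r_(j+1) = C + q r_j, the surplus q (r_j + 1) - (r_(j+1) + 1) is q - 1 - C,
    -- which is nonnegative because C < q.
    have : (repeatDigit (p ^ d) C j + 1) * p ^ d =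
        (p ^ d - 1 - C) + (repeatDigit (p ^ d) C (j + 1) + 1) := by
      rw [repeatDigit, add_one_mul, mul_comm]
      omega
    rw [this, pow_add _ (p ^ d - 1 - C)]
    exact mul_mem_levelIdeal _ _ _

/-- A nonzero function on a domain generates the unit ideal under the operators of some level. -/
theorem exists_levelEq_zero [IsDomain R] (hf : f ≠ 0) : ∃ e, LevelEq k p f e 0 := by
  have hp := (Fact.out : p.Prime)
  obtain ⟨j, hj⟩ := exists_levelIdeal_repeatDigit_stable (k := k) (p := p) f (d := 1) (C := 0)
    (pow_pos hp.pos 1)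
  simp only [repeatDigit_zero, zero_add, one_mul, pow_one] at hj
  set J := levelIdeal k (p ^ j) f with hJ
  have hN : IsNoetherianRing R := Algebra.FiniteType.isNoetherianRing k R
  have htop : J = ⊤ := by
    by_contra hne
    refine hf ?_
    -- If J were proper, then f, which lies in all Frobenius powers of J and hence in all powers
    -- J^i, would vanish by Krull's intersection theorem.
    rw [← Ideal.mem_bot, ← Ideal.iInf_pow_eq_bot_of_isDomain J hne, Submodule.mem_iInf]
    intro i
    have h1 : f ∈ frobeniusPower p i J := by
      rw [← hj]
      exact self_mem_levelIdeal _ _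
    refine (?_ : frobeniusPower p i J ≤ J ^ i) h1
    rw [frobeniusPower, Ideal.span_le]
    rintro _ ⟨x, hx, rfl⟩
    exact Ideal.pow_le_pow_right (Nat.lt_pow_self hp.one_lt).le (Ideal.pow_mem_pow hx _)
  refine ⟨j, ?_⟩
  rw [LevelEq, pow_zero, zero_add, pow_one, ← hJ, htop]
  trivial

/-- If the absolute Frobenius roots do not jump along a periodic expansion, then neither do the
level ideals. -/
theorem exists_levelEq_of_frobeniusRoot_le {d C : ℕ} (hC : C < p ^ d) {e : ℕ}
    (h : frobeniusRoot p (d * e) f (repeatDigit (p ^ d) C e) ≤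
      ⨆ i, frobeniusRoot p (d * i) f (repeatDigit (p ^ d) C i + 1)) :
    ∃ i, LevelEq k p f (d * i) (repeatDigit (p ^ d) C i) := by
  obtain ⟨j, hj⟩ := exists_levelIdeal_repeatDigit_stable (k := k) (p := p) f hC
  set J := levelIdeal k (p ^ (d * j)) (f ^ (repeatDigit (p ^ d) C j + 1)) with hJ
  set x := f ^ repeatDigit (p ^ d) C j with hx
  have hpow : ∀ i n, f ^ (repeatDigit (p ^ d) C (j + i) + n) =
      x ^ p ^ (d * i) * f ^ (repeatDigit (p ^ d) C i + n) := by
    intro i n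
    rw [hx, ← pow_mul, ← pow_add, repeatDigit_add, pow_mul]
    congr 1
    ring
  -- f^(r_(j+i) + 1) = x^(p^(di)) f^(r_i + 1) lies in the p^(di)-th Frobenius power of J. Dividing
  -- by the Frobenius power of x leaves f^(r_i + 1) in that of J : x, an ideal independent of i.
  have h1 : ∀ i, frobeniusRoot p (d * i) f (repeatDigit (p ^ d) C i + 1) ≤ colonBy J x := by
    intro i
    obtain ⟨ι, ψ, hψ⟩ := exists_isFrobeniusDual k p R (d * i)
    refine sInf_le ?_
    refine hψ.mem_frobeniusPower_colon (J := J) (x := x) (fun _ hy => hy) ?_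
    rw [← hpow, ← hj]
    exact self_mem_levelIdeal _ _
  obtain ⟨ι, ψ, hψ⟩ := exists_isFrobeniusDual k p R (d * e)
  -- The Frobenius root is defined as an intersection; flatness ensures that it is itself one of the
  -- ideals intersected.
  have h2 : f ^ repeatDigit (p ^ d) C e ∈ frobeniusPower p (d * e) (colonBy J x) :=
    frobeniusPower_mono _ (h.trans (iSup_le h1)) (hψ.mem_frobeniusPower_sInf fun _ h => h)
  refine ⟨j + e, ?_⟩
  rw [LevelEq, hj]
  have h3 := hpow e 0
  rw [add_zero, add_zero] at h3
  rw [h3]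
  have h4 : ∀ y ∈ frobeniusPower p (d * e) (colonBy J x),
      x ^ p ^ (d * e) * y ∈ frobeniusPower p (d * e) J := by
    intro y hy
    have : frobeniusPower p (d * e) (colonBy J x) ≤
        colonBy (frobeniusPower p (d * e) J) (x ^ p ^ (d * e)) := by
      rw [frobeniusPower, Ideal.span_le]
      rintro _ ⟨z, hz, rfl⟩
      change x ^ p ^ (d * e) * z ^ p ^ (d * e) ∈ frobeniusPower p (d * e) J
      rw [← mul_pow]
      exact pow_mem_frobeniusPower _ hz
    exact this hy
  exact h4 _ h2

end LevelEqLemmas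

/-! ### Residues of p-adic integers and pure periodicity -/

section Periodicity

variable {p : ℕ} [Fact p.Prime]

/-- The residue in `{0, …, p ^ e - 1}` of a `p`-adic integer modulo `p ^ e`. -/
def residue (α : ℤ_[p]) (e : ℕ) : ℕ :=
  (PadicInt.toZModPow e α).val

theorem residue_lt (α : ℤ_[p]) (e : ℕ) : residue α e < p ^ e :=
  haveI : NeZero (p ^ e) := ⟨pow_ne_zero e (Fact.out : p.Prime).ne_zero⟩
  ZMod.val_lt _

theorem residue_zero (α : ℤ_[p]) : residue α 0 = 0 := by
  have := residue_lt α 0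
  rw [pow_zero] at this
  omega

theorem residue_eq_of_toZModPow {α : ℤ_[p]} {e m : ℕ} (hm : m < p ^ e)
    (h : PadicInt.toZModPow e α = m) : residue α e = m := by
  rw [residue, h, ZMod.val_natCast_of_lt hm]

theorem natCast_residue (α : ℤ_[p]) (e : ℕ) :
    ((residue α e : ℕ) : ZMod (p ^ e)) = PadicInt.toZModPow e α :=
  haveI : NeZero (p ^ e) := ⟨pow_ne_zero e (Fact.out : p.Prime).ne_zero⟩
  ZMod.natCast_zmod_val _

theorem residue_modEq (α : ℤ_[p]) {e e' : ℕ} (h : e ≤ e') :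
    residue α e' ≡ residue α e [MOD p ^ e] := by
  rw [← ZMod.natCast_eq_natCast_iff, natCast_residue]
  have h1 := congrArg (ZMod.castHom (pow_dvd_pow p h) (ZMod (p ^ e))) (natCast_residue α e')
  rw [map_natCast] at h1
  rw [h1]
  exact PadicInt.cast_toZModPow e e' h α

theorem residue_mod (α : ℤ_[p]) {e e' : ℕ} (h : e ≤ e') : residue α e' % p ^ e = residue α e := by
  have := residue_modEq α h
  rwa [Nat.ModEq, Nat.mod_eq_of_lt (residue_lt α e)] at this

theorem ext_residue {α β : ℤ_[p]} (h : ∀ e, residue α e = residue β e) : α = β := by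
  rw [← PadicInt.ext_of_toZModPow]
  intro e
  rw [← natCast_residue, ← natCast_residue, h]

theorem residue_add_mul (α : ℤ_[p]) {c : ℕ} (hc : c < p) (e : ℕ) :
    residue ((c : ℤ_[p]) + (p : ℤ_[p]) * α) (e + 1) = p * residue α e + c := by
  apply residue_eq_of_toZModPow
  · have := residue_lt α e
    rw [pow_succ']
    calc p * residue α e + c < p * residue α e + p := by omega
      _ = p * (residue α e + 1) := by ring
      _ ≤ p * p ^ e := Nat.mul_le_mul_left _ this
  · rw [map_add, map_mul, map_natCast, map_natCast, ← natCast_residue,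
      ← Nat.cast_mul, ← Nat.cast_add, ZMod.natCast_eq_natCast_iff, add_comm c, pow_succ']
    exact (Nat.ModEq.mul_left' p (residue_modEq α e.le_succ)).add_right c

theorem residue_repeatDigit {α : ℤ_[p]} {d C : ℕ} (hC : C < p ^ d)
    (h : α = C + (p : ℤ_[p]) ^ d * α) (j : ℕ) :
    residue α (d * j) = repeatDigit (p ^ d) C j := by
  have h1 : α = repeatDigit (p ^ d) C j + (p : ℤ_[p]) ^ (d * j) * α := by
    induction j with
    | zero => simp [repeatDigit]
    | succ j ih =>
      rw [repeatDigit]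
      conv_lhs => rw [h, ih]
      push_cast
      ring
  refine residue_eq_of_toZModPow (by rw [pow_mul]; exact repeatDigit_lt hC j) ?_
  have h2 := congrArg (PadicInt.toZModPow (d * j)) h1
  rw [map_add, map_natCast, map_mul, map_pow, map_natCast, ← Nat.cast_pow, ZMod.natCast_self,
    zero_mul, add_zero] at h2
  exact h2

/-- A set of `p`-adic integers which is determined by boundedly many residues at each level, and
closed under prepending a suitable lowest digit, consists of purely periodic expansions. -/
theorem exists_periodic {Q : ℕ → ℕ → Prop} (h1 : ∀ e a b, Q e a → Q (e + 1) (a + b * p ^ e))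
    (h2 : ∀ e b, (∀ c < p, Q (e + 1) (p * b + c)) → Q e b)
    (h3 : ∃ N, ∀ e, ∀ s : Finset ℕ, (∀ a ∈ s, a < p ^ e ∧ ¬ Q e a) → s.card ≤ N)
    {α : ℤ_[p]} (hα : ∀ e, ¬ Q e (residue α e)) :
    ∃ d C : ℕ, 0 < d ∧ C < p ^ d ∧ α = C + (p : ℤ_[p]) ^ d * α := by
  have hp := (Fact.out : p.Prime)
  let Z : Set ℤ_[p] := {α | ∀ e, ¬ Q e (residue α e)}
  have hmono : ∀ e e' a, e ≤ e' → a < p ^ e' → ¬ Q e' a → ¬ Q e (a % p ^ e) := by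
    intro e e' a hee' ha h
    induction e', hee' using Nat.le_induction generalizing a with
    | base => rwa [Nat.mod_eq_of_lt ha]
    | succ e' hee' ih =>
      rw [← Nat.mod_mod_of_dvd a (pow_dvd_pow p hee')]
      refine ih _ (Nat.mod_lt _ (pow_pos hp.pos _)) fun hQ => h ?_
      have := h1 e' _ (a / p ^ e') hQ
      rwa [mul_comm, Nat.mod_add_div] at this
  have hres : ∀ (α : ℤ_[p]) e e', e ≤ e' → ¬ Q e' (residue α e') → ¬ Q e (residue α e) := by
    intro α e e' hee' h
    rw [← residue_mod α hee']
    exact hmono e e' _ hee' (residue_lt α e') h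
  -- N + 1 elements of Z would have distinct residues at some common level, all of them failing Q,
  -- against the bound N.
  have hfin : Z.Finite := by
    obtain ⟨N, hN⟩ := h3
    by_contra hinf
    obtain ⟨t, htZ, ht⟩ := Set.Infinite.exists_subset_card_eq hinf (N + 1)
    obtain ⟨e, he⟩ : ∃ e, Set.InjOn (fun α => residue α e) (t : Set ℤ_[p]) := by
      have : ∀ x : ℤ_[p] × ℤ_[p], ∃ e, residue x.1 e = residue x.2 e → x.1 = x.2 := by
        intro x
        by_contra! hx
        exact (hx 0).2 (ext_residue fun e => (hx e).1)
      choose E hE using this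
      refine ⟨(t ×ˢ t).sup E, fun α hα β hβ hαβ => hE (α, β) ?_⟩
      have hle : E (α, β) ≤ (t ×ˢ t).sup E :=
        Finset.le_sup (Finset.mk_mem_product hα hβ)
      rw [← residue_mod α hle, ← residue_mod β hle]
      exact congrArg (· % p ^ E (α, β)) hαβ
    have := hN e (t.image fun α => residue α e) ?_
    · rw [Finset.card_image_of_injOn he, ht] at this
      omega
    · intro a ha
      obtain ⟨β, hβ, rfl⟩ := Finset.mem_image.1 ha
      exact ⟨residue_lt β e, htZ hβ e⟩
  -- If every digit c led out of Z, one level would witness this for all p digits at once, since Q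
  -- persists to higher levels; then `h2` would give Q for a residue of β.
  have hpre : ∀ β : Z, ∃ c < p, ((c : ℤ_[p]) + p * β.1) ∈ Z := by
    rintro ⟨β, hβ⟩
    by_contra! hc
    have hc' : ∀ c : Fin p, ∃ e, Q e (residue (((c : ℕ) : ℤ_[p]) + (p : ℤ_[p]) * β) e) := by
      intro c
      have := hc c c.2
      simp only [Z, Set.mem_ofPred_eq, not_forall, not_not] at this
      exact this
    choose E hE using hc'
    refine hβ (Finset.univ.sup E) (h2 _ _ fun c hcp => ?_)
    by_contra hQ
    rw [← residue_add_mul β hcp] at hQ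
    exact hres _ _ _ ((Finset.le_sup (Finset.mem_univ (⟨c, hcp⟩ : Fin p))).trans
      (Nat.le_succ _)) hQ (hE ⟨c, hcp⟩)
  choose c hc hcZ using hpre
  let g : Z → Z := fun β => ⟨_, hcZ β⟩
  have hg : Function.Injective g := by
    intro β γ hβγ
    have heq : (c β : ℤ_[p]) + p * β.1 = c γ + p * γ.1 := congrArg Subtype.val hβγ
    have hcc : c β = c γ := by
      have h : residue _ (0 + 1) = residue _ (0 + 1) := congrArg (fun x => residue x 1) heq
      rwa [residue_add_mul _ (hc β), residue_add_mul _ (hc γ), residue_zero, residue_zero,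
        add_right_inj] at h
    rw [hcc, add_right_inj] at heq
    exact Subtype.ext (mul_left_cancel₀ (Nat.cast_ne_zero.2 hp.ne_zero) heq)
  have : Finite Z := hfin
  -- An injective self-map of a finite set has only periodic points. Returning to α after d
  -- prepended digits is exactly α = C + p^d α.
  obtain ⟨d, hd, hper⟩ := Function.mem_periodicPts.1 (hg.mem_periodicPts ⟨α, hα⟩)
  have hit : ∀ n, ∃ C < p ^ n, ((g^[n] ⟨α, hα⟩ : Z) : ℤ_[p]) = C + (p : ℤ_[p]) ^ n * α := by
    intro n
    induction n with
    | zero => exact ⟨0, by simp, by simp⟩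
    | succ n ih =>
      obtain ⟨C, hC, h⟩ := ih
      refine ⟨c (g^[n] ⟨α, hα⟩) + p * C, ?_, ?_⟩
      · have := hc (g^[n] ⟨α, hα⟩)
        rw [pow_succ']
        calc c (g^[n] ⟨α, hα⟩) + p * C < p + p * C := by omega
          _ = p * (C + 1) := by ring
          _ ≤ p * p ^ n := Nat.mul_le_mul_left _ hC
      · rw [Function.iterate_succ_apply']
        change (c (g^[n] ⟨α, hα⟩) : ℤ_[p]) + p * (g^[n] ⟨α, hα⟩ : Z).1 = _
        rw [h]
        push_cast
        ring
  obtain ⟨C, hC, h⟩ := hit d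
  rw [hper] at h
  exact ⟨d, C, hd, hC, h⟩

end Periodicity

/-! ### Differential operators are the operators of some level p^e -/

section FiniteOrder

variable {k : Type*} [Field k] {R : Type*} [CommRing R] [Algebra k R]

theorem bracket_comm (P : Module.End k R) (a b : R) :
    bracket (bracket P a) b = bracket (bracket P b) a := by
  ext x
  simp only [bracket_apply, mul_left_comm a b]
  ring

/-- The adjoint action `P ↦ [P, a]` as a linear map. -/
def adBracket (a : R) : Module.End k (Module.End k R) :=
  LinearMap.mulRight k (Algebra.lmul k R a) - LinearMap.mulLeft k (Algebra.lmul k R a)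

theorem adBracket_apply (a : R) (P : Module.End k R) : adBracket a P = bracket P a :=
  rfl

/-- Right and left multiplication by a commute, so the p^e-th power of their difference is the
difference of the p^e-th powers. -/
theorem adBracket_pow_char {p : ℕ} [Fact p.Prime] [CharP k p] [Nontrivial R] (a : R) (e : ℕ) :
    (adBracket a : Module.End k (Module.End k R)) ^ p ^ e = adBracket (a ^ p ^ e) := by
  have : CharP (Module.End k (Module.End k R)) p :=
    charP_of_injective_algebraMap
      (FaithfulSMul.algebraMap_injective k (Module.End k (Module.End k R))) p
  refine (sub_pow_char_pow_of_commute (R := Module.End k (Module.End k R)) p e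
    (LinearMap.commute_mulLeft_right (R := k) (A := Module.End k R) _ _).symm).trans ?_
  rw [LinearMap.pow_mulRight, LinearMap.pow_mulLeft, ← map_pow]
  rfl

theorem bracket_eq_zero_iff {P : Module.End k R} {a : R} :
    bracket P a = 0 ↔ ∀ x, P (a * x) = a * P x := by
  constructor
  · intro h x
    have := DFunLike.congr_fun h x
    rwa [bracket_apply, LinearMap.zero_apply, sub_eq_zero] at this
  · intro h
    ext x
    rw [bracket_apply, h, sub_self, LinearMap.zero_apply]

theorem isLevel_iff_bracket {q : ℕ} {P : Module.End k R} :
    IsLevel q P ↔ ∀ r, bracket P (r ^ q) = 0 :=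
  forall_congr' fun _ => bracket_eq_zero_iff.symm

theorem adBracket_pow_eq_zero {n : ℕ} {P : Module.End k R} (hP : P ∈ diffOpFiltration k R n)
    (a : R) {m : ℕ} (hm : n ≤ m) : (adBracket a ^ m) P = 0 := by
  induction n generalizing P m with
  | zero => rw [mem_diffOpFiltration_zero.1 hP, map_zero]
  | succ n ih =>
    obtain ⟨m, rfl⟩ := Nat.exists_eq_succ_of_ne_zero (by omega : m ≠ 0)
    rw [pow_succ, Module.End.mul_apply]
    exact ih (hP a) (by omega)

/-- Differential operators are linear over sufficiently high Frobenius powers. -/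
theorem isLevel_of_mem_diffOpFiltration {p : ℕ} [Fact p.Prime] [CharP k p] {n e : ℕ}
    {P : Module.End k R} (hP : P ∈ diffOpFiltration k R n) (hn : n ≤ p ^ e) :
    IsLevel (p ^ e) P := by
  rcases subsingleton_or_nontrivial R with h | h
  · exact fun r x => Subsingleton.elim _ _
  · rw [isLevel_iff_bracket]
    intro r
    rw [← adBracket_apply, ← adBracket_pow_char]
    exact adBracket_pow_eq_zero hP r hn

theorem mem_diffOpFiltration_succ_of_adjoin {S : Set R} (hS : Algebra.adjoin k S = ⊤) {n : ℕ}
    {P : Module.End k R} (hP : ∀ x ∈ S, bracket P x ∈ diffOpFiltration k R n) :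
    P ∈ diffOpFiltration k R (n + 1) := by
  intro a
  have ha : a ∈ Algebra.adjoin k S := hS ▸ Algebra.mem_top
  induction ha using Algebra.adjoin_induction with
  | mem y hy => exact hP y hy
  | algebraMap r =>
    have : bracket P (algebraMap k R r) = 0 := bracket_eq_zero_iff.2 fun y => by
      rw [← Algebra.smul_def, ← Algebra.smul_def, map_smul]
    rw [this]
    exact zero_mem _
  | add y z _ _ hy hz => rw [bracket_add_right]; exact add_mem hy hz
  | mul y z _ _ hy hz =>
    rw [bracket_mul_right]
    exact add_mem (mul_lmul_mem hy z) (lmul_mul_mem hz y)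

/-- Commutators with different generators commute, so each commutation with a generator lowers one
exponent c_i and keeps the others. The induction is on the sum of the exponents. -/
theorem mem_diffOpFiltration_of_adBracket {ι : Type*} [Fintype ι] {x : ι → R}
    (hx : Algebra.adjoin k (Set.range x) = ⊤) {N : ℕ} {c : ι → ℕ} (hc : ∑ i, c i ≤ N)
    {P : Module.End k R} (hP : ∀ i, (adBracket (x i) ^ c i) P = 0) :
    P ∈ diffOpFiltration k R (N + 1) := by
  classical
  have hzero : ∀ i n, c i = 0 → bracket P (x i) ∈ diffOpFiltration k R n := by
    intro i n hi
    have := hP i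
    rw [hi, pow_zero, Module.End.one_apply] at this
    rw [this, bracket_zero]
    exact zero_mem _
  induction N generalizing c P with
  | zero =>
    refine mem_diffOpFiltration_succ_of_adjoin hx ?_
    rintro _ ⟨i, rfl⟩
    exact hzero i 0 (Nat.le_zero.1 ((Finset.single_le_sum (fun _ _ => Nat.zero_le _)
      (Finset.mem_univ i)).trans hc))
  | succ N ih =>
    refine mem_diffOpFiltration_succ_of_adjoin hx ?_
    rintro _ ⟨i, rfl⟩
    by_cases hi : c i = 0
    · exact hzero i _ hi
    have hP' : ∀ j, (adBracket (x j) ^ (Function.update c i (c i - 1)) j)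
        (bracket P (x i)) = 0 := by
      intro j
      rcases eq_or_ne j i with rfl | hj
      · rw [Function.update_self, ← adBracket_apply, ← Module.End.mul_apply, ← pow_succ,
          Nat.sub_add_cancel (Nat.pos_of_ne_zero hi), hP]
      · have hcomm : Commute (adBracket (k := k) (x j)) (adBracket (x i)) :=
          LinearMap.ext fun Q => (bracket_comm Q (x i) (x j))
        rw [Function.update_of_ne hj, ← adBracket_apply, ← Module.End.mul_apply,
          (hcomm.pow_left _).eq, Module.End.mul_apply, hP, map_zero]
    refine ih ?_ hP' fun j n hj => ?_
    · have h1 := Finset.sum_update_of_mem (Finset.mem_univ i) c (c i - 1)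
      have h2 := Finset.add_sum_erase Finset.univ c (Finset.mem_univ i)
      rw [Finset.sdiff_singleton_eq_erase] at h1
      omega
    · have := hP' j
      rw [hj, pow_zero, Module.End.one_apply] at this
      rw [this, bracket_zero]
      exact zero_mem _

/-- On an algebra of finite type, operators which are linear over the `q`-th powers are
differential operators. -/
theorem IsLevel.exists_mem_diffOpFiltration [Algebra.FiniteType k R] {p : ℕ} [Fact p.Prime]
    [CharP k p] {e : ℕ} {P : Module.End k R} (hP : IsLevel (p ^ e) P) :
    ∃ n, P ∈ diffOpFiltration k R n := by
  rcases subsingleton_or_nontrivial R with h | h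
  · exact ⟨0, mem_diffOpFiltration_zero.2 (LinearMap.ext fun x => Subsingleton.elim _ _)⟩
  · obtain ⟨s, hs⟩ := (inferInstance : Algebra.FiniteType k R).out
    refine ⟨_, mem_diffOpFiltration_of_adBracket (x := ((↑) : s → R)) (by simpa using hs)
      (c := fun _ => p ^ e) le_rfl fun i => ?_⟩
    rw [adBracket_pow_char, adBracket_apply]
    exact isLevel_iff_bracket.1 hP i

end FiniteOrder

/-! ### Eigenvalues, digit projectors and roots -/

section BinomialAlgebra

variable {k : Type*} [Field k] {p : ℕ}

theorem exists_eigenvalue (θ : binomialAlgebra k p) (n : ℕ) :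
    ∃ c : k, ∀ x, DiffOp.toEnd k k[X] θ (monomial n x) = monomial n (c * x) := by
  obtain ⟨θ, hθ⟩ := θ
  induction hθ using Algebra.adjoin_induction with
  | mem _ h =>
    obtain ⟨e, rfl⟩ := h
    exact ⟨_, fun x => eulerOp_monomial k p e n x⟩
  | algebraMap r =>
    refine ⟨r, fun x => ?_⟩
    change DiffOp.toEnd k k[X] (algebraMap k _ r) _ = _
    rw [AlgHom.commutes, Module.algebraMap_end_apply, smul_monomial, smul_eq_mul]
  | add θ θ' _ _ h h' =>
    obtain ⟨c, h⟩ := h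
    obtain ⟨c', h'⟩ := h'
    refine ⟨c + c', fun x => ?_⟩
    change DiffOp.toEnd k k[X] (θ + θ') _ = _
    rw [map_add, LinearMap.add_apply, h, h', add_mul, map_add]
  | mul θ θ' _ _ h h' =>
    obtain ⟨c, h⟩ := h
    obtain ⟨c', h'⟩ := h'
    refine ⟨c * c', fun x => ?_⟩
    change DiffOp.toEnd k k[X] (θ * θ') _ = _
    rw [map_mul, Module.End.mul_apply, h', h, mul_assoc]

/-- The eigenvalue on `t ^ n` of an element of the algebra of binomial coefficients. -/
def eigenvalue (n : ℕ) (θ : binomialAlgebra k p) : k :=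
  (exists_eigenvalue θ n).choose

theorem toEnd_monomial (θ : binomialAlgebra k p) (n : ℕ) (x : k) :
    DiffOp.toEnd k k[X] θ (monomial n x) = monomial n (eigenvalue n θ * x) :=
  (exists_eigenvalue θ n).choose_spec x

theorem eigenvalue_eq {θ : binomialAlgebra k p} {n : ℕ} {c : k}
    (h : DiffOp.toEnd k k[X] θ (monomial n 1) = monomial n c) : eigenvalue n θ = c := by
  rw [toEnd_monomial, mul_one] at h
  exact (monomial_injective n) h

variable (k p) in
/-- The eigenvalue on `t ^ n`, as a ring homomorphism. -/
def eigenvalueHom (n : ℕ) : binomialAlgebra k p →+* k where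
  toFun := eigenvalue n
  map_one' := eigenvalue_eq (by
    change DiffOp.toEnd k k[X] 1 _ = _
    rw [map_one, Module.End.one_apply])
  map_zero' := eigenvalue_eq (by
    change DiffOp.toEnd k k[X] 0 _ = _
    rw [map_zero, LinearMap.zero_apply, map_zero])
  map_mul' θ θ' := eigenvalue_eq (by
    change DiffOp.toEnd k k[X] (θ * θ') _ = _
    rw [map_mul, Module.End.mul_apply, toEnd_monomial, toEnd_monomial, mul_one])
  map_add' θ θ' := eigenvalue_eq (by
    change DiffOp.toEnd k k[X] (θ + θ') _ = _
    rw [map_add, LinearMap.add_apply, toEnd_monomial, toEnd_monomial, mul_one, mul_one, map_add])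

theorem eigenvalueHom_apply (n : ℕ) (θ : binomialAlgebra k p) :
    eigenvalueHom k p n θ = eigenvalue n θ :=
  rfl

theorem eigenvalue_ext {θ θ' : binomialAlgebra k p} (h : ∀ n, eigenvalue n θ = eigenvalue n θ') :
    θ = θ' := by
  refine Subtype.ext (DiffOp.toEnd_injective k _ ?_)
  ext1 n
  ext1
  simp only [LinearMap.comp_apply]
  rw [toEnd_monomial, toEnd_monomial, h]

variable (k p) in
/-- The idempotent of the algebra of binomial coefficients which selects the exponents with the
first `e` digits of `a`. -/
def digitProjector (e a : ℕ) : binomialAlgebra k p :=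
  ∏ i ∈ Finset.range e, (1 - (binomialCoeff k p i - ((a / p ^ i : ℕ) : binomialAlgebra k p)) ^ (p - 1))

theorem eigenvalue_digitProjector (n e a : ℕ) :
    eigenvalue n (digitProjector k p e a) = ∏ i ∈ Finset.range e,
      (1 - (eigenvalue n (binomialCoeff k p i) - ((a / p ^ i : ℕ) : k)) ^ (p - 1)) := by
  rw [← eigenvalueHom_apply, digitProjector, map_prod]
  refine Finset.prod_congr rfl fun i _ => ?_
  rw [map_sub, map_one, map_pow, map_sub, map_natCast, eigenvalueHom_apply]

theorem modEq_pow_of_div {a b e : ℕ} (h : ∀ i < e, a / p ^ i ≡ b / p ^ i [MOD p]) :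
    a ≡ b [MOD p ^ e] := by
  induction e with
  | zero => rw [pow_zero]; exact Nat.modEq_one
  | succ e ih =>
    have h1 := ih fun i hi => h i (hi.trans e.lt_succ_self)
    have h2 := h e e.lt_succ_self
    rw [Nat.ModEq] at h1 h2 ⊢
    rw [Nat.mod_pow_succ, Nat.mod_pow_succ, h1, h2]

theorem div_modEq_of_modEq_pow {a b e i : ℕ} (h : a ≡ b [MOD p ^ e]) (hi : i < e) :
    a / p ^ i ≡ b / p ^ i [MOD p] := by
  have h2 : a ≡ b [MOD p ^ i * p] := h.of_dvd (by rw [← pow_succ]; exact pow_dvd_pow p hi)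
  rw [Nat.ModEq, ← Nat.mod_mul_right_div_self, ← Nat.mod_mul_right_div_self]
  rw [h2]

variable [Fact p.Prime] [CharP k p]

/-- Lucas' theorem strips the lowest digit of n and reduces to i = 0. -/
theorem cast_choose_add_pow (n i : ℕ) :
    ((n + p ^ i).choose (p ^ i) : k) = (n / p ^ i : ℕ) + 1 := by
  have h : (n + p ^ i).choose (p ^ i) ≡ n / p ^ i + 1 [MOD p] := by
    induction i generalizing n with
    | zero => simp [Nat.ModEq.refl]
    | succ i ih =>
      have hp : 0 < p := (Fact.out : p.Prime).pos
      refine (Choose.choose_modEq_choose_mod_mul_choose_div_nat (p := p)).trans ?_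
      rw [pow_succ', Nat.mul_mod_right, Nat.choose_zero_right, one_mul,
        Nat.add_mul_div_left _ _ hp, Nat.mul_div_cancel_left _ hp, ← Nat.div_div_eq_div_mul]
      exact ih _
  exact_mod_cast (CharP.natCast_eq_natCast k p).2 h

theorem eigenvalue_binomialCoeff (n i : ℕ) :
    eigenvalue n (binomialCoeff k p i) = -((n / p ^ i : ℕ) + 1) := by
  rw [← cast_choose_add_pow]
  refine eigenvalue_eq ?_
  change DiffOp.toEnd k k[X] (-eulerOp k p i) _ = _
  rw [map_neg, LinearMap.neg_apply, eulerOp_monomial, mul_one, map_neg]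

/-- The base p digits of p^e - 1 - a are complementary to those of a: ⌊(p^e - 1 - a)/p^i⌋ + 1 +
⌊a/p^i⌋ = p^(e-i), which vanishes in k. This is why components are indexed by the exponent p^e - 1 -
a. -/
theorem eigenvalue_binomialCoeff_of_lt {e i a : ℕ} (hi : i < e) (ha : a < p ^ e) :
    eigenvalue (p ^ e - 1 - a) (binomialCoeff k p i) = (a / p ^ i : ℕ) := by
  have hp : 0 < p := (Fact.out : p.Prime).pos
  have h : (p ^ e - 1 - a) / p ^ i + 1 + a / p ^ i = p * p ^ (e - i - 1) := by
    obtain ⟨j, rfl⟩ := Nat.exists_eq_add_of_lt hi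
    have h1 : i + j + 1 - i - 1 = j := by omega
    rw [h1, ← pow_succ']
    have h2 : p ^ (i + j + 1) = p ^ i * p ^ (j + 1) := by rw [← pow_add]; rfl
    rw [h2] at ha ⊢
    have h3 := Nat.mul_sub_div a (p ^ i) (p ^ (j + 1)) ha
    have h4 : a / p ^ i < p ^ (j + 1) := (Nat.div_lt_iff_lt_mul (pow_pos hp _)).2 (by
      rwa [mul_comm])
    rw [Nat.sub_sub, add_comm 1 a, h3]
    omega
  rw [eigenvalue_binomialCoeff, neg_eq_iff_add_eq_zero]
  have h' := congrArg (Nat.cast (R := k)) h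
  push_cast at h'
  rw [CharP.cast_eq_zero k p, zero_mul] at h'
  exact h'

theorem eigenvalue_binomialCoeff_add {e i : ℕ} (hi : i < e) (n : ℕ) :
    eigenvalue (n + p ^ e) (binomialCoeff k p i) = eigenvalue n (binomialCoeff k p i) := by
  have hp : 0 < p := (Fact.out : p.Prime).pos
  obtain ⟨j, rfl⟩ := Nat.exists_eq_add_of_lt hi
  have h2 : p ^ (i + j + 1) = p ^ i * p ^ (j + 1) := by rw [← pow_add]; rfl
  rw [eigenvalue_binomialCoeff, eigenvalue_binomialCoeff, h2,
    Nat.add_mul_div_left _ _ (pow_pos hp _)]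
  push_cast
  rw [pow_succ, CharP.cast_eq_zero k p, mul_zero, add_zero]

theorem eigenvalue_digitProjector_add {e e' : ℕ} (h : e ≤ e') (a n : ℕ) :
    eigenvalue (n + p ^ e') (digitProjector k p e a) = eigenvalue n (digitProjector k p e a) := by
  rw [eigenvalue_digitProjector, eigenvalue_digitProjector]
  refine Finset.prod_congr rfl fun i hi => ?_
  rw [eigenvalue_binomialCoeff_add ((Finset.mem_range.1 hi).trans_le h)]

theorem natCast_sub_natCast_pow_sub_one (m n : ℕ) :
    ((m : k) - n) ^ (p - 1) = if m ≡ n [MOD p] then 0 else 1 := by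
  have hp : p.Prime := Fact.out
  split_ifs with h
  · rw [(CharP.natCast_eq_natCast k p).2 h, sub_self, zero_pow]
    have := hp.two_le
    omega
  · have h1 : ((m : ZMod p) - n) ^ (p - 1) = 1 := by
      refine ZMod.pow_card_sub_one_eq_one ?_
      rwa [sub_ne_zero, Ne, ZMod.natCast_eq_natCast_iff]
    have := congrArg (ZMod.castHom (dvd_refl p) k) h1
    simpa using this

theorem eigenvalue_digitProjector_of_lt {e e' a a' : ℕ} (h : e ≤ e') (ha' : a' < p ^ e') :
    eigenvalue (p ^ e' - 1 - a') (digitProjector k p e a) =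
      if a' ≡ a [MOD p ^ e] then 1 else 0 := by
  rw [eigenvalue_digitProjector]
  have h1 : ∀ i ∈ Finset.range e,
      (1 - (eigenvalue (p ^ e' - 1 - a') (binomialCoeff k p i) - ((a / p ^ i : ℕ) : k)) ^ (p - 1)) =
        if a' / p ^ i ≡ a / p ^ i [MOD p] then 1 else 0 := by
    intro i hi
    rw [eigenvalue_binomialCoeff_of_lt ((Finset.mem_range.1 hi).trans_le h) ha',
      natCast_sub_natCast_pow_sub_one]
    split_ifs <;> simp
  rw [Finset.prod_congr rfl h1]
  split_ifs with h2
  · exact Finset.prod_eq_one fun i hi =>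
      if_pos (div_modEq_of_modEq_pow h2 (Finset.mem_range.1 hi))
  · have h3 : ∃ i ∈ Finset.range e, ¬ a' / p ^ i ≡ a / p ^ i [MOD p] := by
      by_contra! h4
      exact h2 (modEq_pow_of_div fun i hi => h4 i (Finset.mem_range.2 hi))
    obtain ⟨i, hi, hi'⟩ := h3
    exact Finset.prod_eq_zero hi (if_neg hi')

/-- All eigenvalues lie in the prime field, so z = (s choose p^i) - a_i satisfies z^p = z, and z (1
- z^(p-1)) = 0 for the i-th factor. -/
theorem binomialCoeff_sub_mul_digitProjector {e i a : ℕ} (hi : i < e) :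
    (binomialCoeff k p i - ((a / p ^ i : ℕ) : binomialAlgebra k p)) * digitProjector k p e a = 0 := by
  have hp : p.Prime := Fact.out
  suffices h : (binomialCoeff k p i - ((a / p ^ i : ℕ) : binomialAlgebra k p)) *
      (1 - (binomialCoeff k p i - ((a / p ^ i : ℕ) : binomialAlgebra k p)) ^ (p - 1)) = 0 by
    rw [digitProjector, ← Finset.mul_prod_erase _ _ (Finset.mem_range.2 hi), ← mul_assoc, h,
      zero_mul]
  refine eigenvalue_ext fun n => ?_
  rw [← eigenvalueHom_apply, ← eigenvalueHom_apply, map_zero, map_mul, map_sub _ 1, map_one,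
    map_pow, map_sub, map_natCast, eigenvalueHom_apply, eigenvalue_binomialCoeff]
  set z : k := -(((n / p ^ i : ℕ) : k) + 1) - ((a / p ^ i : ℕ) : k) with hz
  have hz' : z = -((n / p ^ i + 1 + a / p ^ i : ℕ) : k) := by
    rw [hz]; push_cast; ring
  have h1 : z ^ p = z := by
    have h2 := ZMod.pow_card (p := p) (-((n / p ^ i + 1 + a / p ^ i : ℕ) : ZMod p))
    have := congrArg (ZMod.castHom (dvd_refl p) k) h2
    rw [map_pow, map_neg, map_natCast] at this
    rw [hz', this]
  rw [mul_sub, mul_one, ← pow_succ', Nat.sub_add_cancel hp.one_le, h1, sub_self]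

theorem natCast_padicDigit (α : ℤ_[p]) {i e : ℕ} (hi : i < e) :
    (padicDigit α i : k) = ((residue α e / p ^ i : ℕ) : k) := by
  rw [CharP.natCast_eq_natCast k p]
  refine div_modEq_of_modEq_pow (e := i + 1) ?_ i.lt_succ_self
  exact (residue_modEq α hi).symm

/-- A `p`-adic integer is a root of an ideal of the algebra of binomial coefficients iff none of
its digit projectors lies in the ideal. -/
theorem mem_padicRoots_iff {I : Ideal (binomialAlgebra k p)} {α : ℤ_[p]} :
    α ∈ padicRoots I ↔ ∀ e, digitProjector k p e (residue α e) ∉ I := by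
  have hdigit : ∀ {i e : ℕ}, i < e →
      algebraMap k (binomialAlgebra k p) (padicDigit α i : k) =
        ((residue α e / p ^ i : ℕ) : binomialAlgebra k p) := fun hi => by
    rw [natCast_padicDigit α hi, map_natCast]
  constructor
  · rintro ⟨m, hm, hI, h⟩ e he
    have hp : p - 1 ≠ 0 := by
      have := (Fact.out : p.Prime).two_le
      omega
    have h1 := (Ideal.Quotient.eq_zero_iff_mem).2 (hI he)
    rw [digitProjector, map_prod] at h1
    -- Modulo the maximal ideal each factor is 1 - 0^(p-1) = 1, so a projector in I would force 1 =
    -- 0 in the residue field.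
    rw [Finset.prod_eq_one] at h1
    · exact hm.ne_top ((Ideal.eq_top_iff_one m).2 ((Ideal.Quotient.eq_zero_iff_mem).1
        (h1.symm ▸ map_one _)))
    · intro i hi
      have h2 := h i
      rw [hdigit (Finset.mem_range.1 hi)] at h2
      rw [map_sub, map_one, map_pow, (Ideal.Quotient.eq_zero_iff_mem).2 h2, zero_pow hp, sub_zero]
  · intro h
    set J : Ideal (binomialAlgebra k p) := Ideal.span (Set.range fun i =>
      binomialCoeff k p i - algebraMap k (binomialAlgebra k p) (padicDigit α i : k)) with hJ
    by_cases htop : I ⊔ J = ⊤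
    · exfalso
      -- If 1 = x + y with x ∈ I and y ∈ J, a projector killing y equals x times itself and so lies
      -- in I.
      have hkill : ∀ y ∈ J, ∃ e, ∀ e' ≥ e, y * digitProjector k p e' (residue α e') = 0 := by
        intro y hy
        rw [hJ] at hy
        induction hy using Submodule.span_induction with
        | mem y hy =>
          obtain ⟨i, rfl⟩ := hy
          refine ⟨i + 1, fun e' he' => ?_⟩
          change (binomialCoeff k p i - algebraMap k (binomialAlgebra k p) (padicDigit α i : k)) *
            _ = 0
          rw [hdigit he', binomialCoeff_sub_mul_digitProjector he']
        | zero => exact ⟨0, fun _ _ => zero_mul _⟩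
        | add y z _ _ hy hz =>
          obtain ⟨e, hy⟩ := hy
          obtain ⟨e', hz⟩ := hz
          refine ⟨max e e', fun e'' h'' => ?_⟩
          rw [add_mul, hy _ (le_of_max_le_left h''), hz _ (le_of_max_le_right h''), add_zero]
        | smul c y _ hy =>
          obtain ⟨e, hy⟩ := hy
          exact ⟨e, fun e' he' => by rw [smul_eq_mul, mul_assoc, hy e' he', mul_zero]⟩
      obtain ⟨x, hx, y, hy, hxy⟩ := Submodule.mem_sup.1
        ((Ideal.eq_top_iff_one _).1 htop)
      obtain ⟨e, he⟩ := hkill y hy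
      refine h e ?_
      rw [← one_mul (digitProjector k p e (residue α e)), ← hxy, add_mul, he e le_rfl, add_zero]
      exact Ideal.mul_mem_right _ _ hx
    · obtain ⟨m, hm, hle⟩ := Ideal.exists_le_maximal _ htop
      exact ⟨m, hm, le_sup_left.trans hle, fun i => hle (Ideal.mem_sup_right
        (Ideal.subset_span ⟨i, rfl⟩))⟩

end BinomialAlgebra

/-! ### Coordinates on B_f with denominator (f - t)^(p^e) -/

section GraphModule

variable {k : Type u} [Field k] {R : Type*} [CommRing R] [Algebra k R] (f : R)

/-- The power `(f - t) ^ q` as an element of the localizing submonoid. -/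
def graphDenominator (q : ℕ) : Submonoid.powers (C f - X : R[X]) :=
  ⟨(C f - X) ^ q, ⟨q, rfl⟩⟩

variable (k) in
/-- The map sending `g` to the class of `g / (f - t) ^ q`. -/
def polarPart (q : ℕ) : R[X] →ₗ[k] Bf k f :=
  (integralPart k f).mkQ ∘ₗ (LinearMap.mulLeft k (IsLocalization.mk' (GraphLocalization f)
    (1 : R[X]) (graphDenominator f q))) ∘ₗ
      (IsScalarTower.toAlgHom k R[X] (GraphLocalization f)).toLinearMap

theorem polarPart_apply (q : ℕ) (g : R[X]) : polarPart k f q g =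
    (integralPart k f).mkQ (IsLocalization.mk' (GraphLocalization f) (1 : R[X])
      (graphDenominator f q) * algebraMap R[X] (GraphLocalization f) g) :=
  rfl

theorem algebraMap_mul_mk'_graphDenominator (q : ℕ) :
    algebraMap R[X] (GraphLocalization f) ((C f - X) ^ q) *
      IsLocalization.mk' (GraphLocalization f) (1 : R[X]) (graphDenominator f q) = 1 := by
  have := IsLocalization.mk'_spec' (GraphLocalization f) (1 : R[X]) (graphDenominator f q)
  rwa [map_one] at this

variable {f}

theorem polarPart_eq_zero {q : ℕ} {g : R[X]} :
    polarPart k f q g = 0 ↔ (C f - X) ^ q ∣ g := by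
  have hinj := IsLocalization.injective (GraphLocalization f) (powers_le_nonZeroDivisors f)
  have h1 := algebraMap_mul_mk'_graphDenominator f q
  rw [polarPart_apply, Submodule.mkQ_apply, Submodule.Quotient.mk_eq_zero]
  constructor
  · rintro ⟨G, hG⟩
    refine ⟨G, hinj ?_⟩
    change algebraMap R[X] (GraphLocalization f) G = _ at hG
    rw [map_mul, hG, ← mul_assoc, h1, one_mul]
  · rintro ⟨G, rfl⟩
    refine ⟨G, ?_⟩
    change algebraMap R[X] (GraphLocalization f) G = _
    rw [map_mul, ← mul_assoc, mul_comm (IsLocalization.mk' _ _ _), h1, one_mul]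

/-- An operator commuting with (f - t)^q still commutes with it after localization, by uniqueness of
extensions, so it acts on the numerator alone. -/
theorem actionBf_polarPart {P : DiffOp k R[X]} {q : ℕ}
    (hP : ∀ g, DiffOp.toEnd k R[X] P ((C f - X) ^ q * g) =
      (C f - X) ^ q * DiffOp.toEnd k R[X] P g) (g : R[X]) :
    actionBf k f P (polarPart k f q g) = polarPart k f q (DiffOp.toEnd k R[X] P g) := by
  set L := GraphLocalization f
  set Q := DiffOp.localize _ (powers_le_nonZeroDivisors f) L P with hQ
  have hQa : ∀ a, DiffOp.toEnd k L Q (algebraMap R[X] L a) =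
      algebraMap R[X] L (DiffOp.toEnd k R[X] P a) :=
    DiffOp.localize_algebraMap _ (powers_le_nonZeroDivisors f) L P
  obtain ⟨n, hn⟩ := Q.exists_order
  have hb : bracket (DiffOp.toEnd k L Q) (algebraMap R[X] L ((C f - X) ^ q)) = 0 := by
    refine ext_of_localization (Submonoid.powers (C f - X : R[X])) (n := n)
      (diffOpFiltration_le_succ n hn _) fun a => ?_
    rw [bracket_apply, ← map_mul, hQa, hQa, hP, map_mul, sub_self]
  have h1 := algebraMap_mul_mk'_graphDenominator f q
  change (integralPart k f).mkQ (DiffOp.toEnd k L Q _) = _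
  rw [polarPart_apply]
  congr 1
  have h2 := bracket_eq_zero_iff.1 hb (IsLocalization.mk' L (1 : R[X])
    (graphDenominator f q) * algebraMap R[X] L g)
  rw [← mul_assoc, h1, one_mul, hQa] at h2
  change DiffOp.toEnd k L Q (IsLocalization.mk' L (1 : R[X])
    (graphDenominator f q) * algebraMap R[X] L g) = _
  rw [h2, ← mul_assoc, mul_comm _ (algebraMap R[X] L ((C f - X) ^ q)), h1, one_mul]

theorem toEnd_inclLine_monomial {p : ℕ} (θ : binomialAlgebra k p) (n : ℕ) (r : R) :
    DiffOp.toEnd k R[X] (DiffOp.inclLine k R θ) (monomial n r) =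
      monomial n (eigenvalue n θ • r) := by
  have h := DiffOp.inclLine_apply k R (θ : DiffOp k k[X]) r (monomial n 1)
  rw [toEnd_monomial, mul_one, Polynomial.map_monomial, Polynomial.map_monomial, map_one,
    C_mul_monomial, C_mul_monomial, mul_one] at h
  rw [h, Algebra.smul_def, mul_comm]

variable (k f) in
/-- The class of `(∑ a, r a t ^ (q - 1 - a)) / (f - t) ^ q`. -/
def fromComponents (q : ℕ) (r : ℕ → R) : Bf k f :=
  polarPart k f q (∑ a ∈ Finset.range q, monomial (q - 1 - a) (r a))

theorem fromComponents_congr {q : ℕ} {r r' : ℕ → R} (h : ∀ a < q, r a = r' a) :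
    fromComponents k f q r = fromComponents k f q r' := by
  rw [fromComponents, fromComponents]
  congr 1
  exact Finset.sum_congr rfl fun a ha => by rw [h a (Finset.mem_range.1 ha)]

theorem fromComponents_add (q : ℕ) (r r' : ℕ → R) :
    fromComponents k f q r + fromComponents k f q r' = fromComponents k f q (r + r') := by
  rw [fromComponents, fromComponents, fromComponents, ← map_add, ← Finset.sum_add_distrib]
  congr 1
  exact Finset.sum_congr rfl fun a _ => by rw [Pi.add_apply, map_add]

theorem fromComponents_eq_sum (q : ℕ) (r : ℕ → R) :
    fromComponents k f q r = ∑ a ∈ Finset.range q, fromComponents k f q (Pi.single a (r a)) := by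
  simp only [fromComponents]
  rw [← map_sum]
  congr 1
  refine Finset.sum_congr rfl fun a ha => ?_
  rw [Finset.sum_eq_single a, Pi.single_eq_same]
  · intro b _ hb
    rw [Pi.single_eq_of_ne hb, map_zero]
  · exact fun h => absurd ha h

variable {p : ℕ} [Fact p.Prime] [CharP R p]

theorem C_sub_X_pow (e : ℕ) : (C f - X : R[X]) ^ p ^ e = C (f ^ p ^ e) - X ^ p ^ e := by
  rw [sub_pow_char_pow, C_pow]

/-- The numerator has degree below p^e, while (f - t)^(p^e) is up to sign monic of degree p^e and
cannot divide a nonzero numerator. -/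
theorem fromComponents_injective {e : ℕ} {r r' : ℕ → R}
    (h : fromComponents k f (p ^ e) r = fromComponents k f (p ^ e) r') {a : ℕ} (ha : a < p ^ e) :
    r a = r' a := by
  have hp : p.Prime := Fact.out
  have : Nontrivial R := CharP.nontrivial_of_char_ne_one hp.ne_one
  rw [fromComponents, fromComponents, ← sub_eq_zero, ← map_sub, polarPart_eq_zero, C_sub_X_pow,
    ← neg_sub, neg_dvd, ← Finset.sum_sub_distrib] at h
  set g : R[X] := ∑ a ∈ Finset.range (p ^ e),
    ((monomial (p ^ e - 1 - a)) (r a) - (monomial (p ^ e - 1 - a)) (r' a)) with hg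
  have hq : 0 < p ^ e := pow_pos hp.pos e
  have hg0 : g = 0 := by
    by_contra hne
    have hm : (X ^ p ^ e - C (f ^ p ^ e) : R[X]).Monic := monic_X_pow_sub_C _ hq.ne'
    refine hm.not_dvd_of_degree_lt hne ?_ h
    rw [degree_X_pow_sub_C hq]
    refine (degree_sum_le _ _).trans_lt ((Finset.sup_lt_iff (WithBot.bot_lt_coe _)).2 ?_)
    intro b _
    rw [← map_sub]
    refine (degree_monomial_le _ _).trans_lt ?_
    exact_mod_cast (by omega : p ^ e - 1 - b < p ^ e)
  have h1 := congrArg (fun g => coeff g (p ^ e - 1 - a)) hg0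
  simp only [hg, finsetSum_coeff, coeff_sub, coeff_monomial, coeff_zero] at h1
  rw [Finset.sum_eq_single a] at h1
  · simpa [sub_eq_zero] using h1
  · intro b hb hba
    have := Finset.mem_range.1 hb
    rw [if_neg (by omega), if_neg (by omega), sub_zero]
  · exact fun h => absurd (Finset.mem_range.2 ha) h

/-- Level p^e makes P commute with f^(p^e), and its coefficientwise action commutes with t^(p^e);
hence it commutes with the denominator f^(p^e) - t^(p^e). -/
theorem actionBf_inclBase {P : DiffOp k R} {e : ℕ} (hP : IsLevel (p ^ e) (DiffOp.toEnd k R P))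
    (r : ℕ → R) : actionBf k f (DiffOp.inclBase k R P) (fromComponents k f (p ^ e) r) =
      fromComponents k f (p ^ e) fun a => DiffOp.toEnd k R P (r a) := by
  rw [fromComponents, actionBf_polarPart, fromComponents, map_sum]
  · congr 1
    exact Finset.sum_congr rfl fun a _ => DiffOp.inclBase_monomial k R P _ _
  · intro g
    rw [C_sub_X_pow]
    induction g using Polynomial.induction_on' with
    | add g h hg hh => rw [mul_add, map_add, hg, hh, map_add, mul_add]
    | monomial n x =>
      rw [sub_mul, map_sub, C_mul_monomial, X_pow_mul_monomial, DiffOp.inclBase_monomial,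
        DiffOp.inclBase_monomial, DiffOp.inclBase_monomial, hP, sub_mul, C_mul_monomial,
        X_pow_mul_monomial]

/-- Periodicity of the eigenvalues modulo p^e says that θ commutes with t^(p^e). -/
theorem actionBf_inclLine {θ : binomialAlgebra k p} {e : ℕ}
    (hθ : ∀ n, eigenvalue (n + p ^ e) θ = eigenvalue n θ) (r : ℕ → R) :
    actionBf k f (DiffOp.inclLine k R θ) (fromComponents k f (p ^ e) r) =
      fromComponents k f (p ^ e) fun a => eigenvalue (p ^ e - 1 - a) θ • r a := by
  rw [fromComponents, actionBf_polarPart, fromComponents, map_sum]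
  · congr 1
    exact Finset.sum_congr rfl fun a _ => toEnd_inclLine_monomial _ _ _
  · intro g
    rw [C_sub_X_pow]
    induction g using Polynomial.induction_on' with
    | add g h hg hh => rw [mul_add, map_add, hg, hh, map_add, mul_add]
    | monomial n x =>
      rw [sub_mul, map_sub, C_mul_monomial, X_pow_mul_monomial, toEnd_inclLine_monomial,
        toEnd_inclLine_monomial, toEnd_inclLine_monomial, hθ, sub_mul, C_mul_monomial,
        X_pow_mul_monomial, mul_smul_comm]

/-- Multiplication by `t` shifts the components. -/
theorem actionBf_mulBy_X (e : ℕ) (r : ℕ → R) :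
    actionBf k f (DiffOp.mulBy k (X : R[X])) (fromComponents k f (p ^ e) r) =
      fromComponents k f (p ^ e) fun a =>
        if a + 1 < p ^ e then r (a + 1) else f ^ p ^ e * r 0 := by
  have hX : ∀ g : R[X], DiffOp.toEnd k R[X] (DiffOp.mulBy k (X : R[X])) g = X * g := fun _ => rfl
  rw [fromComponents, actionBf_polarPart fun g => by rw [hX, hX, mul_left_comm], fromComponents,
    hX, ← sub_eq_zero, ← map_sub, polarPart_eq_zero, C_sub_X_pow]
  obtain ⟨N, hN⟩ : ∃ N, p ^ e = N + 1 :=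
    Nat.exists_eq_succ_of_ne_zero (pow_pos (Fact.out : p.Prime).pos e).ne'
  rw [hN, Finset.sum_range_succ', Finset.sum_range_succ (n := N) (f := fun a => monomial _ _)]
  -- Only the top term r_0 t^(p^e) overflows; replacing t^(p^e) by f^(p^e) costs -r_0 times the
  -- denominator.
  refine ⟨-C (r 0), ?_⟩
  rw [if_neg (lt_irrefl _), mul_add, Finset.mul_sum, Finset.sum_congr rfl
    (g := fun a => monomial (N + 1 - 1 - a) (if a + 1 < N + 1 then r (a + 1) else _))]
  · rw [add_sub_add_left_eq_sub, X_mul_monomial]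
    simp only [add_tsub_cancel_right, tsub_self, tsub_zero, monomial_zero_left, C_mul]
    rw [← C_mul_X_pow_eq_monomial]
    ring
  · intro a ha
    have := Finset.mem_range.1 ha
    rw [X_mul_monomial, if_pos (by omega)]
    congr 2
    omega

/-- The geometric sum ∑ f^a t^(p^e - 1 - a) times f - t is f^(p^e) - t^(p^e) = (f - t)^(p^e). -/
theorem deltaBf_eq_fromComponents (e : ℕ) :
    deltaBf k f = fromComponents k f (p ^ e) fun a => f ^ a := by
  have h1 : deltaBf k f = polarPart k f 1 1 := by
    have : graphDenominator f 1 = ⟨C f - X, Submonoid.mem_powers _⟩ := Subtype.ext (pow_one _)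
    rw [polarPart_apply, map_one, mul_one, deltaBf, this]
  have h2 : (∑ a ∈ Finset.range (p ^ e), monomial (p ^ e - 1 - a) (f ^ a) : R[X]) * (C f - X) =
      (C f - X) ^ p ^ e := by
    rw [C_sub_X_pow, C_pow, ← geom_sum₂_mul]
    congr 1
    exact Finset.sum_congr rfl fun a _ => by rw [← C_mul_X_pow_eq_monomial, C_pow]
  have h3 := algebraMap_mul_mk'_graphDenominator f 1
  have h4 := algebraMap_mul_mk'_graphDenominator f (p ^ e)
  rw [h1, fromComponents, polarPart_apply, polarPart_apply, map_one, mul_one]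
  congr 1
  rw [← h2, map_mul] at h4
  rw [pow_one] at h3
  linear_combination (exp := 1) IsLocalization.mk' (GraphLocalization f) (1 : R[X])
    (graphDenominator f 1) * h4.symm + IsLocalization.mk' (GraphLocalization f) (1 : R[X])
    (graphDenominator f (p ^ e)) * algebraMap R[X] (GraphLocalization f)
      (∑ a ∈ Finset.range (p ^ e), monomial (p ^ e - 1 - a) (f ^ a)) * h3

end GraphModule

/-! ### Components of M_f and t M_f; the b-function on affine opens -/

section AffineBFunction

variable {k : Type u} [Field k] {R : Type*} [CommRing R] [Algebra k R] {f : R} {p : ℕ}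

theorem mem_Mf {m : Bf k f} :
    m ∈ Mf k p f ↔ ∃ Q ∈ baseEulerOps k R p, actionBf k f Q (deltaBf k f) = m :=
  Iff.rfl

theorem IsLevel.mem_levelIdeal {q : ℕ} {P : Module.End k R} (hP : IsLevel q P) {g x : R}
    (hx : x ∈ levelIdeal k q g) : P x ∈ levelIdeal k q g := by
  obtain ⟨Q, hQ, rfl⟩ := hx
  exact ⟨P * Q, hP.mul hQ, rfl⟩

theorem smul_mem_levelIdeal {q : ℕ} {g x : R} (c : k) (hx : x ∈ levelIdeal k q g) :
    c • x ∈ levelIdeal k q g := by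
  rw [Algebra.smul_def]
  exact Ideal.mul_mem_left _ _ hx

variable [Fact p.Prime] [CharP k p] [CharP R p]

/-- The components of the elements of `M_f` with respect to high powers of the denominator. -/
theorem exists_fromComponents_of_mem_Mf {m : Bf k f} (hm : m ∈ Mf k p f) :
    ∃ e₀, ∀ e ≥ e₀, ∃ r : ℕ → R, (∀ a < p ^ e, r a ∈ levelIdeal k (p ^ e) (f ^ a)) ∧
      fromComponents k f (p ^ e) r = m := by
  -- The condition is required for all large e because a differential operator, or ν_i, respects the
  -- denominator only from some level on.
  set G : Bf k f → Prop := fun m => ∃ e₀, ∀ e ≥ e₀, ∃ r : ℕ → R,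
    (∀ a < p ^ e, r a ∈ levelIdeal k (p ^ e) (f ^ a)) ∧ fromComponents k f (p ^ e) r = m with hG
  have hp : p.Prime := Fact.out
  have hbase : ∀ (P : DiffOp k R) m, G m → G (actionBf k f (DiffOp.inclBase k R P) m) := by
    rintro P m ⟨e₀, h⟩
    obtain ⟨n, hn⟩ := P.exists_order
    refine ⟨max e₀ n, fun e he => ?_⟩
    obtain ⟨r, hr, rfl⟩ := h e (le_of_max_le_left he)
    have hP : IsLevel (p ^ e) (DiffOp.toEnd k R P) := isLevel_of_mem_diffOpFiltration hn
      ((le_of_max_le_right he).trans (Nat.lt_pow_self hp.one_lt).le)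
    exact ⟨_, fun a ha => hP.mem_levelIdeal (hr a ha), (actionBf_inclBase hP r).symm⟩
  obtain ⟨Q, hQ, rfl⟩ := mem_Mf.1 hm
  suffices h : ∀ m, G m → G (actionBf k f Q m) from
    h _ ⟨0, fun e _ => ⟨_, fun a _ => self_mem_levelIdeal _ _,
      (deltaBf_eq_fromComponents e).symm⟩⟩
  clear hm
  induction hQ using Algebra.adjoin_induction with
  | mem Q hQ =>
    rcases hQ with ⟨P, rfl⟩ | ⟨i, rfl⟩
    · exact hbase P
    · rintro m ⟨e₀, h⟩
      refine ⟨max e₀ (i + 1), fun e he => ?_⟩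
      obtain ⟨r, hr, rfl⟩ := h e (le_of_max_le_left he)
      have hi : eulerOp k p i = ((-binomialCoeff k p i : binomialAlgebra k p) : DiffOp k k[X]) := by
        rw [binomialCoeff, neg_neg]
      refine ⟨_, fun a ha => ?_, Eq.trans (actionBf_inclLine (θ := -binomialCoeff k p i) ?_ r).symm
        (by rw [← hi])⟩
      · exact smul_mem_levelIdeal _ (hr a ha)
      · intro n
        rw [← eigenvalueHom_apply, ← eigenvalueHom_apply, map_neg, map_neg, eigenvalueHom_apply,
          eigenvalueHom_apply, eigenvalue_binomialCoeff_add (le_of_max_le_right he)]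
  | algebraMap c =>
    intro m hm
    rw [← AlgHom.commutes (DiffOp.inclBase k R)]
    exact hbase _ m hm
  | add Q Q' _ _ hQ hQ' =>
    intro m hm
    obtain ⟨e₀, h⟩ := hQ m hm
    obtain ⟨e₁, h'⟩ := hQ' m hm
    refine ⟨max e₀ e₁, fun e he => ?_⟩
    obtain ⟨r, hr, h1⟩ := h e (le_of_max_le_left he)
    obtain ⟨r', hr', h2⟩ := h' e (le_of_max_le_right he)
    exact ⟨r + r', fun a ha => add_mem (hr a ha) (hr' a ha), by
      rw [← fromComponents_add, h1, h2, map_add, LinearMap.add_apply]⟩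
  | mul Q Q' _ _ hQ hQ' =>
    intro m hm
    rw [map_mul, Module.End.mul_apply]
    exact hQ _ (hQ' _ hm)

theorem actionBf_digitProjector_delta {e e' : ℕ} (h : e ≤ e') (a : ℕ) :
    actionBf k f (DiffOp.inclLine k R (digitProjector k p e a)) (deltaBf k f) =
      fromComponents k f (p ^ e') fun b => if b ≡ a [MOD p ^ e] then f ^ b else 0 := by
  rw [deltaBf_eq_fromComponents (p := p) e',
    actionBf_inclLine (eigenvalue_digitProjector_add h a)]
  refine fromComponents_congr fun b hb => ?_
  rw [eigenvalue_digitProjector_of_lt h hb]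
  split_ifs
  · rw [one_smul]
  · rw [zero_smul]

/-- The projector for a at level e isolates the component f^a of δ, and any operator of level p^e
can then be applied to it separately. -/
theorem fromComponents_mem_Mf [Algebra.FiniteType k R] {e : ℕ} {r : ℕ → R}
    (hr : ∀ a < p ^ e, r a ∈ levelIdeal k (p ^ e) (f ^ a)) :
    fromComponents k f (p ^ e) r ∈ Mf k p f := by
  rw [fromComponents_eq_sum]
  refine sum_mem fun a ha => ?_
  have ha := Finset.mem_range.1 ha
  obtain ⟨P, hP, hPa⟩ := hr a ha
  refine mem_Mf.2 ⟨DiffOp.inclBase k R (DiffOp.mk P hP.exists_mem_diffOpFiltration) *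
    DiffOp.inclLine k R (digitProjector k p e a),
    mul_mem (Algebra.subset_adjoin (Or.inl ⟨_, rfl⟩)) (inclLine_mem_baseEulerOps k R p _), ?_⟩
  rw [map_mul, Module.End.mul_apply, actionBf_digitProjector_delta le_rfl, actionBf_inclBase hP]
  refine fromComponents_congr fun b hb => ?_
  rw [DiffOp.toEnd_mk]
  by_cases hab : b = a
  · subst hab
    rw [if_pos (Nat.ModEq.refl b), Pi.single_eq_same, hPa]
  · rw [if_neg fun h => hab (Nat.ModEq.eq_of_lt_of_lt h hb ha), Pi.single_eq_of_ne hab, map_zero]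

theorem fromComponents_mem_tMf [Algebra.FiniteType k R] {e : ℕ} {r : ℕ → R}
    (hr : ∀ a < p ^ e, r a ∈ levelIdeal k (p ^ e) (f ^ (a + 1))) :
    fromComponents k f (p ^ e) r ∈ tMf k p f := by
  have hq : 0 < p ^ e := pow_pos (Fact.out : p.Prime).pos e
  obtain ⟨P, hP, hPr⟩ := hr (p ^ e - 1) (by omega)
  rw [Nat.sub_add_cancel hq] at hPr
  -- The last component is P(f^(p^e)) = f^(p^e) P(1), so the value P(1) in position 0 produces it
  -- under the wrap-around of t; the other components are shifted by one.
  refine ⟨_, fromComponents_mem_Mf (r := fun a => if a = 0 then P 1 else r (a - 1)) ?_,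
    (actionBf_mulBy_X e _).trans (fromComponents_congr fun a ha => ?_)⟩
  · intro a ha
    rcases Nat.eq_zero_or_pos a with rfl | h0
    · exact ⟨P, hP, by rw [pow_zero, if_pos rfl]⟩
    · rw [if_neg h0.ne']
      have := hr (a - 1) (by omega)
      rwa [Nat.sub_add_cancel h0] at this
  · simp only [a.succ_ne_zero, if_false, if_true, Nat.add_sub_cancel]
    split_ifs with h
    · rfl
    · rw [← hP, mul_one, hPr]
      congr 1
      omega

/-- The projector keeps only components b ≡ a modulo p^e. The equality at (e, a) propagates to each
such b and moves that component from the level ideal of f^b into that of f^(b+1). -/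
theorem digitProjector_mem_affineBFunction [Algebra.FiniteType k R] {e a : ℕ}
    (h : LevelEq k p f e a) (ha : a < p ^ e) : digitProjector k p e a ∈ affineBFunction k p f := by
  intro m hm
  obtain ⟨e₀, hm⟩ := exists_fromComponents_of_mem_Mf hm
  obtain ⟨r, hr, rfl⟩ := hm (max e₀ e) (le_max_left _ _)
  obtain ⟨i, hi⟩ := Nat.exists_eq_add_of_le (le_max_right e₀ e)
  rw [actionBf_inclLine (eigenvalue_digitProjector_add (le_max_right e₀ e) a)]
  refine fromComponents_mem_tMf fun b hb => ?_
  rw [eigenvalue_digitProjector_of_lt (le_max_right e₀ e) hb]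
  split_ifs with hba
  · rw [one_smul]
    refine levelIdeal_le_of_mem ?_ (hr b hb)
    have h1 := h.add i (b / p ^ e)
    have h2 : a + b / p ^ e * p ^ e = b := by
      rw [← Nat.mod_eq_of_lt ha, ← (show b % p ^ e = a % p ^ e from hba), mul_comm]
      exact Nat.mod_add_div b _
    rwa [h2, ← hi] at h1
  · rw [zero_smul]
    exact zero_mem _

/-- The projector applied to δ has the components f^b for b ≡ a; comparing them with those of an
element of t M_f puts f^b in the level ideal of f^(b+1). -/
theorem exists_levelEq_of_digitProjector_mem {e a : ℕ}
    (h : digitProjector k p e a ∈ affineBFunction k p f) :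
    ∃ e' ≥ e, ∀ b < p ^ e', b ≡ a [MOD p ^ e] → LevelEq k p f e' b := by
  obtain ⟨m, hm, hmt⟩ := h (deltaBf k f) (mem_Mf.2 ⟨1, one_mem _, by rw [map_one]; rfl⟩)
  obtain ⟨e₀, hm⟩ := exists_fromComponents_of_mem_Mf hm
  obtain ⟨r, hr, rfl⟩ := hm (max e₀ e) (le_max_left _ _)
  refine ⟨max e₀ e, le_max_right _ _, fun b hb hba => ?_⟩
  rw [actionBf_digitProjector_delta (le_max_right e₀ e), actionBf_mulBy_X] at hmt
  have h1 := fromComponents_injective hmt hb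
  rw [if_pos hba] at h1
  rw [LevelEq, ← h1]
  split_ifs with h2
  · exact hr _ h2
  -- At the wrap-around b + 1 is the full modulus, and f^(b+1) r_0 lies in the level ideal of
  -- f^(b+1) because operators of this level commute with that power of f.
  · have h3 : b + 1 = p ^ max e₀ e := by omega
    have h4 := pow_mul_mem_levelIdeal f (hr 0 (by omega))
    rw [pow_zero, mul_one] at h4
    rwa [h3]

end AffineBFunction

/-! ### Extending operators to localizations and clearing denominators -/

section Localization

variable {k : Type u} [Field k] {R S : Type*} [CommRing R] [CommRing S] [Algebra k R]
  [Algebra k S] [Algebra R S] [IsScalarTower k R S]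

/-- An operator of level p^e is a differential operator and extends to S. By uniqueness the
extension commutes with p^e-th powers from R, hence with those of fractions. -/
theorem LevelEq.map_of_isLocalization {p : ℕ} [Fact p.Prime] [CharP k p] [Algebra.FiniteType k R]
    (M : Submonoid R) (hM : M ≤ nonZeroDivisors R) [IsLocalization M S] {f : R} {e a : ℕ}
    (h : LevelEq k p f e a) : LevelEq k p (algebraMap R S f) e a := by
  obtain ⟨P, hP, hPf⟩ := h
  obtain ⟨n, hn⟩ := hP.exists_mem_diffOpFiltration
  obtain ⟨Q, hQ, hQP⟩ := exists_extension M hM S hn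
  have hb : ∀ (r : R) x, Q (algebraMap R S r ^ p ^ e * x) = algebraMap R S r ^ p ^ e * Q x := by
    intro r
    rw [← bracket_eq_zero_iff]
    refine ext_of_localization M (diffOpFiltration_le_succ n hQ _) fun y => ?_
    rw [bracket_apply, ← map_pow, ← map_mul, hQP, hQP, hP, map_mul, sub_self]
  refine ⟨Q, fun s x => ?_, ?_⟩
  · obtain ⟨r, m, rfl⟩ := IsLocalization.exists_mk'_eq M s
    have hs := IsLocalization.mk'_spec' S r m
    refine ((IsLocalization.map_units S m).pow (p ^ e)).mul_right_injective ?_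
    change _ * _ = _ * _
    rw [← hb, ← mul_assoc, ← mul_pow, hs, hb, ← mul_assoc, ← mul_pow, hs]
  · rw [← map_pow, hQP, hPf, map_pow]

/-- A differential operator of a localization at the powers of `g` has bounded denominators on
the base. -/
theorem exists_pow_mul_eq_algebraMap [Algebra.FiniteType k R] (g : R) [IsLocalization.Away g S]
    {n : ℕ} {P : Module.End k S} (hP : P ∈ diffOpFiltration k S n) :
    ∃ N, ∀ m ≥ N, ∀ x : R, ∃ y : R, algebraMap R S g ^ m * P (algebraMap R S x) = algebraMap R S y := by
  induction n generalizing P with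
  | zero =>
    rw [mem_diffOpFiltration_zero.1 hP]
    exact ⟨0, fun m _ x => ⟨0, by rw [LinearMap.zero_apply, mul_zero, map_zero]⟩⟩
  | succ n ih =>
    obtain ⟨s, hs⟩ := (inferInstance : Algebra.FiniteType k R).out
    choose N hN using fun x : R => ih (hP (algebraMap R S x))
    obtain ⟨⟨y, ⟨_, M, rfl⟩⟩, hy⟩ := IsLocalization.surj (Submonoid.powers g) (P 1)
    refine ⟨max M (s.sup N), fun m hm => ?_⟩
    set T : Submodule k R := Submodule.comap
      ((Algebra.lmul k S (algebraMap R S g ^ m)) ∘ₗ P ∘ₗ (IsScalarTower.toAlgHom k R S).toLinearMap)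
      (LinearMap.range (IsScalarTower.toAlgHom k R S).toLinearMap) with hT
    have hmem : ∀ x, x ∈ T ↔ ∃ y : R, algebraMap R S y =
        algebraMap R S g ^ m * P (algebraMap R S x) := fun x => Iff.rfl
    have h1 : (1 : R) ∈ T := by
      obtain ⟨i, rfl⟩ := Nat.exists_eq_add_of_le (le_of_max_le_left hm)
      refine (hmem 1).2 ⟨g ^ i * y, ?_⟩
      change P 1 * algebraMap R S (g ^ M) = algebraMap R S y at hy
      rw [map_mul, ← hy, map_one (algebraMap R S), map_pow, map_pow]
      ring
    -- The commutators with the finitely many algebra generators have smaller order, so one exponent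
    -- m clears their denominators; clearing that of P(1) then suffices for all of R.
    have hmul : ∀ x : R, ∀ z ∈ T, x * z ∈ T := by
      intro x
      have hx : x ∈ Algebra.adjoin k (s : Set R) := hs ▸ Algebra.mem_top
      induction hx using Algebra.adjoin_induction with
      | mem x hx =>
        intro z hz
        obtain ⟨y, hy⟩ := (hmem z).1 hz
        obtain ⟨y', hy'⟩ := hN x m ((Finset.le_sup (f := N) hx).trans (le_of_max_le_right hm)) z
        refine (hmem _).2 ⟨x * y + y', ?_⟩
        rw [bracket_apply] at hy'
        rw [map_add, map_mul, hy, ← hy', map_mul (algebraMap R S) x z]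
        ring
      | algebraMap c =>
        intro z hz
        rw [← Algebra.smul_def]
        exact T.smul_mem c hz
      | add x y _ _ hx hy =>
        intro z hz
        rw [add_mul]
        exact add_mem (hx z hz) (hy z hz)
      | mul x y _ _ hx hy =>
        intro z hz
        rw [mul_assoc]
        exact hx _ (hy z hz)
    intro x
    obtain ⟨y, hy⟩ := (hmem _).1 (hmul x 1 h1)
    rw [mul_one] at hy
    exact ⟨y, hy.symm⟩

/-- A sufficiently high power g^N makes g^N P map R into R, and multiplication by g^N does not
change the level. -/
theorem exists_pow_mul_mem_levelIdeal {p : ℕ} [Fact p.Prime] [CharP k p] [Algebra.FiniteType k R]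
    [Algebra.FiniteType k S] {g : R} (hg : Submonoid.powers g ≤ nonZeroDivisors R)
    [IsLocalization.Away g S] {f : R} {e a : ℕ} (h : LevelEq k p (algebraMap R S f) e a) :
    ∃ N, g ^ N * f ^ a ∈ levelIdeal k (p ^ e) (f ^ (a + 1)) := by
  have hinj : Function.Injective (algebraMap R S) := IsLocalization.injective S hg
  obtain ⟨P, hP, hPf⟩ := h
  obtain ⟨n, hn⟩ := hP.exists_mem_diffOpFiltration
  obtain ⟨N, hN⟩ := exists_pow_mul_eq_algebraMap g hn
  choose Q hQ using hN N le_rfl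
  refine ⟨N, { toFun := Q, map_add' := fun x y => hinj ?_, map_smul' := fun c x => hinj ?_ },
    fun r x => hinj ?_, hinj ?_⟩
  · rw [← hQ, map_add, map_add, map_add, mul_add, hQ, hQ]
  · rw [← hQ, RingHom.id_apply, Algebra.smul_def c (Q x), map_mul, ← hQ, Algebra.smul_def, map_mul,
      ← IsScalarTower.algebraMap_apply, ← Algebra.smul_def, map_smul, Algebra.smul_def]
    ring
  · change algebraMap R S (Q _) = algebraMap R S (_ * Q _)
    rw [← hQ, map_mul, map_pow, hP, map_mul, ← hQ, map_pow]
    ring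
  · change algebraMap R S (Q _) = _
    rw [← hQ, map_pow, hPf, map_mul, map_pow, map_pow]

end Localization

/-! ### The absence of jumps as a local condition on X -/

section LevelEqOn

open CategoryTheory

variable {k : Type u} [Field k] {X : Scheme.{u}} (π : X ⟶ Spec (CommRingCat.of k))

theorem smooth_structureMap [AlgebraicGeometry.Smooth π] (U : X.affineOpens) :
    (structureMap π U).Smooth :=
  (RingHom.Smooth.propertyIsLocal.respectsIso.2 _
    (Scheme.ΓSpecIso (CommRingCat.of k)).symm.commRingCatIsoToRingEquiv
    (Scheme.Hom.smooth_appLE π (isAffineOpen_top (Spec (CommRingCat.of k))) U.2 le_top))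

theorem map_comp_structureMap {U V : X.Opens} (h : V ≤ U) :
    (X.presheaf.map (homOfLE h).op).hom.comp (structureMap π U) = structureMap π V := by
  have h1 : π.appLE ⊤ U le_top ≫ X.presheaf.map (homOfLE h).op = π.appLE ⊤ V le_top :=
    Scheme.Hom.appLE_map _ _ _
  exact congrArg (fun φ : Γ(Spec (CommRingCat.of k), ⊤) ⟶ Γ(X, V) =>
    φ.hom.comp (Scheme.ΓSpecIso (CommRingCat.of k)).inv.hom) h1

theorem map_restrictFun (f : Γ(X, ⊤)) {U V : X.Opens} (h : V ≤ U) :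
    X.presheaf.map (homOfLE h).op (restrictFun f U) = restrictFun f V := by
  change ((X.presheaf.map (homOfLE le_top).op) ≫ (X.presheaf.map (homOfLE h).op)).hom f = _
  rw [← Functor.map_comp]
  rfl

/-- `LevelEq` for the restriction of a global function to an affine open subset. -/
def LevelEqOn (p : ℕ) (f : Γ(X, ⊤)) (e a : ℕ) (U : X.affineOpens) : Prop :=
  letI := (structureMap π U).toAlgebra
  LevelEq k p (restrictFun f U) e a

theorem LevelEq.of_subsingleton {R : Type*} [CommRing R] [Algebra k R] [Subsingleton R] {p : ℕ}
    {f : R} {e a : ℕ} : LevelEq k p f e a := by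
  rw [LevelEq, Subsingleton.elim (f ^ a) (f ^ (a + 1))]
  exact self_mem_levelIdeal _ _

variable {π}

theorem subsingleton_of_not_nonempty {U : X.Opens} (h : ¬ Nonempty U) : Subsingleton Γ(X, U) := by
  have : U = ⊥ := by
    ext x
    exact ⟨fun hx => (h ⟨⟨x, hx⟩⟩).elim, fun hx => hx.elim⟩
  subst this
  infer_instance

variable {p : ℕ} {f : Γ(X, ⊤)} {e a : ℕ}

theorem LevelEqOn.of_subsingleton {U : X.affineOpens} [Subsingleton Γ(X, U)] :
    LevelEqOn π p f e a U :=
  letI := (structureMap π U).toAlgebra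
  LevelEq.of_subsingleton

theorem LevelEqOn.residue_mono [Fact p.Prime] {α : ℤ_[p]} {U : X.affineOpens}
    (h : LevelEqOn π p f e (residue α e) U) {e' : ℕ} (he : e ≤ e') :
    LevelEqOn π p f e' (residue α e') U := by
  obtain ⟨i, rfl⟩ := Nat.exists_eq_add_of_le he
  let := (structureMap π U).toAlgebra
  have h1 := LevelEq.add (f := restrictFun f U) h i (residue α (e + i) / p ^ e)
  have h2 : residue α e + residue α (e + i) / p ^ e * p ^ e = residue α (e + i) := by
    rw [← residue_mod α he, mul_comm]
    exact Nat.mod_add_div _ _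
  rwa [h2] at h1

variable [Fact p.Prime] [CharP k p] [AlgebraicGeometry.IsIntegral X] [AlgebraicGeometry.Smooth π]

theorem powers_le_nonZeroDivisors_of_nonempty {U : X.Opens} (g : Γ(X, U))
    (h : Nonempty (X.basicOpen g)) : Submonoid.powers g ≤ nonZeroDivisors Γ(X, U) := by
  obtain ⟨x, hx⟩ := h
  have : Nonempty U := ⟨⟨x, X.basicOpen_le g hx⟩⟩
  refine Submonoid.powers_le.2 (mem_nonZeroDivisors_of_ne_zero ?_)
  rintro rfl
  rw [Scheme.basicOpen_zero] at hx
  exact hx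

theorem LevelEqOn.basicOpen {U : X.affineOpens} (h : LevelEqOn π p f e a U) (g : Γ(X, U)) :
    LevelEqOn π p f e a (X.affineBasicOpen g) := by
  by_cases hne : Nonempty (X.basicOpen g)
  · let := (structureMap π U).toAlgebra
    let := (structureMap π (X.basicOpen g)).toAlgebra
    have : IsLocalization.Away g Γ(X, X.basicOpen g) := U.2.isLocalization_basicOpen g
    have : IsScalarTower k Γ(X, U) Γ(X, X.basicOpen g) :=
      IsScalarTower.of_algebraMap_eq' (map_comp_structureMap π (X.basicOpen_le g)).symm
    have : Algebra.Smooth k Γ(X, U) := smooth_structureMap π U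
    have h1 := LevelEq.map_of_isLocalization (S := Γ(X, X.basicOpen g)) _
      (powers_le_nonZeroDivisors_of_nonempty g hne) h
    have h2 : algebraMap Γ(X, U) Γ(X, X.basicOpen g) (restrictFun f U) =
        restrictFun f (X.basicOpen g) := map_restrictFun f (X.basicOpen_le g)
    rw [h2] at h1
    exact h1
  · have : Subsingleton Γ(X, X.affineBasicOpen g) := subsingleton_of_not_nonempty hne
    exact .of_subsingleton

/-- The elements that multiply f^a into the level ideal of f^(a+1) form an ideal, which contains
powers of all g in s and is therefore the unit ideal. -/
theorem LevelEqOn.of_span {U : X.affineOpens} {s : Set Γ(X, U)} (hs : Ideal.span s = ⊤)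
    (h : ∀ g ∈ s, LevelEqOn π p f e a (X.affineBasicOpen g)) : LevelEqOn π p f e a U := by
  let := (structureMap π U).toAlgebra
  have : Algebra.Smooth k Γ(X, U) := smooth_structureMap π U
  refine Submodule.mem_of_span_eq_top_of_smul_pow_mem _ s hs _ fun g => ?_
  by_cases hne : Nonempty (X.basicOpen g.1)
  · let := (structureMap π (X.basicOpen g.1)).toAlgebra
    have : IsLocalization.Away g.1 Γ(X, X.basicOpen g.1) := U.2.isLocalization_basicOpen g.1
    have : IsScalarTower k Γ(X, U) Γ(X, X.basicOpen g.1) :=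
      IsScalarTower.of_algebraMap_eq' (map_comp_structureMap π (X.basicOpen_le g.1)).symm
    have : Algebra.Smooth k Γ(X, X.basicOpen g.1) := smooth_structureMap π (X.affineBasicOpen g.1)
    refine exists_pow_mul_mem_levelIdeal (S := Γ(X, X.basicOpen g.1))
      (powers_le_nonZeroDivisors_of_nonempty g.1 hne) ?_
    have h2 : algebraMap Γ(X, U) Γ(X, X.basicOpen g.1) (restrictFun f U) =
        restrictFun f (X.basicOpen g.1) := map_restrictFun f (X.basicOpen_le g.1)
    rw [h2]
    exact h g.1 g.2
  · have hg : IsNilpotent g.1 := by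
      have : X.basicOpen g.1 = ⊥ := by
        ext x
        exact ⟨fun hx => (hne ⟨⟨x, hx⟩⟩).elim, fun hx => hx.elim⟩
      rw [(basicOpen_eq_bot_iff g.1).1 this]
      exact .zero
    obtain ⟨n, hn⟩ := hg
    exact ⟨n, by rw [hn, zero_smul]; exact zero_mem _⟩

theorem LevelEqOn.of_cover {ι : Type*} {U : ι → X.affineOpens} (hU : (⨆ i, U i : X.Opens) = ⊤)
    (h : ∀ i, LevelEqOn π p f e a (U i)) (V : X.affineOpens) : LevelEqOn π p f e a V :=
  of_affine_open_cover U hU V (fun _ g hg => hg.basicOpen g)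
    (fun _ _ hs hg => .of_span hs fun g hgs => hg ⟨g, hgs⟩) h

/-- By quasi-compactness, a level which works locally can be chosen uniformly. -/
theorem exists_levelEqOn_of_forall_exists [CompactSpace X] {α : ℤ_[p]}
    (h : ∀ U : X.affineOpens, ∃ e, LevelEqOn π p f e (residue α e) U) :
    ∃ e, ∀ U : X.affineOpens, LevelEqOn π p f e (residue α e) U := by
  choose E hE using h
  let U : X.affineCover.finiteSubcover.I₀ → X.affineOpens := fun i =>
    ⟨(X.affineCover.finiteSubcover.f i).opensRange, isAffineOpen_opensRange _⟩
  refine ⟨Finset.univ.sup fun i => E (U i), fun V => LevelEqOn.of_cover (U := U) ?_ (fun i => ?_) V⟩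
  · exact Scheme.OpenCover.iSup_opensRange _
  · exact (hE (U i)).residue_mono (Finset.le_sup (f := fun i => E (U i)) (Finset.mem_univ i))

end LevelEqOn

/-! ### Frobenius roots of powers of f -/

section TestIdeals

variable {p : ℕ} {R : Type*} [CommRing R] {f : R}

theorem frobeniusRoot_antitone (e : ℕ) (f : R) : Antitone (frobeniusRoot p e f) := by
  intro m m' h
  refine le_sInf fun J hJ => sInf_le ?_
  obtain ⟨i, rfl⟩ := Nat.exists_eq_add_of_le h
  change f ^ (m + i) ∈ frobeniusPower p e J
  rw [pow_add]
  exact Ideal.mul_mem_right _ _ hJ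

theorem affineTestIdeal_antitone (f : R) : Antitone (affineTestIdeal p f) := by
  intro c c' h
  refine iSup_mono fun e => frobeniusRoot_antitone e f (Nat.ceil_mono ?_)
  gcongr

/-- An operator taking f^(a+1) to f^a preserves every p^e-th Frobenius power J^[p^e], so f^(a+1) ∈
J^[p^e] implies f^a ∈ J^[p^e]. -/
theorem LevelEq.frobeniusRoot_le {k : Type u} [Field k] [Algebra k R] {e a : ℕ}
    (h : LevelEq k p f e a) : frobeniusRoot p e f a ≤ frobeniusRoot p e f (a + 1) := by
  obtain ⟨P, hP, hPf⟩ := h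
  refine le_sInf fun J hJ => sInf_le ?_
  change f ^ a ∈ frobeniusPower p e J
  rw [← hPf]
  exact hP.mem_frobeniusPower hJ

variable [Fact p.Prime] [CharP R p]

theorem frobeniusRoot_add_le {e i m m' : ℕ} (h : m * p ^ i ≤ m') :
    frobeniusRoot p (e + i) f m' ≤ frobeniusRoot p e f m := by
  refine (frobeniusRoot_antitone (e + i) f h).trans (le_sInf fun J hJ => sInf_le ?_)
  change f ^ (m * p ^ i) ∈ frobeniusPower p (e + i) J
  rw [pow_mul, add_comm]
  exact pow_mem_frobeniusPower_add i e hJ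

/-- By flatness of Frobenius, f^(m p^i) ∈ J^[p^(e+i)] already implies f^m ∈ J^[p^e]. This makes the
defining sequence of a test ideal increasing. -/
theorem frobeniusRoot_le_add (k : Type u) [Field k] [CharP k p] [Algebra k R] [Algebra.Smooth k R]
    {e i m m' : ℕ} (h : m' ≤ m * p ^ i) :
    frobeniusRoot p e f m ≤ frobeniusRoot p (e + i) f m' := by
  refine le_trans (le_sInf fun J hJ => sInf_le ?_)
    (frobeniusRoot_antitone (e + i) f h)
  obtain ⟨ι, ψ, hψ⟩ := exists_isFrobeniusDual k p R i
  change f ^ (m * p ^ i) ∈ frobeniusPower p (e + i) J at hJ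
  rw [pow_mul, add_comm, ← frobeniusPower_frobeniusPower] at hJ
  exact hψ.mem_of_pow_mem (Fact.out : p.Prime).pos hJ

end TestIdeals

/-! ### Test ideals at exponents C/(p^d - 1) -/

section PeriodicExponents

variable {q C : ℕ} {c : ℝ}

theorem cast_repeatDigit (hq : 1 < q) (hc : (C : ℝ) = c * (q - 1)) (j : ℕ) :
    (repeatDigit q C j : ℝ) = c * q ^ j - c := by
  have h := congrArg (Nat.cast (R := ℝ)) (repeatDigit_mul q C j)
  push_cast at h
  have h1 : (0 : ℝ) < q - 1 := sub_pos.2 (by exact_mod_cast hq)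
  have h2 : ((q : ℝ) - 1) * repeatDigit q C j = (q - 1) * (c * q ^ j - c) := by
    rw [hc] at h
    linear_combination h
  exact mul_left_cancel₀ h1.ne' h2

/-- With c = C/(q - 1) the repeated-digit number is c q^j - c, and 0 < c ≤ 1 makes its successor the
ceiling of c q^j. The value c = 1 is allowed and c = 0 is not. -/
theorem ceil_mul_pow (hq : 1 < q) (hc : (C : ℝ) = c * (q - 1)) (h0 : 0 < c) (h1 : c ≤ 1) (j : ℕ) :
    ⌈c * (q : ℝ) ^ j⌉₊ = repeatDigit q C j + 1 := by
  have h := cast_repeatDigit hq hc j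
  rw [Nat.ceil_eq_iff (Nat.succ_ne_zero _)]
  rw [Nat.succ_sub_one, Nat.succ_eq_add_one]
  push_cast
  constructor <;> linarith

variable {p : ℕ} [Fact p.Prime] {R : Type*} [CommRing R] {f : R} [CharP R p] {d : ℕ}
  (k : Type u) [Field k] [CharP k p] [Algebra k R] [Algebra.Smooth k R]

/-- The exponent b = c - c/p^(dj) is chosen so that b p^(dj) is the integer r_j. Then every root
defining τ(f^b) is contained in the root of f^(r_j), which the absence of a jump puts in that of
f^(r_j + 1), a term of τ(f^c). -/
theorem affineTestIdeal_sub_eq (hd : 0 < d) (hc : (C : ℝ) = c * ((p ^ d : ℕ) - 1)) (h0 : 0 < c)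
    (h1 : c ≤ 1) {j : ℕ} (h : LevelEq k p f (d * j) (repeatDigit (p ^ d) C j)) :
    affineTestIdeal p f (c - c / (p : ℝ) ^ (d * j)) = affineTestIdeal p f c := by
  have hp : p.Prime := Fact.out
  have hq : 1 < p ^ d := Nat.one_lt_pow hd.ne' hp.one_lt
  have hpos : ∀ i, (0 : ℝ) < (p : ℝ) ^ i := fun i => pow_pos (by exact_mod_cast hp.pos) i
  have hm := cast_repeatDigit hq hc j
  rw [Nat.cast_pow, ← pow_mul] at hm
  have hm' : (repeatDigit (p ^ d) C j : ℝ) =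
      (c - c / (p : ℝ) ^ (d * j)) * (p : ℝ) ^ (d * j) := by
    rw [hm, sub_mul, div_mul_cancel₀ _ (hpos _).ne']
  refine le_antisymm ?_ (affineTestIdeal_antitone f
    (sub_le_self c (div_nonneg h0.le (hpos _).le)))
  have hle : frobeniusRoot p (d * j) f (repeatDigit (p ^ d) C j) ≤ affineTestIdeal p f c := by
    refine h.frobeniusRoot_le.trans ?_
    have h2 := le_iSup (fun e => frobeniusRoot p e f ⌈c * (p : ℝ) ^ e⌉₊) (d * j)
    have h3 := ceil_mul_pow hq hc h0 h1 j
    rw [Nat.cast_pow, ← pow_mul] at h3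
    rwa [h3] at h2
  refine iSup_le fun e => le_trans ?_ hle
  set b := c - c / (p : ℝ) ^ (d * j) with hb
  rcases le_total e (d * j) with he | he
  · obtain ⟨i, hi⟩ := Nat.exists_eq_add_of_le he
    rw [hi] at hm' ⊢
    refine frobeniusRoot_le_add k ?_
    have h4 : (repeatDigit (p ^ d) C j : ℝ) ≤ (⌈b * (p : ℝ) ^ e⌉₊ * p ^ i : ℕ) := by
      rw [hm', pow_add, ← mul_assoc]
      push_cast
      exact mul_le_mul_of_nonneg_right (Nat.le_ceil _) (hpos i).le
    exact_mod_cast h4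
  · obtain ⟨i, hi⟩ := Nat.exists_eq_add_of_le he
    rw [hi]
    refine frobeniusRoot_add_le ?_
    have h4 : b * (p : ℝ) ^ (d * j + i) = (repeatDigit (p ^ d) C j * p ^ i : ℕ) := by
      push_cast
      rw [hm', pow_add]
      ring
    rw [h4, Nat.ceil_natCast]

theorem exists_levelEq_of_affineTestIdeal_sub_eq (hd : 0 < d) (hC : C < p ^ d)
    (hc : (C : ℝ) = c * ((p ^ d : ℕ) - 1)) (h0 : 0 < c) (h1 : c ≤ 1) {ε : ℝ} (hε : 0 < ε)
    (h : affineTestIdeal p f (c - ε) = affineTestIdeal p f c) :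
    ∃ j, LevelEq k p f (d * j) (repeatDigit (p ^ d) C j) := by
  have hp : p.Prime := Fact.out
  have hq : 1 < p ^ d := Nat.one_lt_pow hd.ne' hp.one_lt
  have hq' : (1 : ℝ) < (p ^ d : ℕ) := by exact_mod_cast hq
  -- With q = p^d, q^e > c/ε gives (c - ε) q^e ≤ c q^e - c = r_e.
  obtain ⟨e, he⟩ := pow_unbounded_of_one_lt (c / ε) hq'
  refine exists_levelEq_of_frobeniusRoot_le hC (e := e) ?_
  calc frobeniusRoot p (d * e) f (repeatDigit (p ^ d) C e)
      ≤ frobeniusRoot p (d * e) f ⌈(c - ε) * (p : ℝ) ^ (d * e)⌉₊ := by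
        refine frobeniusRoot_antitone _ f (Nat.ceil_le.2 ?_)
        rw [cast_repeatDigit hq hc e, pow_mul, ← Nat.cast_pow p d]
        rw [div_lt_iff₀ hε] at he
        linarith
    _ ≤ affineTestIdeal p f (c - ε) :=
        le_iSup (fun e => frobeniusRoot p e f ⌈(c - ε) * (p : ℝ) ^ e⌉₊) (d * e)
    _ = affineTestIdeal p f c := h
    -- The levels divisible by d are cofinal, and at these the ceiling is the repeated-digit number
    -- plus one.
    _ ≤ _ := by
        refine iSup_le fun i => le_trans ?_ (le_iSup (fun i =>
          frobeniusRoot p (d * i) f (repeatDigit (p ^ d) C i + 1)) i)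
        obtain ⟨l, hl⟩ := Nat.exists_eq_add_of_le (Nat.le_mul_of_pos_left i hd)
        have h3 := ceil_mul_pow hq hc h0 h1 i
        change frobeniusRoot p i f ⌈c * (p : ℝ) ^ i⌉₊ ≤
          frobeniusRoot p (d * i) f (repeatDigit (p ^ d) C i + 1)
        rw [← h3, Nat.cast_pow, ← pow_mul, hl]
        refine frobeniusRoot_le_add k (Nat.ceil_le.2 ?_)
        push_cast
        rw [pow_add, ← mul_assoc]
        exact mul_le_mul_of_nonneg_right (Nat.le_ceil _) (pow_nonneg (Nat.cast_nonneg _) _)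

end PeriodicExponents

/-! ### Roots of the b-function and F-jumping exponents -/

section Roots

open CategoryTheory

variable {k : Type u} [Field k] {p : ℕ} [CharP k p] {X : Scheme.{u}}
  {π : X ⟶ Spec (CommRingCat.of k)} {f : Γ(X, ⊤)}

theorem charP_section (π : X ⟶ Spec (CommRingCat.of k)) (U : X.Opens) [Nontrivial Γ(X, U)] :
    CharP Γ(X, U) p :=
  charP_of_injective_ringHom (structureMap π U).injective p

variable [Fact p.Prime] [AlgebraicGeometry.IsIntegral X] [AlgebraicGeometry.Smooth π]

/-- The roots of the `b`-function in terms of the ideals generated by powers of `f` under the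
operators of bounded level. -/
theorem mem_padicRoots_bFunction_iff [CompactSpace X] {α : ℤ_[p]} :
    α ∈ padicRoots (bFunction p π f) ↔
      ∃ U : X.affineOpens, ∀ e, ¬ LevelEqOn π p f e (residue α e) U := by
  rw [mem_padicRoots_iff]
  constructor
  · intro h
    by_contra! h'
    obtain ⟨e, he⟩ := exists_levelEqOn_of_forall_exists h'
    refine h e (Submodule.mem_iInf _ |>.2 fun U => ?_)
    let := (structureMap π U).toAlgebra
    have : Algebra.Smooth k Γ(X, U) := smooth_structureMap π U
    rcases subsingleton_or_nontrivial Γ(X, U) with hU | hU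
    · intro m _
      have : Subsingleton (GraphLocalization (restrictFun f U)) :=
        (algebraMap Γ(X, U)[X] (GraphLocalization (restrictFun f U))).codomain_trivial
      rw [Subsingleton.elim (actionBf k (restrictFun f U) _ m) 0]
      exact zero_mem _
    · have : CharP Γ(X, U) p := charP_section π U
      exact digitProjector_mem_affineBFunction (he U) (residue_lt α e)
  · rintro ⟨U, hU⟩ e he
    let := (structureMap π U).toAlgebra
    rcases subsingleton_or_nontrivial Γ(X, U) with h | h
    · exact hU 0 .of_subsingleton
    · have : CharP Γ(X, U) p := charP_section π U
      obtain ⟨e', he', h1⟩ := exists_levelEq_of_digitProjector_mem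
        (Submodule.mem_iInf _ |>.1 he U)
      exact hU e' (h1 _ (residue_lt α e') (residue_modEq α he'))

theorem restrictFun_ne_zero (hf : f ≠ 0) (U : X.Opens) [Nonempty U] : restrictFun f U ≠ 0 := by
  intro h
  exact hf (map_injective_of_isIntegral X (homOfLE le_top : U ⟶ ⊤) (h.trans (map_zero _).symm))

/-- Both sides say (1 - p^d) α = C; the factor is nonzero in ℚ_p because p^d > 1. -/
theorem padic_eq_add_mul_iff {α : ℤ_[p]} {r : ℚ} {d C : ℕ} (hd : 0 < d)
    (hC : (C : ℚ) = r * (p ^ d - 1)) :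
    (α : ℚ_[p]) = -(r : ℚ_[p]) ↔ α = C + (p : ℤ_[p]) ^ d * α := by
  have hC' : (C : ℚ_[p]) = r * ((p : ℚ_[p]) ^ d - 1) := by
    exact_mod_cast congrArg (Rat.cast (K := ℚ_[p])) hC
  have h1 : (p : ℚ_[p]) ^ d - 1 ≠ 0 := by
    have : (p : ℕ) ^ d ≠ 1 := (Nat.one_lt_pow hd.ne' (Fact.out : p.Prime).one_lt).ne'
    rw [sub_ne_zero]
    exact_mod_cast this
  have h2 : α = C + (p : ℤ_[p]) ^ d * α ↔ (α : ℚ_[p]) = C + (p : ℚ_[p]) ^ d * α := by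
    refine ⟨fun h => by exact_mod_cast congrArg ((↑) : ℤ_[p] → ℚ_[p]) h, fun h => PadicInt.ext ?_⟩
    push_cast
    exact h
  rw [h2]
  rw [hC']
  constructor
  · intro h
    rw [h]
    ring
  · intro h
    refine mul_left_cancel₀ h1 ?_
    linear_combination -h

theorem isFJumpingExponent_of_forall_not_levelEqOn {U : X.affineOpens} (hf : f ≠ 0) {α : ℤ_[p]}
    (hα : ∀ e, ¬ LevelEqOn π p f e (residue α e) U) :
    ∃ r : ℚ, 0 < r ∧ r ≤ 1 ∧ ¬ p ∣ r.den ∧ IsFJumpingExponent p f (r : ℝ) ∧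
      (α : ℚ_[p]) = -(r : ℚ_[p]) := by
  have hp : p.Prime := Fact.out
  let := (structureMap π U).toAlgebra
  have : Algebra.Smooth k Γ(X, U) := smooth_structureMap π U
  have hU : Nonempty U := by
    by_contra h
    have := subsingleton_of_not_nonempty h
    exact hα 0 .of_subsingleton
  have : CharP Γ(X, U) p := charP_section π U
  set g := restrictFun f U with hg
  have hg0 : g ≠ 0 := restrictFun_ne_zero hf U
  have hα' : ∀ e, ¬ LevelEq k p g e (residue α e) := hα
  obtain ⟨d, C, hd, hC, hper⟩ := exists_periodic (Q := LevelEq k p g)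
    (fun e a b h => h.succ b) (fun e b h => LevelEq.of_succ h)
    (exists_bound_not_levelEq_of_smooth g) hα'
  have hres := residue_repeatDigit hC hper
  have hq : 1 < p ^ d := Nat.one_lt_pow hd.ne' hp.one_lt
  have hq' : (0 : ℚ) < (p : ℚ) ^ d - 1 := sub_pos.2 (by exact_mod_cast hq)
  -- C = 0 would mean that exponent 0 jumps at all levels dj, whereas the nonzero function g on a
  -- domain generates the unit ideal under operators of some level.
  have hC0 : C ≠ 0 := by
    rintro rfl
    obtain ⟨e, he⟩ := exists_levelEq_zero (k := k) (p := p) hg0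
    obtain ⟨i, hi⟩ := Nat.exists_eq_add_of_le (Nat.le_mul_of_pos_left e hd)
    refine hα' (d * e) ?_
    rw [hres, repeatDigit_zero, hi]
    have := he.add i 0
    rwa [zero_mul] at this
  set r : ℚ := C / (p ^ d - 1) with hr
  have hCr : (C : ℚ) = r * (p ^ d - 1) := (div_mul_cancel₀ _ hq'.ne').symm
  have hr0 : 0 < r := div_pos (by exact_mod_cast Nat.pos_of_ne_zero hC0) hq'
  have hr1 : r ≤ 1 := by
    rw [hr, div_le_one hq', le_sub_iff_add_le]
    exact_mod_cast hC
  refine ⟨r, hr0, hr1, ?_, ⟨by exact_mod_cast hr0, fun ε hε _ h => ?_⟩,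
    (padic_eq_add_mul_iff hd hCr).2 hper⟩
  · intro hpd
    have h1 : (r.den : ℤ) ∣ ((p ^ d - 1 : ℕ) : ℤ) := by
      have h2 := Rat.den_dvd (C : ℤ) ((p ^ d - 1 : ℕ) : ℤ)
      rw [Rat.divInt_eq_div] at h2
      push_cast [Nat.cast_sub hq.le] at h2 ⊢
      exact h2
    have h2 : p ∣ p ^ d - 1 := hpd.trans (by exact_mod_cast h1)
    have h3 : p ∣ 1 := by
      have := (Nat.dvd_sub_iff_right hq.le (dvd_pow_self p hd.ne')).1 h2
      exact this
    exact hp.one_lt.ne' (Nat.dvd_one.1 h3)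
  · have hCr' : (C : ℝ) = (r : ℝ) * ((p ^ d : ℕ) - 1) := by
      exact_mod_cast congrArg (Rat.cast (K := ℝ)) hCr
    obtain ⟨j, hj⟩ := exists_levelEq_of_affineTestIdeal_sub_eq k hd hC hCr'
      (by exact_mod_cast hr0) (by exact_mod_cast hr1) hε (congrFun h U)
    rw [← hres] at hj
    exact hα' _ hj

theorem exists_forall_not_levelEqOn_of_isFJumpingExponent [CompactSpace X] {α : ℤ_[p]} {r : ℚ}
    (hr0 : 0 < r) (hr1 : r ≤ 1) (hrp : ¬ p ∣ r.den) (hr : IsFJumpingExponent p f (r : ℝ))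
    (hα : (α : ℚ_[p]) = -(r : ℚ_[p])) :
    ∃ U : X.affineOpens, ∀ e, ¬ LevelEqOn π p f e (residue α e) U := by
  have hp : p.Prime := Fact.out
  by_contra! h
  obtain ⟨e, he⟩ := exists_levelEqOn_of_forall_exists h
  set d := r.den.totient with hd
  have hd0 : 0 < d := Nat.totient_pos.2 r.den_pos
  have hq : 1 < p ^ d := Nat.one_lt_pow hd0.ne' hp.one_lt
  have hq' : (0 : ℚ) < (p : ℚ) ^ d - 1 := sub_pos.2 (by exact_mod_cast hq)
  obtain ⟨C, hC⟩ : ∃ C : ℕ, (C : ℚ) = r * (p ^ d - 1) := by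
    -- Euler's theorem: d is the totient of the denominator, which is prime to p.
    have h1 : r.den ∣ p ^ d - 1 :=
      (Nat.modEq_iff_dvd' hq.le).1 (Nat.ModEq.pow_totient ((hp.coprime_iff_not_dvd).2 hrp)).symm
    obtain ⟨c, hc⟩ := h1
    refine ⟨r.num.toNat * c, ?_⟩
    have h2 : ((r.num.toNat : ℕ) : ℚ) = r.num := by
      exact_mod_cast congrArg (Int.cast (R := ℚ)) (Int.toNat_of_nonneg (Rat.num_pos.2 hr0).le)
    have h3 : (p : ℚ) ^ d - 1 = r.den * c := by
      have := congrArg (Nat.cast (R := ℚ)) hc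
      rw [Nat.cast_sub hq.le] at this
      exact_mod_cast this
    rw [h3, Nat.cast_mul, h2, ← mul_assoc, Rat.mul_den_eq_num]
  have hCq : C < p ^ d := by
    have : (C : ℚ) < (p : ℚ) ^ d := by nlinarith
    exact_mod_cast this
  have hper := (padic_eq_add_mul_iff hd0 hC).1 hα
  have hC' : (C : ℝ) = (r : ℝ) * ((p ^ d : ℕ) - 1) := by
    exact_mod_cast congrArg (Rat.cast (K := ℝ)) hC
  have hpos : (0 : ℝ) < (p : ℝ) ^ (d * e) := pow_pos (by exact_mod_cast hp.pos) _
  have hr0' : (0 : ℝ) < r := by exact_mod_cast hr0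
  refine hr.2 ((r : ℝ) / (p : ℝ) ^ (d * e)) (div_pos hr0' hpos)
    (div_le_self hr0'.le (one_le_pow₀ (by exact_mod_cast hp.one_le))) (funext fun U => ?_)
  rcases subsingleton_or_nontrivial Γ(X, U) with hU | hU
  · exact Subsingleton.elim _ _
  · let := (structureMap π U).toAlgebra
    have : Algebra.Smooth k Γ(X, U) := smooth_structureMap π U
    have : CharP Γ(X, U) p := charP_section π U
    have h1 := (he U).residue_mono (Nat.le_mul_of_pos_left e hd0)
    rw [residue_repeatDigit hCq hper] at h1
    exact affineTestIdeal_sub_eq k hd0 hC' hr0' (by exact_mod_cast hr1) h1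

end Roots

end CharPBFunction

end

theorem mainTheorem1 (p : ℕ) [Fact p.Prime] (k : Type u) [Field k] [CharP k p]
    (X : Scheme.{u}) (π : X ⟶ Spec (CommRingCat.of k))
    [AlgebraicGeometry.IsIntegral X] [IsSeparated π] [QuasiCompact π]
    [AlgebraicGeometry.Smooth π]
    (f : Γ(X, ⊤)) (hf : f ∉ Set.range (CharPBFunction.structureMap π ⊤)) :
    CharPBFunction.padicRoots (CharPBFunction.bFunction p π f) =
      {α : ℤ_[p] | ∃ r : ℚ, 0 < r ∧ r ≤ 1 ∧ ¬ p ∣ r.den ∧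
        CharPBFunction.IsFJumpingExponent p f (r : ℝ) ∧ (α : ℚ_[p]) = -(r : ℚ_[p])} := by
  have : CompactSpace X := QuasiCompact.compactSpace_of_compactSpace π
  have hf0 : f ≠ 0 := fun h => hf ⟨0, by rw [map_zero, h]⟩
  ext α
  rw [CharPBFunction.mem_padicRoots_bFunction_iff]
  constructor
  · rintro ⟨U, hU⟩
    exact CharPBFunction.isFJumpingExponent_of_forall_not_levelEqOn hf0 hU
  · rintro ⟨r, hr0, hr1, hrp, hr, hα⟩
    exact CharPBFunction.exists_forall_not_levelEqOn_of_isFJumpingExponent hr0 hr1 hrp hr hα
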